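/- **Proposition.** Let $n,m\ge 0$ be integers and let $\mathcal A^1,\dots,\mathcal A^n:\mathbb R^m\to\mathbb R^{m\times m}$ be smooth with symmetric values. Fix a paraproduct quantization as follows. Let $\chi:\mathbb R^n\to\mathbb R$ be smooth and radial with $\chi(\xi)=1$ for $|\xi|\le 1$ and $\chi(\xi)=0$ for $|\xi|\ge 2$. For $j,k\in\mathbb Z$ let $P_{<j}$ be the Fourier multiplier with symbol $\chi(\xi/2^{j-1})$, let $P_k=P_{<k+1}-P_{<k}$, and write $f_{<j}=P_{<j}f$, $g_k=P_kg$. Fix a frequency gap $N\ge 3$ (for instance $N=8$) and $k_0\in\mathbb Z\cup\{-\infty\}$, and for $f\in L^\infty(\mathbb R^n)$ (scalar or matrix-valued) set $$T_f g=\sum_{k>k_0} f_{<k-N}\,g_k ,$$ with convergence in the sense of tempered distributions ($k_0=-\infty$ gives the homogeneous, finite $k_0$ an inhomogeneous paraproduct). Let $T>0$ and let $u:[0,T]\times\mathbb R^n\to\mathbb R^m$ satisfy $u\in L^\infty_{t,x}$ and, for its weak spatial gradient, $\nabla u\in L^1_tL^\infty_x$; put $B(t)=\|\nabla u(t)\|_{L^\infty_x}$.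 Consider the linear paradifferential equation $$\partial_t w=\sum_{j=1}^n T_{\mathcal A^j(u)}\partial_j w+T_{D\mathcal A^j(u)\partial_j u}\,w,\qquad w(0)=w_0, \tag{1}$$ where $D\mathcal A^j(u)\partial_j u$ (summed over $j$) denotes the $m\times m$ matrix $v\mapsto\sum_j (D\mathcal A^j(u)v)\,\partial_j u$. A solution in $H^\sigma$ is a function $w\in C([0,T];H^\sigma)$ which satisfies (1), integrated in time from $0$, in the sense of distributions. Then for every $\sigma\in\mathbb R$ the problem (1) is well-posed in $H^\sigma=H^\sigma(\mathbb R^n;\mathbb C^m)$ on $[0,T]$: * (existence) for each $w_0\in H^\sigma$ there is a solution $w\in C([0,T];H^\sigma)$; * (uniqueness) the solution is unique in $C([0,T];H^\sigma)$; * (continuous dependence) the map $w_0\mapsto w$ is continuous from $H^\sigma$ to $C([0,T];H^\sigma)$; if $w_0$ is $\mathbb R^m$-valued then so is $w(t)$ for all $t\in[0,T]$, so the same holds in $H^\sigma(\mathbb R^n;\mathbb R^m)$. Moreover, for each $A\ge 0$ there is a constant $C$, depending only on $A$, $\sigma$, $n$, $m$, the functions $\mathcal A^j$ and the quantization $(\chi,N,k_0)$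 (and not on $T$, $u$, $w$), such that whenever $\|u\|_{L^\infty_{t,x}}\le A$, each solution $w\in C([0,T];H^\sigma)$ of (1) has $t\mapsto\|w(t)\|_{H^\sigma}^2$ absolutely continuous on $[0,T]$ and $$\frac{d}{dt}\|w(t)\|_{H^\sigma}^2\le C\,B(t)\,\|w(t)\|_{H^\sigma}^2\qquad\text{for a.e. }t\in[0,T].$$ -/

import Mathlib

open MeasureTheory Set Filter Topology TemperedDistribution
open scoped SchwartzMap FourierTransform LineDeriv ContDiff ENNReal

/-- The physical space `ℝⁿ`. -/
abbrev Rn (n : ℕ) := EuclideanSpace ℝ (Fin n)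

/-- The space `ℝᵐ` in which the background state `u` takes its values. -/
abbrev RVec (m : ℕ) := EuclideanSpace ℝ (Fin m)

/-- The (complexified) space `ℂᵐ` in which the unknown `w` takes its values. -/
abbrev CVec (m : ℕ) := EuclideanSpace ℂ (Fin m)

noncomputable section

/-! ### Sobolev norms -/

/-- The `H^σ` norm of a tempered distribution `f ∈ H^σ`, i.e. the `L²` norm of the Bessel
potential of order `σ` of `f` (and `0` if `f ∉ H^σ`). -/
def sobolevNorm {n m : ℕ} (σ : ℝ) (f : 𝓢'(Rn n, CVec m)) : ℝ :=
  open Classical in if h : MemSobolev σ 2 f then ‖h.choose‖ else 0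

/-- The `H^σ` norm is the `L²` norm of the function representing the Bessel potential. -/
theorem sobolevNorm_eq {n m : ℕ} {σ : ℝ} {f : 𝓢'(Rn n, CVec m)}
    {g : Lp (CVec m) 2 (volume : Measure (Rn n))}
    (h : besselPotential (Rn n) (CVec m) σ f = g) : sobolevNorm σ f = ‖g‖ := by
  have hf : MemSobolev σ 2 f := ⟨g, h⟩
  have hinj : Function.Injective
      (Lp.toTemperedDistributionCLM (CVec m) (volume : Measure (Rn n)) 2) :=
    LinearMap.ker_eq_bot.mp Lp.ker_toTemperedDistributionCLM_eq_bot
  have : hf.choose = g := hinj (by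
    simpa using hf.choose_spec.symm.trans h)
  simp [sobolevNorm, hf, this]

/-- `w ∈ C([0,T]; H^σ)`. -/
def ContInSobolev {n m : ℕ} (σ T : ℝ) (w : ℝ → 𝓢'(Rn n, CVec m)) : Prop :=
  (∀ t ∈ Icc 0 T, MemSobolev σ 2 (w t)) ∧
  ∀ t ∈ Icc 0 T, Tendsto (fun s => sobolevNorm σ (w s - w t)) (𝓝[Icc 0 T] t) (𝓝 0)

/-- A `ℂᵐ`-valued tempered distribution is real (`ℝᵐ`-valued) if all its components take real
values on real-valued test functions. -/
def IsRealDistribution {n m : ℕ} (f : 𝓢'(Rn n, CVec m)) : Prop :=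
  ∀ φ : 𝓢(Rn n, ℂ), (∀ x, (φ x).im = 0) → ∀ a, (f φ a).im = 0

/-! ### Littlewood-Paley projections and paraproducts -/

/-- A Littlewood-Paley cutoff: a smooth radial function on `ℝⁿ` which equals `1` on the unit
ball and vanishes for `‖ξ‖ ≥ 2`. -/
structure LPCutoff (n : ℕ) where
  toFun : Rn n → ℝ
  smooth : ContDiff ℝ ∞ toFun
  radial : ∀ ξ η, ‖ξ‖ = ‖η‖ → toFun ξ = toFun η
  eq_one : ∀ ξ, ‖ξ‖ ≤ 1 → toFun ξ = 1
  eq_zero : ∀ ξ, 2 ≤ ‖ξ‖ → toFun ξ = 0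

/-- The symbol `χ(ξ / 2^(j-1))` of `P_{<j} = ∑_{i<j} P_i`. -/
def LPCutoff.lowSymbol {n : ℕ} (χ : LPCutoff n) (j : ℤ) (ξ : Rn n) : ℂ :=
  (χ.toFun ((2 : ℝ) ^ (1 - j) • ξ) : ℂ)

/-- The symbol `χ(ξ / 2^k) - χ(ξ / 2^(k-1))` of `P_k`, supported in
`2^(k-1) ≤ ‖ξ‖ ≤ 2^(k+1)`. -/
def LPCutoff.blockSymbol {n : ℕ} (χ : LPCutoff n) (k : ℤ) (ξ : Rn n) : ℂ :=
  χ.lowSymbol (k + 1) ξ - χ.lowSymbol k ξ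

/-- The low frequency part `f_{<j} = P_{<j} f` of a bounded function `f`, as the convolution of
`f` with the inverse Fourier transform of the symbol of `P_{<j}`. -/
def LPCutoff.lowPass {n : ℕ} (χ : LPCutoff n) (j : ℤ) (f : Rn n → ℝ) (x : Rn n) : ℂ :=
  ∫ y, 𝓕⁻ (χ.lowSymbol j) (x - y) * (f y : ℂ)

/-- The Littlewood-Paley piece `g_k = P_k g` of a tempered distribution. -/
def LPCutoff.block {n m : ℕ} (χ : LPCutoff n) (k : ℤ) (g : 𝓢'(Rn n, CVec m)) :
    𝓢'(Rn n, CVec m) :=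
  fourierMultiplierCLM (CVec m) (χ.blockSymbol k) g

/-- The data on which a paraproduct depends: a Littlewood-Paley cutoff, the frequency gap, and the
lowest dyadic frequency `k₀` (exclusive), where `k₀ = ⊥` means that all `k ∈ ℤ` are used. -/
structure ParaQuantization (n : ℕ) where
  cutoff : LPCutoff n
  gap : ℤ
  three_le_gap : 3 ≤ gap
  lowest : WithBot ℤ

/-- The paraproduct `T_f g = ∑_{k > k₀} f_{<k-N} g_k`, for a bounded real-valued function `f`, with
convergence in the sense of tempered distributions. -/
def ParaQuantization.para {n m : ℕ} (Q : ParaQuantization n) (f : Rn n → ℝ)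
    (g : 𝓢'(Rn n, CVec m)) : 𝓢'(Rn n, CVec m) :=
  open Classical in
  ∑' k : ℤ, if Q.lowest < (k : WithBot ℤ) then
    smulLeftCLM (CVec m) (Q.cutoff.lowPass (k - Q.gap) f) (Q.cutoff.block k g) else 0

/-- The matrix unit `v ↦ v_b e_a` on `ℂᵐ`. -/
def matrixUnit {m : ℕ} (a b : Fin m) : CVec m →L[ℂ] CVec m :=
  (EuclideanSpace.proj b : CVec m →L[ℂ] ℂ).smulRight (EuclideanSpace.single a (1 : ℂ))

/-- The paraproduct `T_M g` with a matrix-valued function `M`: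
`(T_M g)_a = ∑_b T_{M_{ab}} g_b`. -/
def ParaQuantization.matPara {n m : ℕ} (Q : ParaQuantization n)
    (M : Rn n → Matrix (Fin m) (Fin m) ℝ) (g : 𝓢'(Rn n, CVec m)) : 𝓢'(Rn n, CVec m) :=
  ∑ a, ∑ b, PointwiseConvergenceCLM.postcomp (𝓢(Rn n, ℂ)) (matrixUnit a b)
    (Q.para (fun x => M x a b) g)

/-! ### The background state -/

/-- `Df` is the weak gradient of `f : ℝⁿ → ℝᵐ`. -/
def HasWeakGradient {n m : ℕ} (f : Rn n → RVec m) (Df : Rn n → (Rn n →L[ℝ] RVec m)) : Prop :=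
  ∀ φ : Rn n → ℝ, ContDiff ℝ ∞ φ → HasCompactSupport φ → ∀ v : Rn n,
    ∫ x, fderiv ℝ φ x v • f x = -∫ x, φ x • Df x v

/-- The control parameter `B(t) = ‖∇u(t)‖_{L^∞_x}`. -/
def controlB {n m : ℕ} (Du : ℝ → Rn n → (Rn n →L[ℝ] RVec m)) (t : ℝ) : ℝ≥0∞ :=
  eLpNorm (Du t) ⊤ volume

/-- `u ∈ L^∞_{t,x}([0,T] × ℝⁿ)` with norm at most `A`, and its spatial gradient `Du` is in
`L¹_t L^∞_x`. -/
structure IsBackground {n m : ℕ} (T A : ℝ) (u : ℝ → Rn n → RVec m)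
    (Du : ℝ → Rn n → (Rn n →L[ℝ] RVec m)) : Prop where
  measurable_u : AEStronglyMeasurable (Function.uncurry u)
    ((volume.restrict (Icc 0 T)).prod volume)
  measurable_Du : AEStronglyMeasurable (Function.uncurry Du)
    ((volume.restrict (Icc 0 T)).prod volume)
  bounded : ∀ᵐ p ∂((volume.restrict (Icc 0 T)).prod (volume : Measure (Rn n))), ‖u p.1 p.2‖ ≤ A
  gradient : ∀ᵐ t ∂(volume.restrict (Icc 0 T)), HasWeakGradient (u t) (Du t)
  integrable_B : ∫⁻ t in Icc 0 T, controlB Du t < ⊤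

/-! ### The linear paradifferential equation -/

/-- The matrix `D𝒜^j(u) ∂_j u` (summed over `j`), acting by `v ↦ ∑_j (D𝒜^j(u) v) ∂_j u`; `U` and
`DU` are the values of `u` and of its spatial gradient at a point. -/
def zerothOrderCoeff {n m : ℕ} (𝒜 : Fin n → RVec m → Matrix (Fin m) (Fin m) ℝ)
    (U : RVec m) (DU : Rn n →L[ℝ] RVec m) : Matrix (Fin m) (Fin m) ℝ :=
  fun a b => ∑ j, ∑ c, fderiv ℝ (fun V => 𝒜 j V a c) U (EuclideanSpace.single b 1) *
    DU (EuclideanSpace.single j 1) c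

/-- The right-hand side `∑_j T_{𝒜^j(u)} ∂_j w + T_{D𝒜^j(u) ∂_j u} w` at a fixed time. -/
def paraRHS {n m : ℕ} (Q : ParaQuantization n)
    (𝒜 : Fin n → RVec m → Matrix (Fin m) (Fin m) ℝ)
    (U : Rn n → RVec m) (DU : Rn n → (Rn n →L[ℝ] RVec m))
    (g : 𝓢'(Rn n, CVec m)) : 𝓢'(Rn n, CVec m) :=
  (∑ j, Q.matPara (fun x => 𝒜 j (U x)) (∂_{(EuclideanSpace.single j 1 : Rn n)} g)) +
    Q.matPara (fun x => zerothOrderCoeff 𝒜 (U x) (DU x)) g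

/-- `w ∈ C([0,T]; H^σ)` solves
`∂_t w = T_{𝒜^j(u)} ∂_j w + T_{D𝒜^j(u) ∂_j u} w`, `w(0) = w₀`, on `[0,T]`: the equation holds in the
sense of distributions, integrated in time. -/
structure IsParaSolution {n m : ℕ} (Q : ParaQuantization n)
    (𝒜 : Fin n → RVec m → Matrix (Fin m) (Fin m) ℝ) (T : ℝ)
    (u : ℝ → Rn n → RVec m) (Du : ℝ → Rn n → (Rn n →L[ℝ] RVec m)) (σ : ℝ)
    (w₀ : 𝓢'(Rn n, CVec m)) (w : ℝ → 𝓢'(Rn n, CVec m)) : Prop where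
  cont : ContInSobolev σ T w
  initial : w 0 = w₀
  integrable : ∀ φ : 𝓢(Rn n, ℂ),
    IntervalIntegrable (fun s => paraRHS Q 𝒜 (u s) (Du s) (w s) φ) volume 0 T
  equation : ∀ φ : 𝓢(Rn n, ℂ), ∀ t ∈ Icc 0 T,
    w t φ = w₀ φ + ∫ s in (0 : ℝ)..t, paraRHS Q 𝒜 (u s) (Du s) (w s) φ

/-- Hadamard well-posedness in `H^σ` on `[0,T]` of an evolution problem given by its solution
relation `Sol w₀ w` ("`w` is a `C([0,T]; H^σ)` solution with initial data `w₀`"). -/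
structure HadamardWellPosed {n m : ℕ} (σ T : ℝ)
    (Sol : 𝓢'(Rn n, CVec m) → (ℝ → 𝓢'(Rn n, CVec m)) → Prop) : Prop where
  existence : ∀ w₀, MemSobolev σ 2 w₀ → ∃ w, Sol w₀ w
  uniqueness : ∀ w₀ w w', Sol w₀ w → Sol w₀ w' → ∀ t ∈ Icc 0 T, w t = w' t
  continuity : ∀ w₀, MemSobolev σ 2 w₀ → ∀ ε > 0, ∃ δ > 0, ∀ w₀' w w', Sol w₀ w → Sol w₀' w' →
    sobolevNorm σ (w₀' - w₀) < δ → ∀ t ∈ Icc 0 T, sobolevNorm σ (w' t - w t) < ε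

end

/-!
The equation is a symmetric hyperbolic system at the paradifferential level, and the proof is an
energy method whose estimates involve the gradient of `u` only through `B(t)`.

**Reduction to `L²`.** Bessel potentials identify `H^σ` with `L²` (`sobolevEmb`). In these
coordinates the equation becomes `S v' = Γ(t) v`, where `S` is the Bessel potential of order `-1`
and `Γ(t)`, the `generator`, is a bounded operator on `L²` whose norm is integrable in time
(`IsEvolution.isParaSolution`, `IsParaSolution.exists_isEvolution`). It is a sum over `k` of pieces
`paraTerm` localized at the frequency `2 ^ k` in input and output, which are uniformly bounded, and
whose sum converges strongly by almost orthogonality (`exists_hasSum_localized`). Since the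
frequency gap localizes the products `f_{<k-N} g_k`, this is the same operator as the series of
tempered distributions (`paraRHS_sobolevEmb`).

**The energy estimate.** For the frequency truncations `J_K = χ(2 ^ (-K) D)` one has, uniformly in
`K`, `|Re ⟨J_K S⁻¹ Γ(t) x, J_K x⟩| ≤ C B(t) ‖x‖²` (`ParaQuantization.exists_energy_bound`). On a
piece at the frequency `2 ^ k` the left-hand side is `Re ⟨A g(D) y, Θ(D) y⟩` with a symmetric matrix
`A`, the skew multiplier `g(D) = ∂_j P_k`, and `Θ` the localized square of the energy weight. By
symmetry it is expressed by the commutators of `A` with `Θ(D)` and `g(D)`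
(`abs_re_inner_le_commutator`). Commutators with a multiplier are bounded by the Lipschitz constant
of `A` times the first moment of the kernel (`norm_commutator_le`). The kernels have dyadic size,
for `Θ` uniformly in `K`, because after rescaling the symbols form a smooth family over a compact
parameter space (`exists_symbolBound_energy`). The Lipschitz constant of `𝒜^j(u)` is at most a
multiple of `B(t)` (`exists_lipschitz_of_weakGradient`), and so is the size of the zeroth order
coefficient, for which no cancellation is needed.

**Abstract evolution equations.** For an `EnergyGenerator`, regularizing by `J_K` bounds the
increments of `‖v‖²` by `∫ 2 b ‖v‖²` (`IsEvolution.abs_norm_sq_sub_le`). This gives the absolute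
continuity of the norm and its differential inequality and, through Gronwall's inequality,
uniqueness and continuous dependence. For existence, the truncated equations
`v' = J_K S⁻¹ Γ(t) J_K v` have bounded generators and are solved by a Picard iteration. With data in
the range of `S²` their solutions are bounded two orders higher, by the energy estimate in
`H^(σ+2)`, and therefore Cauchy in `H^σ` (`exists_isEvolution_of_smooth`); general data are treated
by density (`exists_isEvolution`).

**Reality.** The operator has real coefficients and Hermitian symbols, so it commutes with complex
conjugation (`ParaQuantization.conjOp_rhsOp`), and uniqueness shows that solutions with real data
are real.
-/

/-! ### Absolutely continuous functions and Gronwall's inequality -/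

/-- A function whose increments are controlled by those of an absolutely continuous function is
absolutely continuous. -/
theorem AbsolutelyContinuousOnInterval.of_dist_le {X : Type*} [PseudoMetricSpace X] {f : ℝ → X}
    {g : ℝ → ℝ} {a b C : ℝ} (hg : AbsolutelyContinuousOnInterval g a b)
    (h : ∀ x ∈ uIcc a b, ∀ y ∈ uIcc a b, dist (f x) (f y) ≤ C * dist (g x) (g y)) :
    AbsolutelyContinuousOnInterval f a b := by
  have h2 := Tendsto.const_mul C hg
  rw [mul_zero] at h2
  refine squeeze_zero' (Eventually.of_forall fun E => Finset.sum_nonneg fun _ _ => dist_nonneg)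
    ?_ h2
  have : ∀ᶠ E in AbsolutelyContinuousOnInterval.totalLengthFilter ⊓
      𝓟 (AbsolutelyContinuousOnInterval.disjWithin a b),
      E ∈ AbsolutelyContinuousOnInterval.disjWithin a b :=
    eventually_inf_principal.mpr (by simp)
  filter_upwards [this] with E hE
  rw [Finset.mul_sum]
  exact Finset.sum_le_sum fun i hi => h _ (hE.1 i hi).1 _ (hE.1 i hi).2

theorem intervalIntegrable_of_mem_Icc {E : Type*} [NormedAddCommGroup E] {f : ℝ → E} {T s t : ℝ}
    (hf : IntervalIntegrable f volume 0 T) (hs : s ∈ Icc 0 T) (ht : t ∈ Icc 0 T) :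
    IntervalIntegrable f volume s t := by
  refine hf.mono_set ?_
  rw [uIcc_of_le (hs.1.trans hs.2)]
  exact uIcc_subset_Icc hs ht

theorem aestronglyMeasurable_Icc_of_intervalIntegrable {E : Type*} [NormedAddCommGroup E]
    {f : ℝ → E} {T : ℝ} (hT : 0 ≤ T) (hf : IntervalIntegrable f volume 0 T) :
    AEStronglyMeasurable f (volume.restrict (Icc 0 T)) :=
  ((intervalIntegrable_iff_integrableOn_Icc_of_le hT).mp hf).aestronglyMeasurable

theorem intervalIntegrable_of_ae_le {E : Type*} [NormedAddCommGroup E]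
    {f : ℝ → E} {g : ℝ → ℝ} {T : ℝ} (hT : 0 ≤ T)
    (hf : AEStronglyMeasurable f (volume.restrict (Icc 0 T)))
    (hg : IntervalIntegrable g volume 0 T)
    (h : ∀ᵐ s ∂(volume.restrict (Icc 0 T)), ‖f s‖ ≤ g s) :
    IntervalIntegrable f volume 0 T := by
  rw [intervalIntegrable_iff_integrableOn_Icc_of_le hT] at hg ⊢
  exact Integrable.mono' hg hf h

theorem ae_restrict_uIoc_of_Icc {p : ℝ → Prop} {T s t : ℝ}
    (h : ∀ᵐ r ∂(volume.restrict (Icc 0 T)), p r) (hs : s ∈ Icc 0 T) (ht : t ∈ Icc 0 T) :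
    ∀ᵐ r, r ∈ uIoc s t → p r := by
  rw [ae_restrict_iff' measurableSet_Icc] at h
  filter_upwards [h] with r hr hrs
  exact hr (uIcc_subset_Icc hs ht (uIoc_subset_uIcc hrs))

theorem integral_mono_of_ae_Icc {f g : ℝ → ℝ} {T t : ℝ}
    (hf : IntervalIntegrable f volume 0 T) (hg : IntervalIntegrable g volume 0 T)
    (h : ∀ᵐ s ∂(volume.restrict (Icc 0 T)), f s ≤ g s) (ht : t ∈ Icc 0 T) :
    ∫ s in (0 : ℝ)..t, f s ≤ ∫ s in (0 : ℝ)..t, g s := by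
  have h0 : (0 : ℝ) ∈ Icc 0 T := ⟨le_rfl, ht.1.trans ht.2⟩
  refine intervalIntegral.integral_mono_ae_restrict ht.1
    (intervalIntegrable_of_mem_Icc hf h0 ht) (intervalIntegrable_of_mem_Icc hg h0 ht) ?_
  exact ae_restrict_of_ae_restrict_of_subset (Icc_subset_Icc_right ht.2) h

theorem integral_nonneg_of_ae_Icc {f : ℝ → ℝ} {T s t : ℝ}
    (h : ∀ᵐ s ∂(volume.restrict (Icc 0 T)), 0 ≤ f s) (hs : s ∈ Icc 0 T) (ht : t ∈ Icc 0 T)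
    (hst : s ≤ t) : 0 ≤ ∫ r in s..t, f r :=
  intervalIntegral.integral_nonneg_of_ae_restrict hst
    (ae_restrict_of_ae_restrict_of_subset (Icc_subset_Icc hs.1 ht.2) h)

theorem continuousOn_primitive_Icc {E : Type*} [NormedAddCommGroup E] [NormedSpace ℝ E]
    {f : ℝ → E} {T : ℝ} (hT : 0 ≤ T) (hf : IntervalIntegrable f volume 0 T) :
    ContinuousOn (fun t => ∫ s in (0 : ℝ)..t, f s) (Icc 0 T) := by
  have := intervalIntegral.continuousOn_primitive_interval' hf (a := 0) left_mem_uIcc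
  rwa [uIcc_of_le hT] at this

/-- The exponential of an absolutely continuous function is absolutely continuous, since `exp` is
Lipschitz on bounded sets. -/
theorem AbsolutelyContinuousOnInterval.exp_comp {g : ℝ → ℝ} {a b : ℝ}
    (hg : AbsolutelyContinuousOnInterval g a b) :
    AbsolutelyContinuousOnInterval (fun t => Real.exp (g t)) a b := by
  obtain ⟨K, hK⟩ := hg.exists_bound
  refine AbsolutelyContinuousOnInterval.of_dist_le (C := Real.exp K) hg fun x hx y hy => ?_
  have hconv : Convex ℝ (Iic K) := convex_Iic K
  have := hconv.norm_image_sub_le_of_norm_deriv_le (f := Real.exp) (C := Real.exp K)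
    (fun x _ => Real.differentiableAt_exp) (fun x hx => by
      rw [Real.deriv_exp, Real.norm_eq_abs, Real.abs_exp]
      exact Real.exp_le_exp.mpr hx)
    ((le_abs_self _).trans (hK y hy)) ((le_abs_self _).trans (hK x hx))
  simpa [dist_eq_norm] using this

/-- The weight `exp (∫ β)` integrates explicitly against `β`. This is the computation behind both
Gronwall's inequality and the contraction property of the Picard map. -/
theorem integral_mul_exp_primitive {β : ℝ → ℝ} {T t : ℝ} (hβ : IntervalIntegrable β volume 0 T)
    (ht : t ∈ Icc 0 T) :
    ∫ s in (0 : ℝ)..t, β s * Real.exp (∫ r in (0 : ℝ)..s, β r) =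
      Real.exp (∫ r in (0 : ℝ)..t, β r) - 1 := by
  have h0 : (0 : ℝ) ∈ Icc 0 T := ⟨le_rfl, ht.1.trans ht.2⟩
  have hβt := intervalIntegrable_of_mem_Icc hβ h0 ht
  have hac := (hβt.absolutelyContinuousOnInterval_intervalIntegral (c := 0) left_mem_uIcc).exp_comp
  have := hac.integral_deriv_eq_sub
  simp only [intervalIntegral.integral_same, Real.exp_zero] at this
  rw [← this]
  refine intervalIntegral.integral_congr_ae ?_
  filter_upwards [hβt.ae_hasDerivAt_integral] with s hs hst
  have := (hs (uIoc_subset_uIcc hst) 0 left_mem_uIcc).exp.deriv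
  rw [this]; ring

/-- Gronwall's inequality in integral form, with an integrable coefficient. -/
theorem gronwall_integral {β y : ℝ → ℝ} {T a : ℝ} (hT : 0 ≤ T)
    (hβ : IntervalIntegrable β volume 0 T)
    (hβ0 : ∀ᵐ s ∂(volume.restrict (Icc 0 T)), 0 ≤ β s) (hy : ContinuousOn y (Icc 0 T))
    (h : ∀ t ∈ Icc 0 T, y t ≤ a + ∫ s in (0 : ℝ)..t, β s * y s) :
    ∀ t ∈ Icc 0 T, y t ≤ a * Real.exp (∫ s in (0 : ℝ)..t, β s) := by
  set b : ℝ → ℝ := fun t => ∫ s in (0 : ℝ)..t, β s with hb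
  have hbc : ContinuousOn b (Icc 0 T) := continuousOn_primitive_Icc hT hβ
  obtain ⟨r, hr, hmax⟩ := isCompact_Icc.exists_isMaxOn (nonempty_Icc.mpr hT)
    (hy.mul (Real.continuous_exp.comp_continuousOn hbc.neg))
  set m := y r * Real.exp (-b r) with hm
  have hle : ∀ t ∈ Icc 0 T, y t ≤ m * Real.exp (b t) := fun t ht => by
    have h1 : y t * Real.exp (-b t) ≤ m := hmax ht
    calc y t = y t * Real.exp (-b t) * Real.exp (b t) := by
          rw [mul_assoc, ← Real.exp_add]; simp
      _ ≤ _ := by gcongr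
  have huIcc : uIcc 0 T = Icc 0 T := uIcc_of_le hT
  have h1 : ∫ s in (0 : ℝ)..r, β s * y s ≤ ∫ s in (0 : ℝ)..r, m * (β s * Real.exp (b s)) := by
    refine integral_mono_of_ae_Icc (hβ.mul_continuousOn (huIcc ▸ hy)) ?_ ?_ hr
    · exact (hβ.mul_continuousOn (huIcc ▸ Real.continuous_exp.comp_continuousOn hbc)).const_mul m
    · filter_upwards [hβ0, ae_restrict_mem measurableSet_Icc] with s hs hsI
      calc β s * y s ≤ β s * (m * Real.exp (b s)) := by gcongr; exact hle s hsI
        _ = _ := by ring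
  rw [intervalIntegral.integral_const_mul, integral_mul_exp_primitive hβ hr] at h1
  have h2 : y r = m * Real.exp (b r) := by
    rw [hm, mul_assoc, ← Real.exp_add]; simp
  have hma : m ≤ a := by
    have := h r hr
    rw [h2] at this
    simp only [hb] at this h1 ⊢
    linarith
  intro t ht
  exact (hle t ht).trans (by gcongr)

/-! ### Linear evolution equations with integrable coefficients -/

section Evolution

variable {H : Type*} [NormedAddCommGroup H] [InnerProductSpace ℂ H] [CompleteSpace H]

/-- The energy identity for the primitive of an integrable function. -/
theorem norm_sq_primitive {g y : ℝ → H} {y₀ : H} {T : ℝ}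
    (hg : IntervalIntegrable g volume 0 T)
    (hy : ∀ t ∈ Icc 0 T, y t = y₀ + ∫ s in (0 : ℝ)..t, g s) {s t : ℝ} (hs : s ∈ Icc 0 T)
    (ht : t ∈ Icc 0 T) :
    ‖y t‖ ^ 2 - ‖y s‖ ^ 2 = ∫ r in s..t, 2 * (inner ℂ (g r) (y r)).re := by
  have h0 : (0 : ℝ) ∈ Icc 0 T := ⟨le_rfl, ht.1.trans ht.2⟩
  have hT := ht.1.trans ht.2
  set z : ℝ → H := fun t => y₀ + ∫ s in (0 : ℝ)..t, g s with hz
  have hzc : ContinuousOn z (Icc 0 T) := continuousOn_const.add (continuousOn_primitive_Icc hT hg)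
  obtain ⟨K, hK⟩ := isCompact_Icc.exists_bound_of_continuousOn hzc
  have hac : AbsolutelyContinuousOnInterval (fun t => ‖z t‖ ^ 2) 0 T := by
    refine AbsolutelyContinuousOnInterval.of_dist_le (C := 2 * K)
      (hg.norm.absolutelyContinuousOnInterval_intervalIntegral (c := 0) left_mem_uIcc) ?_
    rw [uIcc_of_le hT]
    intro x hx w hw
    have h1 : ‖z x - z w‖ ≤ |∫ r in w..x, ‖g r‖| := by
      simp only [hz, add_sub_add_left_eq_sub]
      rw [intervalIntegral.integral_interval_sub_left (intervalIntegrable_of_mem_Icc hg h0 hx)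
        (intervalIntegrable_of_mem_Icc hg h0 hw)]
      exact intervalIntegral.norm_integral_le_abs_integral_norm
    rw [Real.dist_eq, Real.dist_eq, intervalIntegral.integral_interval_sub_left
      (intervalIntegrable_of_mem_Icc hg.norm h0 hx) (intervalIntegrable_of_mem_Icc hg.norm h0 hw)]
    have h2 : |‖z x‖ ^ 2 - ‖z w‖ ^ 2| = (‖z x‖ + ‖z w‖) * |‖z x‖ - ‖z w‖| := by
      rw [show ‖z x‖ ^ 2 - ‖z w‖ ^ 2 = (‖z x‖ + ‖z w‖) * (‖z x‖ - ‖z w‖) by ring, abs_mul]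
      rw [abs_of_nonneg (by positivity : 0 ≤ ‖z x‖ + ‖z w‖)]
    rw [h2]
    calc _ ≤ (K + K) * |∫ r in w..x, ‖g r‖| :=
          mul_le_mul (add_le_add (hK x hx) (hK w hw)) ((abs_norm_sub_norm_le _ _).trans h1)
            (abs_nonneg _) (by linarith [norm_nonneg (z x), hK x hx])
      _ = _ := by ring
  have hac' := hac.mono (c := s) (d := t) (by
    rw [uIcc_of_le hT]; exact uIcc_subset_Icc hs ht)
  rw [hy t ht, hy s hs]
  change ‖z t‖ ^ 2 - ‖z s‖ ^ 2 = _
  rw [← hac'.integral_deriv_eq_sub]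
  refine intervalIntegral.integral_congr_ae ?_
  filter_upwards [hg.ae_hasDerivAt_integral] with r hr hrst
  have hrI : r ∈ Icc 0 T := uIcc_subset_Icc hs ht (uIoc_subset_uIcc hrst)
  have hd : HasDerivAt z (g r) r := by
    have := hr (by rwa [uIcc_of_le hT]) 0 left_mem_uIcc
    exact this.const_add y₀
  let _ : InnerProductSpace ℝ H := InnerProductSpace.complexToReal
  rw [hd.norm_sq.deriv, hy r hrI, real_inner_comm, real_inner_eq_re_inner ℂ]
  rfl

/-- A strongly measurable family of operators applied to a measurable function is measurable. -/
theorem aestronglyMeasurable_clm_apply {α : Type*} [MeasurableSpace α] {μ : Measure α}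
    {F G : Type*} [NormedAddCommGroup F] [NormedSpace ℂ F] [NormedAddCommGroup G] [NormedSpace ℂ G]
    {O : α → F →L[ℂ] G} {y : α → F} (hO : ∀ x, AEStronglyMeasurable (fun s => O s x) μ)
    (hy : AEStronglyMeasurable y μ) : AEStronglyMeasurable (fun s => O s (y s)) μ := by
  have hsimple : ∀ f : SimpleFunc α F, AEStronglyMeasurable (fun s => O s (f s)) μ := by
    intro f
    induction f using SimpleFunc.induction with
    | const c hs =>
      refine ((hO c).indicator hs).congr (Eventually.of_forall fun x => ?_)
      rename_i S
      by_cases hx : x ∈ S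
      · rw [indicator_of_mem hx]; simp [SimpleFunc.piecewise, hx]
      · rw [indicator_of_notMem hx]; simp [SimpleFunc.piecewise, hx]
    | add _ hf hg =>
      simpa using! hf.add hg
  refine aestronglyMeasurable_of_tendsto_ae atTop
    (f := fun n s => O s (hy.stronglyMeasurable_mk.approx n s)) (fun n => hsimple _) ?_
  filter_upwards [hy.ae_eq_mk] with s hs
  rw [hs]
  exact ((O s).continuous.tendsto _).comp (hy.stronglyMeasurable_mk.tendsto_approx s)

end Evolution

section Evolution

set_option linter.unusedSectionVars false

variable {H : Type*} [NormedAddCommGroup H] [InnerProductSpace ℂ H] [CompleteSpace H]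

theorem intervalIntegrable_clm_apply {O : ℝ → H →L[ℂ] H} {β : ℝ → ℝ} {T : ℝ} (hT : 0 ≤ T)
    (hO : ∀ x, AEStronglyMeasurable (fun s => O s x) (volume.restrict (Icc 0 T)))
    (hβ : IntervalIntegrable β volume 0 T)
    (hle : ∀ᵐ s ∂(volume.restrict (Icc 0 T)), ‖O s‖ ≤ β s)
    {y : ℝ → H} (hy : ContinuousOn y (Icc 0 T)) :
    IntervalIntegrable (fun s => O s (y s)) volume 0 T := by
  obtain ⟨K, hK⟩ := isCompact_Icc.exists_bound_of_continuousOn hy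
  refine intervalIntegrable_of_ae_le hT
    (aestronglyMeasurable_clm_apply hO (hy.aestronglyMeasurable measurableSet_Icc))
    (hβ.mul_const K) ?_
  filter_upwards [hle, ae_restrict_mem measurableSet_Icc] with s hs hsI
  exact ((O s).le_opNorm _).trans (mul_le_mul hs (hK s hsI) (norm_nonneg _)
    ((norm_nonneg _).trans hs))

/-- Linear equations `X' = O(t) X` whose bounded generator has an integrable norm are solvable:
in the norm weighted by `exp (-∫ 2β)` the Picard map contracts by a factor `1/2`. -/
theorem exists_linear_ode_solution {O : ℝ → H →L[ℂ] H} {β : ℝ → ℝ} {T : ℝ} (hT : 0 ≤ T)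
    (hO : ∀ x, AEStronglyMeasurable (fun s => O s x) (volume.restrict (Icc 0 T)))
    (hβ : IntervalIntegrable β volume 0 T)
    (hle : ∀ᵐ s ∂(volume.restrict (Icc 0 T)), ‖O s‖ ≤ β s) (x₀ : H) :
    ∃ X : ℝ → H, ContinuousOn X (Icc 0 T) ∧
      ∀ t ∈ Icc 0 T, X t = x₀ + ∫ s in (0 : ℝ)..t, O s (X s) := by
  have h0 : (0 : ℝ) ∈ Icc 0 T := ⟨le_rfl, hT⟩
  have hβ2 : IntervalIntegrable (fun s => 2 * β s) volume 0 T := hβ.const_mul 2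
  set b : ℝ → ℝ := fun t => ∫ s in (0 : ℝ)..t, 2 * β s with hb
  have hbc : ContinuousOn b (Icc 0 T) := continuousOn_primitive_Icc hT hβ2
  have hexp : ContinuousOn (fun s => Real.exp (b s)) (Icc 0 T) :=
    Real.continuous_exp.comp_continuousOn hbc
  have hW : ∀ Y : C(Icc (0 : ℝ) T, H),
      ContinuousOn (fun s => Real.exp (b s) • Y (projIcc 0 T hT s)) (Icc 0 T) := fun Y =>
    hexp.smul (Y.continuous.comp continuous_projIcc).continuousOn
  have hF : ∀ Y : C(Icc (0 : ℝ) T, H), IntervalIntegrable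
      (fun s => O s (Real.exp (b s) • Y (projIcc 0 T hT s))) volume 0 T := fun Y =>
    intervalIntegrable_clm_apply hT hO hβ hle (hW Y)
  set g : C(Icc (0 : ℝ) T, H) → ℝ → H := fun Y t => Real.exp (-b t) • (x₀ +
    ∫ s in (0 : ℝ)..t, O s (Real.exp (b s) • Y (projIcc 0 T hT s))) with hg
  have hgc : ∀ Y, ContinuousOn (g Y) (Icc 0 T) := fun Y =>
    (Real.continuous_exp.comp_continuousOn hbc.neg).smul
      (continuousOn_const.add (continuousOn_primitive_Icc hT (hF Y)))
  let Ψ : C(Icc (0 : ℝ) T, H) → C(Icc (0 : ℝ) T, H) := fun Y =>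
    ⟨fun t => g Y t, (hgc Y).comp_continuous continuous_subtype_val fun t => t.2⟩
  have hΨg : ∀ Y t (ht : t ∈ Icc 0 T), Ψ Y ⟨t, ht⟩ = g Y t := fun _ _ _ => rfl
  have hΨ : ContractingWith (1 / 2) Ψ := by
    refine ⟨by norm_num, LipschitzWith.of_dist_le_mul fun Y Z => ?_⟩
    rw [dist_eq_norm, ContinuousMap.norm_le _ (by positivity)]
    rintro ⟨t, ht⟩
    have hsub : (Ψ Y - Ψ Z) ⟨t, ht⟩ = Real.exp (-b t) • ∫ s in (0 : ℝ)..t,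
        O s (Real.exp (b s) • (Y (projIcc 0 T hT s) - Z (projIcc 0 T hT s))) := by
      rw [ContinuousMap.sub_apply, hΨg, hΨg]
      simp only [hg, ← smul_sub, add_sub_add_left_eq_sub]
      rw [← intervalIntegral.integral_sub (intervalIntegrable_of_mem_Icc (hF Y) h0 ht)
        (intervalIntegrable_of_mem_Icc (hF Z) h0 ht)]
      simp only [smul_sub, map_sub]
    rw [hsub, norm_smul, Real.norm_eq_abs, Real.abs_exp]
    have h1 : ‖∫ s in (0 : ℝ)..t,
        O s (Real.exp (b s) • (Y (projIcc 0 T hT s) - Z (projIcc 0 T hT s)))‖ ≤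
        ∫ s in (0 : ℝ)..t, (dist Y Z / 2) * (2 * β s * Real.exp (b s)) := by
      refine intervalIntegral.norm_integral_le_of_norm_le ht.1 ?_ ?_
      · have := (ae_restrict_iff' measurableSet_Icc).mp hle
        filter_upwards [this] with s hs hst
        have hs' := hs ⟨hst.1.le, hst.2.trans ht.2⟩
        refine ((O s).le_opNorm _).trans ?_
        rw [norm_smul, Real.norm_eq_abs, Real.abs_exp]
        have h3 : ‖Y (projIcc 0 T hT s) - Z (projIcc 0 T hT s)‖ ≤ dist Y Z := by
          rw [← dist_eq_norm]; exact ContinuousMap.dist_apply_le_dist _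
        have h4 : 0 ≤ β s := (norm_nonneg _).trans hs'
        calc _ ≤ β s * (Real.exp (b s) * dist Y Z) := by gcongr
          _ = _ := by ring
      · refine intervalIntegrable_of_mem_Icc ?_ h0 ht
        exact (hβ2.mul_continuousOn (by rwa [uIcc_of_le hT])).const_mul _
    rw [intervalIntegral.integral_const_mul, integral_mul_exp_primitive hβ2 ht] at h1
    calc _ ≤ Real.exp (-b t) * (dist Y Z / 2 * (Real.exp (b t) - 1)) := by gcongr
      _ = dist Y Z / 2 * (1 - Real.exp (-b t)) := by
        have : Real.exp (-b t) * Real.exp (b t) = 1 := by rw [← Real.exp_add]; simp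
        linear_combination (dist Y Z / 2) * this
      _ ≤ dist Y Z / 2 * 1 := by
        have := Real.exp_pos (-b t)
        gcongr; linarith
      _ = _ := by simp; ring
  have hY : Ψ (ContractingWith.fixedPoint Ψ hΨ) = ContractingWith.fixedPoint Ψ hΨ :=
    hΨ.fixedPoint_isFixedPt
  set Y := ContractingWith.fixedPoint Ψ hΨ
  refine ⟨fun s => Real.exp (b s) • Y (projIcc 0 T hT s), hW Y, fun t ht => ?_⟩
  have h2 : Y ⟨t, ht⟩ = g Y t := by rw [← hΨg Y t ht, hY]
  simp only [projIcc_of_mem hT ht]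
  rw [h2]
  simp only [hg]
  rw [smul_smul, ← Real.exp_add]; simp

/-- Energy estimate for `y' = O(t) y + f` when `Re ⟨O(t) x, x⟩ ≤ b(t) ‖x‖²` and `‖f‖ ≤ γ`. The
forcing is absorbed by `2 ‖y‖ ≤ 1 + ‖y‖²`. -/
theorem norm_sq_le_of_forced {O : ℝ → H →L[ℂ] H} {y f : ℝ → H} {y₀ : H} {b γ : ℝ → ℝ} {T : ℝ}
    (hT : 0 ≤ T) (hint : IntervalIntegrable (fun s => O s (y s) + f s) volume 0 T)
    (hyc : ContinuousOn y (Icc 0 T))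
    (hy : ∀ t ∈ Icc 0 T, y t = y₀ + ∫ s in (0 : ℝ)..t, (O s (y s) + f s))
    (hb : IntervalIntegrable b volume 0 T) (hγ : IntervalIntegrable γ volume 0 T)
    (hb0 : ∀ᵐ s ∂(volume.restrict (Icc 0 T)), 0 ≤ b s)
    (hO : ∀ᵐ s ∂(volume.restrict (Icc 0 T)), ∀ x, (inner ℂ (O s x) x).re ≤ b s * ‖x‖ ^ 2)
    (hf : ∀ᵐ s ∂(volume.restrict (Icc 0 T)), ‖f s‖ ≤ γ s) :
    ∀ t ∈ Icc 0 T, ‖y t‖ ^ 2 ≤ (‖y₀‖ ^ 2 + ∫ s in (0 : ℝ)..T, γ s) *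
      Real.exp (∫ s in (0 : ℝ)..T, (2 * b s + γ s)) := by
  have h0 : (0 : ℝ) ∈ Icc 0 T := ⟨le_rfl, hT⟩
  have hTT : T ∈ Icc 0 T := ⟨hT, le_rfl⟩
  have hγ0 : ∀ᵐ s ∂(volume.restrict (Icc 0 T)), 0 ≤ γ s :=
    hf.mono fun s hs => (norm_nonneg _).trans hs
  have hc0 : ∀ᵐ s ∂(volume.restrict (Icc 0 T)), 0 ≤ 2 * b s + γ s := by
    filter_upwards [hb0, hγ0] with s h1 h2; positivity
  have hc : IntervalIntegrable (fun s => 2 * b s + γ s) volume 0 T := (hb.const_mul 2).add hγ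
  have hy2 : ContinuousOn (fun t => ‖y t‖ ^ 2) (Icc 0 T) := hyc.norm.pow 2
  have hcy : IntervalIntegrable (fun s => (2 * b s + γ s) * ‖y s‖ ^ 2) volume 0 T :=
    hc.mul_continuousOn (by rwa [uIcc_of_le hT])
  have hy0 : y 0 = y₀ := by rw [hy 0 h0]; simp
  have key : ∀ t ∈ Icc 0 T, ‖y t‖ ^ 2 ≤ (‖y₀‖ ^ 2 + ∫ s in (0 : ℝ)..T, γ s) +
      ∫ s in (0 : ℝ)..t, (2 * b s + γ s) * ‖y s‖ ^ 2 := by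
    intro t ht
    have h1 := norm_sq_primitive hint hy h0 ht
    rw [hy0] at h1
    have hmeas : AEStronglyMeasurable (fun r => 2 * (inner ℂ (O r (y r) + f r) (y r)).re)
        (volume.restrict (Icc 0 T)) := by
      have := (aestronglyMeasurable_Icc_of_intervalIntegrable hT hint).inner (𝕜 := ℂ)
        (hyc.aestronglyMeasurable measurableSet_Icc)
      exact (Complex.continuous_re.comp_aestronglyMeasurable this).const_mul 2
    obtain ⟨K, hK⟩ := isCompact_Icc.exists_bound_of_continuousOn hyc
    have hii : IntervalIntegrable (fun r => 2 * (inner ℂ (O r (y r) + f r) (y r)).re)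
        volume 0 T := by
      refine intervalIntegrable_of_ae_le hT hmeas (hint.norm.mul_const (2 * K)) ?_
      filter_upwards [ae_restrict_mem measurableSet_Icc] with s hs
      have := (Complex.abs_re_le_norm _).trans (norm_inner_le_norm (𝕜 := ℂ) (O s (y s) + f s) (y s))
      rw [Real.norm_eq_abs, abs_mul, abs_two]
      calc _ ≤ 2 * (‖O s (y s) + f s‖ * ‖y s‖) := by gcongr
        _ ≤ 2 * (‖O s (y s) + f s‖ * K) := by gcongr; exact hK s hs
        _ = _ := by ring
    have h2 : ∫ r in (0 : ℝ)..t, 2 * (inner ℂ (O r (y r) + f r) (y r)).re ≤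
        ∫ r in (0 : ℝ)..t, (γ r + (2 * b r + γ r) * ‖y r‖ ^ 2) := by
      refine integral_mono_of_ae_Icc hii (hγ.add hcy) ?_ ht
      filter_upwards [hO, hf, hγ0] with s h1 h2 h3
      rw [inner_add_left, Complex.add_re]
      have h4 := (Complex.re_le_norm _).trans (norm_inner_le_norm (𝕜 := ℂ) (f s) (y s))
      have h5 : ‖f s‖ * ‖y s‖ ≤ γ s * ‖y s‖ := by gcongr
      nlinarith [h1 (y s), mul_nonneg h3 (sq_nonneg (‖y s‖ - 1))]
    rw [intervalIntegral.integral_add (intervalIntegrable_of_mem_Icc hγ h0 ht)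
      (intervalIntegrable_of_mem_Icc hcy h0 ht)] at h2
    have h3 : ∫ s in (0 : ℝ)..t, γ s ≤ ∫ s in (0 : ℝ)..T, γ s := by
      rw [← intervalIntegral.integral_add_adjacent_intervals
        (intervalIntegrable_of_mem_Icc hγ h0 ht) (intervalIntegrable_of_mem_Icc hγ ht hTT)]
      linarith [integral_nonneg_of_ae_Icc hγ0 ht hTT ht.2]
    linarith
  intro t ht
  refine (gronwall_integral hT hc hc0 hy2 key t ht).trans ?_
  have h3 : ∫ s in (0 : ℝ)..t, (2 * b s + γ s) ≤ ∫ s in (0 : ℝ)..T, (2 * b s + γ s) := by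
    rw [← intervalIntegral.integral_add_adjacent_intervals
      (intervalIntegrable_of_mem_Icc hc h0 ht) (intervalIntegrable_of_mem_Icc hc ht hTT)]
    linarith [integral_nonneg_of_ae_Icc hc0 ht hTT ht.2]
  have := integral_nonneg_of_ae_Icc hγ0 h0 hTT hT
  gcongr

/-- A regularization of an unbounded equation: `J K` are self-adjoint operators tending strongly
to the identity, `S` is a smoothing operator of order one (a negative power of the order operator)
and `M K = J K S⁻¹`. -/
structure Regularization (S : H →L[ℂ] H) (J M : ℕ → H →L[ℂ] H) : Prop where
  M_S : ∀ K, M K ∘L S = J K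
  S_M : ∀ K, S ∘L M K = J K
  J_S : ∀ K, J K ∘L S = S ∘L J K
  J_M_succ : ∀ K, J K ∘L M (K + 1) = M K
  J_succ_J : ∀ K, J (K + 1) ∘L J K = J K
  symm : ∀ K x y, inner ℂ (J K x) y = inner ℂ x (J K y)
  tendsto : ∀ x, Tendsto (fun K => J K x) atTop (𝓝 x)
  bound : ∃ c, ∀ K, ‖J K‖ ≤ c
  tendsto_S : Tendsto (fun K => ‖(J K - 1) ∘L S‖) atTop (𝓝 0)

/-- The generator `Γ(t) = S G(t)` of the equation `S v' = Γ(t) v` is measurable and bounded by an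
integrable function `β`, and satisfies an energy estimate with an integrable function `b`, uniformly
in the regularization. -/
structure EnergyGenerator (T : ℝ) (J M : ℕ → H →L[ℂ] H) (Γ : ℝ → H →L[ℂ] H) (β b : ℝ → ℝ) :
    Prop where
  measurable : ∀ x, AEStronglyMeasurable (fun s => Γ s x) (volume.restrict (Icc 0 T))
  norm_le : ∀ᵐ s ∂(volume.restrict (Icc 0 T)), ‖Γ s‖ ≤ β s
  integrable_β : IntervalIntegrable β volume 0 T
  integrable_b : IntervalIntegrable b volume 0 T
  b_nonneg : ∀ᵐ s ∂(volume.restrict (Icc 0 T)), 0 ≤ b s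
  energy : ∀ᵐ s ∂(volume.restrict (Icc 0 T)), ∀ K x,
    |(inner ℂ (M K (Γ s x)) (J K x)).re| ≤ b s * ‖x‖ ^ 2

/-- `v` is a continuous solution of `S v' = Γ(t) v` with `v(0) = v₀`, in integrated form. -/
structure IsEvolution (T : ℝ) (S : H →L[ℂ] H) (Γ : ℝ → H →L[ℂ] H) (v₀ : H) (v : ℝ → H) :
    Prop where
  cont : ContinuousOn v (Icc 0 T)
  initial : v 0 = v₀
  equation : ∀ t ∈ Icc 0 T, S (v t) = S v₀ + ∫ s in (0 : ℝ)..t, Γ s (v s)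

section

variable {T : ℝ} {S : H →L[ℂ] H} {J M : ℕ → H →L[ℂ] H} {Γ : ℝ → H →L[ℂ] H} {β b : ℝ → ℝ}

/-- The increments of the energy are controlled by the energy estimate: regularize, use the energy
identity, and let the regularization tend to the identity. -/
theorem IsEvolution.abs_norm_sq_sub_le {v₀ : H} {v : ℝ → H} (hv : IsEvolution T S Γ v₀ v)
    (hT : 0 ≤ T) (hR : Regularization S J M) (hΓ : EnergyGenerator T J M Γ β b) {s t : ℝ}
    (hs : s ∈ Icc 0 T) (ht : t ∈ Icc 0 T) :
    |‖v t‖ ^ 2 - ‖v s‖ ^ 2| ≤ |∫ r in s..t, 2 * b r * ‖v r‖ ^ 2| := by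
  have hint : IntervalIntegrable (fun s => Γ s (v s)) volume 0 T :=
    intervalIntegrable_clm_apply hT hΓ.measurable hΓ.integrable_β hΓ.norm_le hv.cont
  have hlim : Tendsto (fun K => |‖J K (v t)‖ ^ 2 - ‖J K (v s)‖ ^ 2|) atTop
      (𝓝 |‖v t‖ ^ 2 - ‖v s‖ ^ 2|) :=
    ((((hR.tendsto _).norm).pow 2).sub (((hR.tendsto _).norm).pow 2)).abs
  refine le_of_tendsto hlim (Eventually.of_forall fun K => ?_)
  have hMint : IntervalIntegrable (fun r => M K (Γ r (v r))) volume 0 T :=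
    ⟨(M K).integrable_comp hint.1, (M K).integrable_comp hint.2⟩
  have hJ : ∀ t ∈ Icc 0 T, J K (v t) = J K v₀ + ∫ r in (0 : ℝ)..t, M K (Γ r (v r)) := by
    intro t ht
    have h0 : (0 : ℝ) ∈ Icc 0 T := ⟨le_rfl, hT⟩
    have hcomm : ∫ r in (0 : ℝ)..t, M K (Γ r (v r)) = M K (∫ r in (0 : ℝ)..t, Γ r (v r)) :=
      ContinuousLinearMap.intervalIntegral_comp_comm _ (intervalIntegrable_of_mem_Icc hint h0 ht)
    rw [hcomm]
    have := congrArg (M K) (hv.equation t ht)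
    rw [map_add] at this
    simpa only [← ContinuousLinearMap.comp_apply, hR.M_S K] using this
  rw [norm_sq_primitive hMint hJ hs ht]
  have hb2 : IntervalIntegrable (fun r => 2 * b r * ‖v r‖ ^ 2) volume 0 T :=
    (hΓ.integrable_b.const_mul 2).mul_continuousOn (by
      rw [uIcc_of_le hT]; exact hv.cont.norm.pow 2)
  refine intervalIntegral.norm_integral_le_abs_of_norm_le (E := ℝ) (μ := volume)
    (g := fun r => 2 * b r * ‖v r‖ ^ 2) ?_ (intervalIntegrable_of_mem_Icc hb2 hs ht)
  rw [ae_restrict_iff' measurableSet_uIoc]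
  filter_upwards [ae_restrict_uIoc_of_Icc hΓ.energy hs ht] with r hr hrst
  rw [Real.norm_eq_abs, abs_mul, abs_two, mul_assoc]
  exact mul_le_mul_of_nonneg_left (hr hrst K (v r)) two_pos.le

/-- The a priori estimate, which gives uniqueness and continuous dependence for differences of
evolutions. -/
theorem IsEvolution.norm_sq_le {v₀ : H} {v : ℝ → H} (hv : IsEvolution T S Γ v₀ v)
    (hT : 0 ≤ T) (hR : Regularization S J M) (hΓ : EnergyGenerator T J M Γ β b) {t : ℝ}
    (ht : t ∈ Icc 0 T) :
    ‖v t‖ ^ 2 ≤ ‖v₀‖ ^ 2 * Real.exp (∫ s in (0 : ℝ)..T, 2 * b s) := by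
  have h0 : (0 : ℝ) ∈ Icc 0 T := ⟨le_rfl, hT⟩
  have hTT : T ∈ Icc 0 T := ⟨hT, le_rfl⟩
  have hc0 : ∀ᵐ s ∂(volume.restrict (Icc 0 T)), 0 ≤ 2 * b s := by
    filter_upwards [hΓ.b_nonneg] with s h1; positivity
  have hc : IntervalIntegrable (fun s => 2 * b s) volume 0 T := hΓ.integrable_b.const_mul 2
  refine (gronwall_integral (y := fun t => ‖v t‖ ^ 2) (a := ‖v₀‖ ^ 2) hT hc hc0
    (hv.cont.norm.pow 2) (fun t ht => ?_) t ht).trans ?_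
  · have h1 := hv.abs_norm_sq_sub_le hT hR hΓ h0 ht
    rw [hv.initial, abs_of_nonneg (integral_nonneg_of_ae_Icc (T := T) ?_ h0 ht ht.1)] at h1
    · linarith [le_abs_self (‖v t‖ ^ 2 - ‖v₀‖ ^ 2)]
    · filter_upwards [hc0] with s hs; positivity
  · have h3 : ∫ s in (0 : ℝ)..t, 2 * b s ≤ ∫ s in (0 : ℝ)..T, 2 * b s := by
      rw [← intervalIntegral.integral_add_adjacent_intervals
        (intervalIntegrable_of_mem_Icc hc h0 ht) (intervalIntegrable_of_mem_Icc hc ht hTT)]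
      linarith [integral_nonneg_of_ae_Icc hc0 ht hTT ht.2]
    gcongr

theorem IsEvolution.sub {v₀ w₀ : H} {v w : ℝ → H} (hv : IsEvolution T S Γ v₀ v)
    (hw : IsEvolution T S Γ w₀ w) (hT : 0 ≤ T) (hΓ : EnergyGenerator T J M Γ β b) :
    IsEvolution T S Γ (v₀ - w₀) (v - w) where
  cont := hv.cont.sub hw.cont
  initial := by simp [hv.initial, hw.initial]
  equation t ht := by
    have h0 : (0 : ℝ) ∈ Icc 0 T := ⟨le_rfl, hT⟩
    have h1 := intervalIntegrable_clm_apply hT hΓ.measurable hΓ.integrable_β hΓ.norm_le hv.cont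
    have h2 := intervalIntegrable_clm_apply hT hΓ.measurable hΓ.integrable_β hΓ.norm_le hw.cont
    simp only [Pi.sub_apply, map_sub]
    rw [intervalIntegral.integral_sub (intervalIntegrable_of_mem_Icc h1 h0 ht)
      (intervalIntegrable_of_mem_Icc h2 h0 ht), hv.equation t ht, hw.equation t ht]
    abel

end

end Evolution

section Evolution

set_option linter.unusedSectionVars false

variable {H : Type*} [NormedAddCommGroup H] [InnerProductSpace ℂ H] [CompleteSpace H]

variable {T : ℝ} {S : H →L[ℂ] H} {J M : ℕ → H →L[ℂ] H} {Γ : ℝ → H →L[ℂ] H} {β b : ℝ → ℝ}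

/-- A locally uniformly Cauchy sequence of approximate solutions converges to a solution. The
approximate generators `P k Γ R k` tend strongly to `Γ`. -/
theorem exists_isEvolution_of_cauchy (hT : 0 ≤ T) (hΓ : EnergyGenerator T J M Γ β b)
    {P R : ℕ → H →L[ℂ] H} {c : ℝ} (hP : ∀ k, ‖P k‖ ≤ c) (hR : ∀ k, ‖R k‖ ≤ c)
    (hPlim : ∀ x, Tendsto (fun k => P k x) atTop (𝓝 x))
    (hRlim : ∀ x, Tendsto (fun k => R k x) atTop (𝓝 x))
    {v : ℕ → ℝ → H} {x : ℕ → H} {x₀ : H} (hx : Tendsto x atTop (𝓝 x₀))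
    (hvc : ∀ k, ContinuousOn (v k) (Icc 0 T))
    (hveq : ∀ k, ∀ t ∈ Icc 0 T,
      S (v k t) = S (x k) + ∫ s in (0 : ℝ)..t, P k (Γ s (R k (v k s))))
    (hv0 : ∀ k, v k 0 = x k) (hcau : UniformCauchySeqOn v atTop (Icc 0 T)) :
    ∃ w, IsEvolution T S Γ x₀ w := by
  have hlim : ∀ t, ∃ y, t ∈ Icc 0 T → Tendsto (fun k => v k t) atTop (𝓝 y) := by
    intro t
    by_cases ht : t ∈ Icc 0 T
    · obtain ⟨y, hy⟩ := cauchySeq_tendsto_of_complete (hcau.cauchySeq ht)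
      exact ⟨y, fun _ => hy⟩
    · exact ⟨0, fun h => (ht h).elim⟩
  choose w hw using hlim
  have h0 : (0 : ℝ) ∈ Icc 0 T := ⟨le_rfl, hT⟩
  have hunif : TendstoUniformlyOn v w atTop (Icc 0 T) :=
    hcau.tendstoUniformlyOn_of_tendsto fun t ht => hw t ht
  have hwc : ContinuousOn w (Icc 0 T) :=
    hunif.continuousOn (Eventually.of_forall hvc).frequently
  obtain ⟨K, hK⟩ := isCompact_Icc.exists_bound_of_continuousOn hwc
  have hbd : ∀ᶠ k in atTop, ∀ t ∈ Icc 0 T, ‖v k t‖ ≤ K + 1 := by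
    filter_upwards [Metric.tendstoUniformlyOn_iff.mp hunif 1 one_pos] with k hk t ht
    have h1 := hk t ht
    rw [dist_comm, dist_eq_norm] at h1
    calc ‖v k t‖ = ‖(v k t - w t) + w t‖ := by rw [sub_add_cancel]
      _ ≤ _ := (norm_add_le _ _).trans (by linarith [hK t ht])
  have hc : 0 ≤ c := (norm_nonneg _).trans (hP 0)
  have hstrong : ∀ {Q : ℕ → H →L[ℂ] H} (_ : ∀ k, ‖Q k‖ ≤ c)
      (_ : ∀ x, Tendsto (fun k => Q k x) atTop (𝓝 x)) {y : ℕ → H} {z : H}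
      (_ : Tendsto y atTop (𝓝 z)), Tendsto (fun k => Q k (y k)) atTop (𝓝 z) := by
    intro Q hQ hQlim y z hy
    have h1 : Tendsto (fun k => Q k (y k - z)) atTop (𝓝 0) := by
      refine squeeze_zero_norm (a := fun k => c * ‖y k - z‖) (fun k => ?_) ?_
      · exact ((Q k).le_opNorm _).trans (by gcongr; exact hQ k)
      · simpa using (tendsto_const_nhds (x := c)).mul
          (((hy.sub (tendsto_const_nhds (x := z)))).norm)
    simpa using h1.add (hQlim z)
  refine ⟨w, hwc, ?_, fun t ht => ?_⟩
  · refine tendsto_nhds_unique (hw 0 h0) ?_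
    simpa only [hv0] using hx
  · have hl := (S.continuous.tendsto _).comp (hw t ht)
    have hr1 := (S.continuous.tendsto _).comp hx
    have hr2 : Tendsto (fun k => ∫ s in (0 : ℝ)..t, P k (Γ s (R k (v k s)))) atTop
        (𝓝 (∫ s in (0 : ℝ)..t, Γ s (w s))) := by
      refine intervalIntegral.tendsto_integral_filter_of_dominated_convergence
        (fun s => c * (β s * (c * (K + 1)))) ?_ ?_ ?_ ?_
      · refine Eventually.of_forall fun k => ?_
        have h1 : AEStronglyMeasurable (fun s => P k (Γ s (R k (v k s))))
            (volume.restrict (Icc 0 T)) :=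
          (P k).continuous.comp_aestronglyMeasurable (aestronglyMeasurable_clm_apply
            hΓ.measurable (((R k).continuous.comp_continuousOn (hvc k)).aestronglyMeasurable
              measurableSet_Icc))
        exact h1.mono_measure (Measure.restrict_mono
          (uIoc_subset_uIcc.trans (uIcc_subset_Icc h0 ht)) le_rfl)
      · filter_upwards [hbd] with k hk
        filter_upwards [ae_restrict_uIoc_of_Icc hΓ.norm_le h0 ht] with s hs hst
        have hsI : s ∈ Icc 0 T := uIcc_subset_Icc h0 ht (uIoc_subset_uIcc hst)
        have h2 := hs hst
        have h3 : 0 ≤ β s := (norm_nonneg _).trans h2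
        refine ((P k).le_opNorm _).trans ?_
        have h4 : ‖R k (v k s)‖ ≤ c * (K + 1) :=
          ((R k).le_opNorm _).trans (mul_le_mul (hR k) (hk s hsI) (norm_nonneg _) hc)
        have h5 : ‖Γ s (R k (v k s))‖ ≤ β s * (c * (K + 1)) :=
          ((Γ s).le_opNorm _).trans (mul_le_mul h2 h4 (norm_nonneg _) h3)
        exact mul_le_mul (hP k) h5 (norm_nonneg _) hc
      · exact ((intervalIntegrable_of_mem_Icc hΓ.integrable_β h0 ht).mul_const _).const_mul _
      · refine Eventually.of_forall fun s hst => ?_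
        have hsI : s ∈ Icc 0 T := uIcc_subset_Icc h0 ht (uIoc_subset_uIcc hst)
        exact hstrong hP hPlim (((Γ s).continuous.tendsto _).comp
          (hstrong hR hRlim (hw s hsI)))
    refine tendsto_nhds_unique hl ((hr1.add hr2).congr fun k => ?_)
    exact (hveq k t ht).symm

theorem uniformCauchySeqOn_of_norm_sq_le {v : ℕ → ℝ → H} {δ : ℕ → ℕ → ℝ} {s : Set ℝ}
    (h : ∀ K L, ∀ t ∈ s, ‖v K t - v L t‖ ^ 2 ≤ δ K L)
    (hδ : Tendsto (fun p : ℕ × ℕ => δ p.1 p.2) (atTop ×ˢ atTop) (𝓝 0)) :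
    UniformCauchySeqOn v atTop s := by
  rw [Metric.uniformCauchySeqOn_iff]
  intro ε hε
  have := hδ.eventually (gt_mem_nhds (show (0 : ℝ) < ε ^ 2 by positivity))
  rw [prod_atTop_atTop_eq, eventually_atTop] at this
  obtain ⟨⟨N₁, N₂⟩, hN⟩ := this
  refine ⟨max N₁ N₂, fun K hK L hL t ht => ?_⟩
  have h1 := hN (K, L) ⟨le_of_max_le_left hK, le_of_max_le_right hL⟩
  rw [dist_eq_norm]
  exact lt_of_pow_lt_pow_left₀ 2 hε.le ((h K L t ht).trans_lt h1)

/-- Solvability for data in the range of `S²`. Truncating the generator gives linear equations with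
bounded coefficients; their solutions are bounded in the stronger norm, two orders higher, and are
therefore Cauchy in the original one. -/
theorem exists_isEvolution_of_smooth (hT : 0 ≤ T) (hR : Regularization S J M)
    {Γ₁ Γ₂ : ℝ → H →L[ℂ] H} (hΓ : EnergyGenerator T J M Γ β b)
    (hΓ₂ : EnergyGenerator T J M Γ₂ β b)
    (hΓ₁ : ∀ᵐ s ∂(volume.restrict (Icc 0 T)), ‖Γ₁ s‖ ≤ β s)
    (h01 : ∀ᵐ s ∂(volume.restrict (Icc 0 T)), S ∘L Γ₁ s = Γ s ∘L S)
    (h12 : ∀ᵐ s ∂(volume.restrict (Icc 0 T)), S ∘L Γ₂ s = Γ₁ s ∘L S) (x₀ : H) :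
    ∃ v, IsEvolution T S Γ (S (S x₀)) v := by
  obtain ⟨c, hc⟩ := hR.bound
  have hc0 : 0 ≤ c := (norm_nonneg _).trans (hc 0)
  have h0 : (0 : ℝ) ∈ Icc 0 T := ⟨le_rfl, hT⟩
  have hTT : T ∈ Icc 0 T := ⟨hT, le_rfl⟩
  have hJS : ∀ K x, J K (S x) = S (J K x) := fun K x => congrArg (· x) (hR.J_S K)
  have hMS : ∀ K x, M K (S x) = J K x := fun K x => congrArg (· x) (hR.M_S K)
  have hSM : ∀ K x, S (M K x) = J K x := fun K x => congrArg (· x) (hR.S_M K)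
  have hJM : ∀ K x, J K (M (K + 1) x) = M K x := fun K x => congrArg (· x) (hR.J_M_succ K)
  have hJJ : ∀ K x, J (K + 1) (J K x) = J K x := fun K x => congrArg (· x) (hR.J_succ_J K)
  -- the energy estimate at level `K + 1`, applied to `J K x`, controls the truncated generator
  have hdiss : ∀ {Γ' : ℝ → H →L[ℂ] H}, EnergyGenerator T J M Γ' β b → ∀ K,
      ∀ᵐ s ∂(volume.restrict (Icc 0 T)), ∀ x,
        (inner ℂ ((M K ∘L Γ' s ∘L J K) x) x).re ≤ (c ^ 2 * b s) * ‖x‖ ^ 2 := by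
    intro Γ' hΓ' K
    filter_upwards [hΓ'.energy, hΓ'.b_nonneg] with s hs hbs x
    have h1 := hs (K + 1) (J K x)
    rw [hJJ, ← hR.symm, hJM] at h1
    calc _ ≤ b s * ‖J K x‖ ^ 2 := (le_abs_self _).trans h1
      _ ≤ b s * (c * ‖x‖) ^ 2 := by
        gcongr; exact ((J K).le_opNorm _).trans (by gcongr; exact hc K)
      _ = _ := by ring
  have hMnorm : ∀ {Γ' : ℝ → H →L[ℂ] H}, EnergyGenerator T J M Γ' β b → ∀ K,
      ∀ᵐ s ∂(volume.restrict (Icc 0 T)), ‖M K ∘L Γ' s ∘L J K‖ ≤ ‖M K‖ * c * β s := by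
    intro Γ' hΓ' K
    filter_upwards [hΓ'.norm_le] with s hs
    calc _ ≤ ‖M K‖ * (‖Γ' s‖ * ‖J K‖) :=
          (ContinuousLinearMap.opNorm_comp_le _ _).trans
            (by gcongr; exact ContinuousLinearMap.opNorm_comp_le _ _)
      _ ≤ ‖M K‖ * (β s * c) := by
        have := (norm_nonneg _).trans hs
        gcongr; exact hc K
      _ = _ := by ring
  have hMmeas : ∀ {Γ' : ℝ → H →L[ℂ] H}, EnergyGenerator T J M Γ' β b → ∀ K x,
      AEStronglyMeasurable (fun s => (M K ∘L Γ' s ∘L J K) x) (volume.restrict (Icc 0 T)) :=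
    fun hΓ' K x => (M K).continuous.comp_aestronglyMeasurable (hΓ'.measurable (J K x))
  have hX : ∀ K, ∃ X : ℝ → H, ContinuousOn X (Icc 0 T) ∧
      ∀ t ∈ Icc 0 T, X t = x₀ + ∫ s in (0 : ℝ)..t, (M K ∘L Γ₂ s ∘L J K) (X s) := fun K =>
    exists_linear_ode_solution hT (hMmeas hΓ₂ K) (hΓ₂.integrable_β.const_mul _) (hMnorm hΓ₂ K) x₀
  choose X hXc hXeq using hX
  have hXint : ∀ K, IntervalIntegrable (fun s => (M K ∘L Γ₂ s ∘L J K) (X K s)) volume 0 T :=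
    fun K => intervalIntegrable_clm_apply hT (hMmeas hΓ₂ K) (hΓ₂.integrable_β.const_mul _)
      (hMnorm hΓ₂ K) (hXc K)
  have hcb : IntervalIntegrable (fun s => c ^ 2 * b s) volume 0 T := hΓ.integrable_b.const_mul _
  have hcb0 : ∀ᵐ s ∂(volume.restrict (Icc 0 T)), 0 ≤ c ^ 2 * b s :=
    hΓ.b_nonneg.mono fun s hs => by positivity
  -- uniform bound of the approximations in the stronger norm
  obtain ⟨B, hB0, hB⟩ : ∃ B, 0 ≤ B ∧ ∀ K, ∀ t ∈ Icc 0 T, ‖X K t‖ ≤ B := by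
    refine ⟨Real.sqrt (‖x₀‖ ^ 2 * Real.exp (∫ s in (0 : ℝ)..T, 2 * (c ^ 2 * b s))),
      Real.sqrt_nonneg _, fun K t ht => Real.le_sqrt_of_sq_le ?_⟩
    have := norm_sq_le_of_forced (O := fun s => M K ∘L Γ₂ s ∘L J K) (f := fun _ => 0)
      (γ := fun _ => 0) (y := X K) (y₀ := x₀) (b := fun s => c ^ 2 * b s) hT
      (by simpa only [add_zero] using hXint K) (hXc K)
      (by simpa only [add_zero] using hXeq K) hcb (by simp) hcb0 (hdiss hΓ₂ K) (by simp) t ht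
    simpa using this
  set v : ℕ → ℝ → H := fun K t => S (S (X K t)) with hv
  have hvc : ∀ K, ContinuousOn (v K) (Icc 0 T) := fun K =>
    S.continuous.comp_continuousOn (S.continuous.comp_continuousOn (hXc K))
  have hSSO : ∀ᵐ s ∂(volume.restrict (Icc 0 T)), ∀ K x,
      S (S (M K (Γ₂ s (J K x)))) = M K (Γ s (J K (S (S x)))) := by
    filter_upwards [h01, h12] with s h1 h2 K x
    have h1' : ∀ x, S (Γ₁ s x) = Γ s (S x) := fun x => congrArg (· x) h1
    have h2' : ∀ x, S (Γ₂ s x) = Γ₁ s (S x) := fun x => congrArg (· x) h2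
    rw [hJS, hJS, ← h1', ← h2', hMS, hSM, hJS]
  have hvint : ∀ K, IntervalIntegrable (fun s => (M K ∘L Γ s ∘L J K) (v K s)) volume 0 T :=
    fun K => intervalIntegrable_clm_apply hT (hMmeas hΓ K) (hΓ.integrable_β.const_mul _)
      (hMnorm hΓ K) (hvc K)
  have hveq : ∀ K, ∀ t ∈ Icc 0 T,
      v K t = S (S x₀) + ∫ s in (0 : ℝ)..t, (M K ∘L Γ s ∘L J K) (v K s) := by
    intro K t ht
    have h1 := congrArg (S ∘L S) (hXeq K t ht)
    rw [map_add] at h1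
    have hcomm : ∫ s in (0 : ℝ)..t, (S ∘L S) ((M K ∘L Γ₂ s ∘L J K) (X K s)) =
        (S ∘L S) (∫ s in (0 : ℝ)..t, (M K ∘L Γ₂ s ∘L J K) (X K s)) :=
      ContinuousLinearMap.intervalIntegral_comp_comm _
        (intervalIntegrable_of_mem_Icc (hXint K) h0 ht)
    rw [← hcomm] at h1
    refine h1.trans ?_
    congr 1
    refine intervalIntegral.integral_congr_ae ?_
    filter_upwards [ae_restrict_uIoc_of_Icc hSSO h0 ht] with s hs hst
    exact hs hst K (X K s)
  -- the difference of two truncated generators is small on the range of `S²`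
  set e : ℕ → ℝ := fun K => ‖(J K - 1) ∘L S‖ with he
  have heJ : ∀ K L x, ‖J K (S x) - J L (S x)‖ ≤ (e K + e L) * ‖x‖ := by
    intro K L x
    have h1 : J K (S x) - J L (S x) = ((J K - 1) ∘L S) x - ((J L - 1) ∘L S) x := by simp
    rw [h1, add_mul]
    exact (norm_sub_le _ _).trans (add_le_add (ContinuousLinearMap.le_opNorm _ _)
      (ContinuousLinearMap.le_opNorm _ _))
  have hdiff : ∀ᵐ s ∂(volume.restrict (Icc 0 T)), ∀ K L x,
      ‖M K (Γ s (J K (S (S x)))) - M L (Γ s (J L (S (S x))))‖ ≤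
        (e K + e L) * (2 * c) * β s * ‖x‖ := by
    filter_upwards [h01, h12, hΓ₂.norm_le, hΓ₁] with s h1 h2 h3 h4 K L x
    have h1' : ∀ x, S (Γ₁ s x) = Γ s (S x) := fun x => congrArg (· x) h1
    have h2' : ∀ x, S (Γ₂ s x) = Γ₁ s (S x) := fun x => congrArg (· x) h2
    have h5 : ∀ K, M K (Γ s (J K (S (S x)))) = J K (Γ₁ s (J K (S x))) := fun K => by
      rw [hJS K (S x), ← h1', hMS]
    have hβ : 0 ≤ β s := (norm_nonneg _).trans h3
    have he0 : 0 ≤ e K + e L := add_nonneg (norm_nonneg _) (norm_nonneg _)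
    rw [h5, h5]
    have h6 : J K (Γ₁ s (J K (S x))) - J L (Γ₁ s (J L (S x))) =
        (J K (S (Γ₂ s (J K x))) - J L (S (Γ₂ s (J K x)))) +
          J L (Γ₁ s (J K (S x) - J L (S x))) := by
      rw [h2', ← hJS, map_sub, map_sub]; abel
    rw [h6]
    refine (norm_add_le _ _).trans ?_
    have h7 : ‖Γ₂ s (J K x)‖ ≤ β s * (c * ‖x‖) :=
      ((Γ₂ s).le_opNorm _).trans (mul_le_mul h3 (((J K).le_opNorm _).trans (by
        gcongr; exact hc K)) (norm_nonneg _) hβ)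
    have h8 : ‖J L (Γ₁ s (J K (S x) - J L (S x)))‖ ≤ c * (β s * ((e K + e L) * ‖x‖)) :=
      ((J L).le_opNorm _).trans (mul_le_mul (hc L) (((Γ₁ s).le_opNorm _).trans
        (mul_le_mul h4 (heJ K L x) (norm_nonneg _) hβ)) (norm_nonneg _) hc0)
    calc _ ≤ (e K + e L) * (β s * (c * ‖x‖)) + c * (β s * ((e K + e L) * ‖x‖)) := by
          refine add_le_add ((heJ K L _).trans ?_) h8
          gcongr
      _ = _ := by ring
  have hγint : ∀ K L, IntervalIntegrable (fun s => (e K + e L) * (2 * c) * β s * B) volume 0 T :=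
    fun K L => (hΓ.integrable_β.const_mul _).mul_const _
  have hcau : UniformCauchySeqOn v atTop (Icc 0 T) := by
    refine uniformCauchySeqOn_of_norm_sq_le (δ := fun K L =>
      (∫ s in (0 : ℝ)..T, (e K + e L) * (2 * c) * β s * B) * Real.exp (∫ s in (0 : ℝ)..T,
        (2 * (c ^ 2 * b s) + (e K + e L) * (2 * c) * β s * B))) (fun K L t ht => ?_) ?_
    · have hsplit : ∀ s, (M K ∘L Γ s ∘L J K) (v K s - v L s) +
          ((M K ∘L Γ s ∘L J K) (v L s) - (M L ∘L Γ s ∘L J L) (v L s)) =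
          (M K ∘L Γ s ∘L J K) (v K s) - (M L ∘L Γ s ∘L J L) (v L s) := fun s => by
        rw [map_sub]; abel
      have h1 := norm_sq_le_of_forced (O := fun s => M K ∘L Γ s ∘L J K)
        (f := fun s => (M K ∘L Γ s ∘L J K) (v L s) - (M L ∘L Γ s ∘L J L) (v L s))
        (γ := fun s => (e K + e L) * (2 * c) * β s * B) (y := fun t => v K t - v L t) (y₀ := 0)
        (b := fun s => c ^ 2 * b s) hT
        (by simp only [hsplit]; exact (hvint K).sub (hvint L)) ((hvc K).sub (hvc L))
        (fun t ht => by
          simp only [hsplit]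
          rw [intervalIntegral.integral_sub (intervalIntegrable_of_mem_Icc (hvint K) h0 ht)
            (intervalIntegrable_of_mem_Icc (hvint L) h0 ht), hveq K t ht, hveq L t ht]
          abel) hcb (hγint K L) hcb0 (hdiss hΓ K) (by
          filter_upwards [hdiff, hΓ.norm_le, ae_restrict_mem measurableSet_Icc] with s hs hβ hsI
          have hβ0 := (norm_nonneg _).trans hβ
          have he0 : 0 ≤ e K + e L := add_nonneg (norm_nonneg _) (norm_nonneg _)
          refine (hs K L (X L s)).trans ?_
          gcongr
          exact hB L s hsI) t ht
      simpa using h1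
    · have hee : Tendsto (fun p : ℕ × ℕ => e p.1 + e p.2) (atTop ×ˢ atTop) (𝓝 0) := by
        have := (hR.tendsto_S.comp tendsto_fst).add (hR.tendsto_S.comp (tendsto_snd (f := atTop)))
        rw [add_zero] at this
        exact this
      have h1 : ∀ K L, ∫ s in (0 : ℝ)..T, (e K + e L) * (2 * c) * β s * B =
          (e K + e L) * (2 * c * B * ∫ s in (0 : ℝ)..T, β s) := fun K L => by
        rw [intervalIntegral.integral_mul_const, intervalIntegral.integral_const_mul]; ring
      have h2 : ∀ K L, ∫ s in (0 : ℝ)..T, (2 * (c ^ 2 * b s) + (e K + e L) * (2 * c) * β s * B) =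
          (∫ s in (0 : ℝ)..T, 2 * (c ^ 2 * b s)) +
          (e K + e L) * (2 * c * B * ∫ s in (0 : ℝ)..T, β s) := fun K L => by
        rw [intervalIntegral.integral_add (hcb.const_mul 2) (hγint K L), h1]
      simp only [h1, h2]
      have h3 := hee.mul_const (2 * c * B * ∫ s in (0 : ℝ)..T, β s)
      have h4 := (Real.continuous_exp.tendsto _).comp
        ((tendsto_const_nhds (x := ∫ s in (0 : ℝ)..T, 2 * (c ^ 2 * b s))).add h3)
      simpa using h3.mul h4
  refine exists_isEvolution_of_cauchy hT hΓ hc hc hR.tendsto hR.tendsto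
    (x := fun _ => S (S x₀)) tendsto_const_nhds hvc (fun K t ht => ?_) (fun K => ?_) hcau
  · have h1 := congrArg S (hveq K t ht)
    rw [map_add] at h1
    rw [h1]
    congr 1
    have hcomm : ∫ s in (0 : ℝ)..t, S ((M K ∘L Γ s ∘L J K) (v K s)) =
        S (∫ s in (0 : ℝ)..t, (M K ∘L Γ s ∘L J K) (v K s)) :=
      ContinuousLinearMap.intervalIntegral_comp_comm _
        (intervalIntegrable_of_mem_Icc (hvint K) h0 ht)
    rw [← hcomm]
    simp only [ContinuousLinearMap.comp_apply, hSM]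
  · rw [hveq K 0 h0]; simp

/-- Solvability for arbitrary data, by density and the energy estimate. -/
theorem exists_isEvolution (hT : 0 ≤ T) (hR : Regularization S J M)
    {Γ₁ Γ₂ : ℝ → H →L[ℂ] H} (hΓ : EnergyGenerator T J M Γ β b)
    (hΓ₂ : EnergyGenerator T J M Γ₂ β b)
    (hΓ₁ : ∀ᵐ s ∂(volume.restrict (Icc 0 T)), ‖Γ₁ s‖ ≤ β s)
    (h01 : ∀ᵐ s ∂(volume.restrict (Icc 0 T)), S ∘L Γ₁ s = Γ s ∘L S)
    (h12 : ∀ᵐ s ∂(volume.restrict (Icc 0 T)), S ∘L Γ₂ s = Γ₁ s ∘L S) (x₀ : H) :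
    ∃ v, IsEvolution T S Γ x₀ v := by
  obtain ⟨c, hc⟩ := hR.bound
  have hMS : ∀ K x, M K (S x) = J K x := fun K x => congrArg (· x) (hR.M_S K)
  have hSM : ∀ K x, S (M K x) = J K x := fun K x => congrArg (· x) (hR.S_M K)
  have hJS : ∀ K x, J K (S x) = S (J K x) := fun K x => congrArg (· x) (hR.J_S K)
  have hJJ : ∀ K x, S (S (M K (M K x))) = J K (J K x) := fun K x => by
    rw [hSM, ← hJS, hSM]
  have hsol : ∀ K, ∃ v, IsEvolution T S Γ (J K (J K x₀)) v := fun K => by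
    rw [← hJJ]; exact exists_isEvolution_of_smooth hT hR hΓ hΓ₂ hΓ₁ h01 h12 _
  choose v hv using hsol
  have hlim : Tendsto (fun K => J K (J K x₀)) atTop (𝓝 x₀) := by
    have h1 : Tendsto (fun k => J k (J k x₀ - x₀)) atTop (𝓝 0) := by
      refine squeeze_zero_norm (a := fun k => c * ‖J k x₀ - x₀‖) (fun k => ?_) ?_
      · exact ((J k).le_opNorm _).trans (by gcongr; exact hc k)
      · simpa using (tendsto_const_nhds (x := c)).mul
          ((((hR.tendsto x₀).sub (tendsto_const_nhds (x := x₀)))).norm)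
    simpa using h1.add (hR.tendsto x₀)
  have hcau : UniformCauchySeqOn v atTop (Icc 0 T) := by
    refine uniformCauchySeqOn_of_norm_sq_le (δ := fun K L =>
      ‖J K (J K x₀) - J L (J L x₀)‖ ^ 2 * Real.exp (∫ s in (0 : ℝ)..T, 2 * b s))
      (fun K L t ht => ((hv K).sub (hv L) hT hΓ).norm_sq_le hT hR hΓ ht) ?_
    have := (((hlim.comp tendsto_fst).sub (hlim.comp tendsto_snd)).norm.pow 2).mul_const
      (Real.exp (∫ s in (0 : ℝ)..T, 2 * b s))
    simpa using this
  exact exists_isEvolution_of_cauchy hT hΓ (P := fun _ => 1) (R := fun _ => 1) (c := 1)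
    (fun _ => ContinuousLinearMap.norm_id_le) (fun _ => ContinuousLinearMap.norm_id_le)
    (fun x => by simp) (fun x => by simp) hlim (fun K => (hv K).cont)
    (fun K t ht => by simpa using (hv K).equation t ht) (fun K => (hv K).initial) hcau

end Evolution

noncomputable section

/-! ### Multiplication operators and Fourier multipliers on `L²` -/

/-- The Hilbert space `L²(ℝⁿ; ℂᵐ)`. -/
abbrev L2 (n m : ℕ) := Lp (CVec m) 2 (volume : Measure (Rn n))

variable {n m : ℕ}

/-- Multiplication on `L²` by an essentially bounded matrix-valued function (and `0` if the function
is not essentially bounded). -/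
def mulOp (M : Rn n → CVec m →L[ℂ] CVec m) : L2 n m →L[ℂ] L2 n m :=
  open Classical in if h : MemLp M ∞ volume then
    (ContinuousLinearMap.id ℂ (CVec m →L[ℂ] CVec m)).holderL volume ∞ 2 2 (h.toLp M) else 0

theorem mulOp_coeFn {M : Rn n → CVec m →L[ℂ] CVec m} (h : MemLp M ∞ volume) (f : L2 n m) :
    mulOp M f =ᵐ[volume] fun x => M x (f x) := by
  rw [mulOp, dif_pos h, ContinuousLinearMap.holderL_apply_apply]
  filter_upwards [ContinuousLinearMap.coeFn_holder (r := 2)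
    (ContinuousLinearMap.id ℂ (CVec m →L[ℂ] CVec m)) (h.toLp M) f, h.coeFn_toLp] with x h1 h2
  rw [h1, h2]; rfl

theorem norm_mulOp_le {M : Rn n → CVec m →L[ℂ] CVec m} {C : ℝ} (hC : 0 ≤ C)
    (h : ∀ᵐ x, ‖M x‖ ≤ C) : ‖mulOp M‖ ≤ C := by
  by_cases hM : MemLp M ∞ volume
  · refine ContinuousLinearMap.opNorm_le_bound _ hC fun f => ?_
    refine Lp.norm_le_mul_norm_of_ae_le_mul ?_
    filter_upwards [mulOp_coeFn hM f, h] with x h1 h2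
    rw [h1]
    exact ((M x).le_opNorm _).trans (by gcongr)
  · rw [mulOp, dif_neg hM]; simpa using hC

theorem inner_mulOp {M N : Rn n → CVec m →L[ℂ] CVec m} (hM : MemLp M ∞ volume)
    (hN : MemLp N ∞ volume)
    (h : ∀ᵐ x, ∀ v w, inner ℂ (M x v) w = inner ℂ v (N x w)) (f g : L2 n m) :
    inner ℂ (mulOp M f) g = inner ℂ f (mulOp N g) := by
  rw [L2.inner_def, L2.inner_def]
  refine integral_congr_ae ?_
  filter_upwards [mulOp_coeFn hM f, mulOp_coeFn hN g, h] with x h1 h2 h3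
  rw [h1, h2, h3]

/-- Scalar functions as multiples of the identity matrix. -/
def scalarMat (m : ℕ) (φ : Rn n → ℂ) (x : Rn n) : CVec m →L[ℂ] CVec m := φ x • 1

@[simp] theorem scalarMat_apply (φ : Rn n → ℂ) (x : Rn n) (v : CVec m) :
    scalarMat m φ x v = φ x • v := rfl

theorem memLp_scalarMat {φ : Rn n → ℂ} (h : MemLp φ ∞ volume) :
    MemLp (scalarMat m φ) ∞ volume := by
  have := ((ContinuousLinearMap.id ℂ ℂ).smulRight (1 : CVec m →L[ℂ] CVec m)).comp_memLp' h
  exact this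

theorem norm_scalarMat_le (φ : Rn n → ℂ) (x : Rn n) : ‖scalarMat m φ x‖ ≤ ‖φ x‖ := by
  refine ContinuousLinearMap.opNorm_le_bound _ (norm_nonneg _) fun v => ?_
  rw [scalarMat_apply, norm_smul]

/-- The Fourier multiplier with symbol `φ`, as an operator on `L²`. -/
def FM (m : ℕ) (φ : Rn n → ℂ) : L2 n m →L[ℂ] L2 n m :=
  (Lp.fourierTransformₗᵢ (Rn n) (CVec m)).symm.toContinuousLinearEquiv.toContinuousLinearMap ∘L
    mulOp (scalarMat m φ) ∘L
    (Lp.fourierTransformₗᵢ (Rn n) (CVec m)).toContinuousLinearEquiv.toContinuousLinearMap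

theorem FM_apply (φ : Rn n → ℂ) (f : L2 n m) :
    FM m φ f = 𝓕⁻ (mulOp (scalarMat m φ) (𝓕 f)) := rfl

theorem fourier_FM (φ : Rn n → ℂ) (f : L2 n m) :
    𝓕 (FM m φ f) = mulOp (scalarMat m φ) (𝓕 f) := by
  rw [FM_apply, FourierTransform.fourier_fourierInv_eq]

theorem fourier_injective : Function.Injective (𝓕 : L2 n m → L2 n m) :=
  (Lp.fourierTransformₗᵢ (Rn n) (CVec m)).injective

theorem fourier_FM_coeFn {φ : Rn n → ℂ} (h : MemLp φ ∞ volume) (f : L2 n m) :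
    (𝓕 (FM m φ f) : L2 n m) =ᵐ[volume] fun ξ => φ ξ • (𝓕 f : L2 n m) ξ := by
  rw [fourier_FM]
  exact mulOp_coeFn (memLp_scalarMat h) _

theorem norm_FM_le {φ : Rn n → ℂ} {C : ℝ} (hC : 0 ≤ C) (h : ∀ ξ, ‖φ ξ‖ ≤ C) :
    ‖FM m φ‖ ≤ C := by
  refine ContinuousLinearMap.opNorm_le_bound _ hC fun f => ?_
  rw [← Lp.norm_fourier_eq, fourier_FM]
  calc _ ≤ ‖mulOp (scalarMat m φ)‖ * ‖(𝓕 f : L2 n m)‖ := ContinuousLinearMap.le_opNorm _ _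
    _ ≤ C * ‖f‖ := by
      rw [Lp.norm_fourier_eq]
      gcongr
      exact norm_mulOp_le hC (Eventually.of_forall fun x => (norm_scalarMat_le φ x).trans (h x))

theorem FM_comp {φ ψ : Rn n → ℂ} (hφ : MemLp φ ∞ volume) (hψ : MemLp ψ ∞ volume) :
    FM m φ ∘L FM m ψ = FM m (φ * ψ) := by
  have hm : MemLp (φ * ψ) ∞ volume := hψ.mul hφ
  ext1 f
  apply fourier_injective
  apply Lp.ext
  filter_upwards [fourier_FM_coeFn hφ (FM m ψ f), fourier_FM_coeFn hψ f, fourier_FM_coeFn hm f]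
    with x h1 h2 h3
  simp only [ContinuousLinearMap.comp_apply]
  rw [h1, h2, h3, Pi.mul_apply, mul_smul]

theorem FM_comp_apply {φ ψ : Rn n → ℂ} (hφ : MemLp φ ∞ volume) (hψ : MemLp ψ ∞ volume)
    (f : L2 n m) : FM m φ (FM m ψ f) = FM m (φ * ψ) f :=
  congrArg (· f) (FM_comp hφ hψ)

theorem FM_comm {φ ψ : Rn n → ℂ} (hφ : MemLp φ ∞ volume) (hψ : MemLp ψ ∞ volume) :
    FM m φ ∘L FM m ψ = FM m ψ ∘L FM m φ := by
  rw [FM_comp hφ hψ, FM_comp hψ hφ, mul_comm]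

theorem FM_sub {φ ψ : Rn n → ℂ} (hφ : MemLp φ ∞ volume) (hψ : MemLp ψ ∞ volume) :
    FM m (φ - ψ) = FM m φ - FM m ψ := by
  have hm : MemLp (φ - ψ) ∞ volume := hφ.sub hψ
  ext1 f
  apply fourier_injective
  have hsub : 𝓕 ((FM m φ - FM m ψ) f) = 𝓕 (FM m φ f) - (𝓕 (FM m ψ f) : L2 n m) :=
    (Lp.fourierTransformₗᵢ (Rn n) (CVec m)).map_sub _ _
  rw [hsub]
  apply Lp.ext
  filter_upwards [fourier_FM_coeFn hφ f, fourier_FM_coeFn hψ f, fourier_FM_coeFn hm f,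
    Lp.coeFn_sub (𝓕 (FM m φ f) : L2 n m) (𝓕 (FM m ψ f))] with x h1 h2 h3 h4
  rw [h4, Pi.sub_apply, h1, h2, h3, Pi.sub_apply, sub_smul]

theorem FM_one : FM m (1 : Rn n → ℂ) = 1 := by
  ext1 f
  apply fourier_injective
  apply Lp.ext
  filter_upwards [fourier_FM_coeFn (memLp_top_const (1 : ℂ)) f] with x h1
  exact h1.trans (by simp)

theorem FM_smul {φ : Rn n → ℂ} (hφ : MemLp φ ∞ volume) (c : ℂ) :
    FM m (c • φ) = c • FM m φ := by
  have hm : MemLp (c • φ) ∞ volume := hφ.const_smul c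
  ext1 f
  apply fourier_injective
  have hsub : 𝓕 ((c • FM m φ) f) = c • (𝓕 (FM m φ f) : L2 n m) :=
    (Lp.fourierTransformₗᵢ (Rn n) (CVec m)).map_smul _ _
  rw [hsub]
  apply Lp.ext
  filter_upwards [fourier_FM_coeFn hφ f, fourier_FM_coeFn hm f,
    Lp.coeFn_smul c (𝓕 (FM m φ f) : L2 n m)] with x h1 h3 h4
  rw [h4, Pi.smul_apply, h1, h3, Pi.smul_apply, smul_eq_mul, mul_smul]

theorem inner_FM {φ : Rn n → ℂ} (hφ : MemLp φ ∞ volume) (f g : L2 n m) :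
    inner ℂ (FM m φ f) g = inner ℂ f (FM m (star φ) g) := by
  have hs : MemLp (star φ) ∞ volume := hφ.star
  rw [← Lp.inner_fourier_eq, fourier_FM, ← Lp.inner_fourier_eq f, fourier_FM]
  refine inner_mulOp (memLp_scalarMat hφ) (memLp_scalarMat hs)
    (Eventually.of_forall fun x v w => ?_) _ _
  simp [mul_comm]

/-! ### Translations and modulations -/

/-- The translation `f ↦ f(· - z)` on `L²`. -/
def transl (m : ℕ) (z : Rn n) : L2 n m →ₗᵢ[ℂ] L2 n m :=
  Lp.compMeasurePreservingₗᵢ ℂ (fun x => x - z) (measurePreserving_sub_right volume z)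

theorem transl_coeFn (z : Rn n) (f : L2 n m) : transl m z f =ᵐ[volume] fun x => f (x - z) :=
  Lp.coeFn_compMeasurePreserving f (measurePreserving_sub_right volume z)

/-- The character `x ↦ exp(2πi ⟨x, ζ⟩)`. -/
def charFn (ζ : Rn n) (x : Rn n) : ℂ := (Real.fourierChar (inner ℝ x ζ) : ℂ)

theorem memLp_charFn (ζ : Rn n) : MemLp (charFn ζ) ∞ volume := by
  refine memLp_top_of_bound (Continuous.aestronglyMeasurable ?_) 1
    (Eventually.of_forall fun x => (Circle.norm_coe _).le)
  exact continuous_subtype_val.comp (Real.continuous_fourierChar.comp (by fun_prop))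

/-- The modulation `f ↦ exp(2πi ⟨·, ζ⟩) f` on `L²`. -/
def modOp (m : ℕ) (ζ : Rn n) : L2 n m →L[ℂ] L2 n m := mulOp (scalarMat m (charFn ζ))

theorem modOp_coeFn (ζ : Rn n) (f : L2 n m) :
    modOp m ζ f =ᵐ[volume] fun x => charFn ζ x • f x :=
  mulOp_coeFn (memLp_scalarMat (memLp_charFn ζ)) f

theorem fourier_compSubConst (f : 𝓢(Rn n, CVec m)) (z w : Rn n) :
    𝓕 (fun x => f (x - z)) w = charFn (-z) w • 𝓕 (f : Rn n → CVec m) w := by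
  have h1 := VectorFourier.fourierIntegral_comp_add_right (E := CVec m) Real.fourierChar
    (volume : Measure (Rn n)) (innerₗ (Rn n)) (f : Rn n → CVec m) (-z)
  have h2 := congrFun h1 w
  simp only [← sub_eq_add_neg] at h2
  refine Eq.trans ?_ (h2.trans ?_)
  · rfl
  · rw [charFn, Circle.smul_def, innerₗ_apply_apply, real_inner_comm]; rfl

theorem schwartz_transl (f : 𝓢(Rn n, CVec m)) (z : Rn n) :
    transl m z (f.toLp 2) = (f.compSubConstCLM ℂ z).toLp 2 := by
  apply Lp.ext
  have h := (measurePreserving_sub_right volume z).quasiMeasurePreserving.ae_eq_comp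
    (f.coeFn_toLp 2 (volume : Measure (Rn n)))
  filter_upwards [transl_coeFn z (f.toLp 2), (f.compSubConstCLM ℂ z).coeFn_toLp 2, h]
    with x h1 h2 h3
  rw [h1, h2]; exact h3

theorem fourier_transl (z : Rn n) (f : L2 n m) :
    𝓕 (transl m z f) = modOp m (-z) (𝓕 f) := by
  refine DenseRange.induction_on (p := fun f : L2 n m => 𝓕 (transl m z f) = modOp m (-z) (𝓕 f))
    (SchwartzMap.denseRange_toLpCLM (p := 2) ENNReal.ofNat_ne_top) f ?_ fun f => ?_
  · refine isClosed_eq ?_ ?_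
    · exact (Lp.fourierTransformₗᵢ (Rn n) (CVec m)).continuous.comp (transl m z).continuous
    · exact (modOp m (-z)).continuous.comp (Lp.fourierTransformₗᵢ (Rn n) (CVec m)).continuous
  · simp only [SchwartzMap.toLpCLM_apply]
    rw [schwartz_transl, SchwartzMap.toLp_fourier_eq, SchwartzMap.toLp_fourier_eq]
    apply Lp.ext
    filter_upwards [modOp_coeFn (-z) ((𝓕 f).toLp 2), (𝓕 f).coeFn_toLp 2,
      (𝓕 (f.compSubConstCLM ℂ z)).coeFn_toLp 2] with x h1 h2 h3
    rw [h1, h2, h3, SchwartzMap.fourier_coe, SchwartzMap.fourier_coe, ← fourier_compSubConst]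
    rfl

theorem fourierInv_transl (z : Rn n) (f : L2 n m) :
    𝓕⁻ (transl m z f) = modOp m z (𝓕⁻ f) := by
  refine DenseRange.induction_on (p := fun f : L2 n m => 𝓕⁻ (transl m z f) = modOp m z (𝓕⁻ f))
    (SchwartzMap.denseRange_toLpCLM (p := 2) ENNReal.ofNat_ne_top) f ?_ fun f => ?_
  · refine isClosed_eq ?_ ?_
    · exact (Lp.fourierTransformₗᵢ (Rn n) (CVec m)).symm.continuous.comp (transl m z).continuous
    · exact (modOp m z).continuous.comp (Lp.fourierTransformₗᵢ (Rn n) (CVec m)).symm.continuous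
  · simp only [SchwartzMap.toLpCLM_apply]
    rw [schwartz_transl, SchwartzMap.toLp_fourierInv_eq, SchwartzMap.toLp_fourierInv_eq]
    apply Lp.ext
    filter_upwards [modOp_coeFn z ((𝓕⁻ f).toLp 2), (𝓕⁻ f).coeFn_toLp 2,
      (𝓕⁻ (f.compSubConstCLM ℂ z)).coeFn_toLp 2] with x h1 h2 h3
    rw [h1, h2, h3, SchwartzMap.fourierInv_coe, SchwartzMap.fourierInv_coe,
      Real.fourierInv_eq_fourier_neg, Real.fourierInv_eq_fourier_neg]
    refine (fourier_compSubConst f z (-x)).trans ?_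
    simp [charFn]

theorem fourier_modOp (ζ : Rn n) (f : L2 n m) :
    𝓕 (modOp m ζ f) = transl m ζ (𝓕 f) := by
  have h := fourierInv_transl ζ (𝓕 f : L2 n m)
  rw [FourierTransform.fourierInv_fourier_eq] at h
  rw [← h, FourierTransform.fourier_fourierInv_eq]

/-- The Fourier transform of the integrable function `⟨f, g⟩` consists of matrix elements of
modulations. -/
theorem fourier_inner_eq (f g : L2 n m) (z : Rn n) :
    𝓕 (fun x => inner ℂ (f x) (g x)) z = inner ℂ f (modOp m (-z) g) := by
  rw [L2.inner_def, Real.fourier_eq]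
  refine integral_congr_ae ?_
  filter_upwards [modOp_coeFn (-z) g] with x h
  rw [h, inner_smul_right, charFn, Circle.smul_def, inner_neg_right, smul_eq_mul]

/-- The pairing of a bounded function `𝓕 K` with `⟨f, g⟩`, as a superposition of modulations. -/
theorem integral_fourier_mul_inner {K : Rn n → ℂ} (hK : Integrable K) (f g : L2 n m) :
    ∫ x, 𝓕 K x * inner ℂ (f x) (g x) = ∫ z, K z * inner ℂ f (modOp m (-z) g) := by
  have h := VectorFourier.integral_fourierIntegral_smul_eq_flip (e := Real.fourierChar)
    (L := innerₗ (Rn n)) (f := K) (g := fun x => inner ℂ (f x) (g x))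
    (μ := volume) (ν := volume) Real.continuous_fourierChar
    (by exact continuous_inner) hK (L2.integrable_inner f g)
  rw [flip_innerₗ] at h
  simp only [smul_eq_mul] at h
  refine Eq.trans h ?_
  congr 1
  ext z
  rw [← fourier_inner_eq]
  rfl

theorem continuous_inner_modOp (f g : L2 n m) :
    Continuous (fun z => inner ℂ f (modOp m (-z) g)) := by
  simp_rw [← fourier_inner_eq]
  exact VectorFourier.fourierIntegral_continuous Real.continuous_fourierChar
    (by exact continuous_inner) (L2.integrable_inner f g)

/-- A Fourier multiplier whose symbol is the Fourier transform of an integrable kernel is a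
superposition of translations. -/
theorem inner_FM_eq_integral {K φ : Rn n → ℂ} (hK : Integrable K) (hφ : MemLp φ ∞ volume)
    (h : ∀ ξ, 𝓕 K ξ = φ ξ) (f g : L2 n m) :
    inner ℂ f (FM m φ g) = ∫ z, K z * inner ℂ f (transl m z g) := by
  rw [← Lp.inner_fourier_eq, L2.inner_def]
  have h1 : ∀ z, inner ℂ f (transl m z g) =
      inner ℂ (𝓕 f : L2 n m) (modOp m (-z) (𝓕 g : L2 n m)) := fun z => by
    rw [← fourier_transl, Lp.inner_fourier_eq]
  simp_rw [h1]
  rw [← integral_fourier_mul_inner hK]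
  refine integral_congr_ae ?_
  filter_upwards [fourier_FM_coeFn hφ g] with ξ h2
  rw [h2, inner_smul_right, h]

theorem integrable_mul_inner_transl {K : Rn n → ℂ} (hK : Integrable K) (f g : L2 n m) :
    Integrable (fun z => K z * inner ℂ f (transl m z g)) := by
  have h1 : ∀ z, inner ℂ f (transl m z g) =
      inner ℂ (𝓕 f : L2 n m) (modOp m (-z) (𝓕 g : L2 n m)) := fun z => by
    rw [← fourier_transl, Lp.inner_fourier_eq]
  refine hK.mul_bdd (c := ‖f‖ * ‖g‖) ?_ (Eventually.of_forall fun z => ?_)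
  · simp_rw [h1]
    exact (continuous_inner_modOp _ _).aestronglyMeasurable
  · refine (norm_inner_le_norm _ _).trans ?_
    rw [(transl m z).norm_map]

theorem opNorm_le_of_inner {H : Type*} [NormedAddCommGroup H] [InnerProductSpace ℂ H]
    {A : H →L[ℂ] H} {C : ℝ} (hC : 0 ≤ C) (h : ∀ f g, ‖inner ℂ f (A g)‖ ≤ C * ‖f‖ * ‖g‖) :
    ‖A‖ ≤ C := by
  refine ContinuousLinearMap.opNorm_le_bound _ hC fun g => ?_
  have h1 := h (A g) g
  rw [inner_self_eq_norm_sq_to_K, norm_pow, RCLike.norm_ofReal, abs_norm] at h1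
  rcases (norm_nonneg (A g)).eq_or_lt with h0 | h0
  · rw [← h0]; positivity
  · nlinarith

/-! ### Commutators of Fourier multipliers and multiplication operators -/

/-- Calderón's commutator estimate for a smooth symbol: the commutator with a Lipschitz function is
bounded by the first absolute moment of the kernel. -/
theorem norm_commutator_le {K φ : Rn n → ℂ} (hK : Integrable K)
    (hK1 : Integrable fun z => ‖z‖ * ‖K z‖) (hφ : MemLp φ ∞ volume) (h : ∀ ξ, 𝓕 K ξ = φ ξ)
    {M : Rn n → CVec m →L[ℂ] CVec m} (hM : MemLp M ∞ volume) {Λ : ℝ} (hΛ : 0 ≤ Λ)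
    (hLip : ∀ x z, ‖M (x - z) - M x‖ ≤ Λ * ‖z‖) :
    ‖FM m φ ∘L mulOp M - mulOp M ∘L FM m φ‖ ≤ Λ * ∫ z, ‖z‖ * ‖K z‖ := by
  have hpos : 0 ≤ ∫ z, ‖z‖ * ‖K z‖ := integral_nonneg fun z => by positivity
  have hMad : MemLp (fun x => ContinuousLinearMap.adjoint (M x)) ∞ volume := by
    refine ⟨?_, ?_⟩
    · exact ContinuousLinearMap.adjoint.continuous.comp_aestronglyMeasurable hM.1
    · rw [eLpNorm_congr_norm_ae (g := M) (Eventually.of_forall fun x => by simp)]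
      exact hM.2
  refine opNorm_le_of_inner (by positivity) fun f g => ?_
  have hadj : ∀ g, inner ℂ f (mulOp M g) =
      inner ℂ (mulOp (fun x => ContinuousLinearMap.adjoint (M x)) f) g := fun g =>
    (inner_mulOp hMad hM (Eventually.of_forall fun x v w => by
      rw [ContinuousLinearMap.adjoint_inner_left]) _ _).symm
  have hcomm : ∀ z, ‖transl m z (mulOp M g) - mulOp M (transl m z g)‖ ≤ Λ * ‖z‖ * ‖g‖ := by
    intro z
    rw [← (transl m z).norm_map g]
    refine Lp.norm_le_mul_norm_of_ae_le_mul ?_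
    have h4 := (measurePreserving_sub_right volume z).quasiMeasurePreserving.ae_eq_comp
      (mulOp_coeFn hM g)
    filter_upwards [Lp.coeFn_sub (transl m z (mulOp M g)) (mulOp M (transl m z g)),
      transl_coeFn z (mulOp M g), mulOp_coeFn hM (transl m z g), h4, transl_coeFn z g]
      with x h1 h2 h3 h4 h5
    have h4' : (mulOp M g) (x - z) = M (x - z) (g (x - z)) := h4
    rw [h1, Pi.sub_apply, h2, h3, h4', h5, ← sub_apply]
    exact (ContinuousLinearMap.le_opNorm _ _).trans (by gcongr; exact hLip x z)
  simp only [sub_apply, ContinuousLinearMap.comp_apply, inner_sub_right]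
  rw [hadj, inner_FM_eq_integral hK hφ h, inner_FM_eq_integral hK hφ h,
    ← integral_sub (integrable_mul_inner_transl hK _ _) (integrable_mul_inner_transl hK _ _)]
  simp_rw [← hadj, ← mul_sub, ← inner_sub_right]
  calc ‖∫ z, K z * inner ℂ f (transl m z (mulOp M g) - mulOp M (transl m z g))‖
      ≤ ∫ z, (Λ * ‖f‖ * ‖g‖) * (‖z‖ * ‖K z‖) := by
        refine norm_integral_le_of_norm_le (hK1.const_mul _) (Eventually.of_forall fun z => ?_)
        rw [norm_mul]
        calc _ ≤ ‖K z‖ * (‖f‖ * (Λ * ‖z‖ * ‖g‖)) := by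
              gcongr
              exact (norm_inner_le_norm _ _).trans (by gcongr; exact hcomm z)
          _ = _ := by ring
    _ = _ := by rw [integral_const_mul]; ring

/-! ### Frequency localization of products -/

theorem integrable_charFn_mul_comp_neg {κ : Rn n → ℂ} (hκ : Integrable κ) (y : Rn n) :
    Integrable (fun ζ => charFn y ζ * κ (-ζ)) := by
  have h : Integrable (fun ζ => κ (-ζ)) := hκ.comp_neg
  exact h.bdd_mul (c := 1) (memLp_charFn y).1 (Eventually.of_forall fun x => (Circle.norm_coe _).le)

theorem fourierInv_sub_eq_fourier (κ : Rn n → ℂ) (y x : Rn n) :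
    𝓕⁻ κ (x - y) = 𝓕 (fun ζ => charFn y ζ * κ (-ζ)) x := by
  rw [Real.fourierInv_eq_fourier_comp_neg, Real.fourier_eq, Real.fourier_eq]
  refine integral_congr_ae (Eventually.of_forall fun v => ?_)
  simp only [charFn, Circle.smul_def, smul_eq_mul]
  rw [← mul_assoc, ← Circle.coe_mul, ← AddChar.map_add_eq_mul, inner_sub_right]
  congr 3; ring

/-- The mechanism of frequency localization: for each `y`, multiplication by `x ↦ 𝓕⁻ κ (x - y)` is a
superposition of modulations by frequencies of norm less than `R`, none of which connects the
support of `β` with that of `α`. -/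
theorem integral_fourierInv_sub_mul_inner_eq_zero {κ : Rn n → ℂ} (hκ : Integrable κ) {R : ℝ}
    (hR : ∀ ζ, R ≤ ‖ζ‖ → κ ζ = 0) {α β : Rn n → ℂ} (hα : MemLp α ∞ volume)
    (hβ : MemLp β ∞ volume) (hαβ : ∀ ξ η, ‖ξ - η‖ < R → α ξ = 0 ∨ β η = 0) (g h : L2 n m)
    (y : Rn n) :
    ∫ x, 𝓕⁻ κ (x - y) * inner ℂ (FM m (star α) g x) (FM m β h x) = 0 := by
  have hs : MemLp (star α) ∞ volume := hα.star
  simp_rw [fourierInv_sub_eq_fourier κ y]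
  rw [integral_fourier_mul_inner (integrable_charFn_mul_comp_neg hκ y)]
  refine integral_eq_zero_of_ae (Eventually.of_forall fun ζ => ?_)
  simp only [Pi.zero_apply, mul_eq_zero]
  by_cases hζ : R ≤ ‖ζ‖
  · left; right; exact hR _ (by rwa [norm_neg])
  · right
    rw [← Lp.inner_fourier_eq, fourier_modOp, L2.inner_def]
    refine integral_eq_zero_of_ae ?_
    have h3 := (measurePreserving_sub_right volume (-ζ)).quasiMeasurePreserving.ae_eq_comp
      (fourier_FM_coeFn hβ h)
    filter_upwards [transl_coeFn (-ζ) (𝓕 (FM m β h) : L2 n m), fourier_FM_coeFn hs g, h3]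
      with ξ h4 h5 h6
    have h6' : (𝓕 (FM m β h) : L2 n m) (ξ - -ζ) = β (ξ - -ζ) • (𝓕 h : L2 n m) (ξ - -ζ) := h6
    rw [h4, h5, h6', inner_smul_left, inner_smul_right, Pi.star_apply, RCLike.star_def,
      Complex.conj_conj]
    rcases hαβ ξ (ξ - -ζ) (by simpa using not_le.mp hζ) with h7 | h7 <;> rw [h7] <;> simp

theorem integrable_mul_convolution_integrand {k u f : Rn n → ℂ} (hk : Integrable k)
    (hu : Integrable u) {C : ℝ} (hf : AEStronglyMeasurable f volume)
    (hfC : ∀ᵐ x, ‖f x‖ ≤ C) :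
    Integrable (fun p : Rn n × Rn n => k (p.1 - p.2) * f p.2 * u p.1)
      ((volume : Measure (Rn n)).prod volume) := by
  have h10 : Integrable (fun p : Rn n × Rn n => k (p.1 - p.2) * u p.1)
      ((volume : Measure (Rn n)).prod volume) := by
    have h := (hu.convolution_integrand (ContinuousLinearMap.mul ℂ ℂ) hk.comp_neg).swap
    refine h.congr (Eventually.of_forall fun p => ?_)
    simp [mul_comm]
  have h11 : AEStronglyMeasurable (fun p : Rn n × Rn n => f p.2)
      ((volume : Measure (Rn n)).prod volume) := hf.comp_snd
  have h12 : ∀ᵐ p : Rn n × Rn n ∂((volume : Measure (Rn n)).prod volume), ‖f p.2‖ ≤ C :=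
    Measure.quasiMeasurePreserving_snd.ae hfC
  refine (h10.bdd_mul h11 h12).congr (Eventually.of_forall fun p => ?_)
  ring

/-- Multiplication by a function with frequencies in the ball of radius `R` moves frequencies by
less than `R`. -/
theorem FM_mulOp_FM_eq_zero {κ : Rn n → ℂ} (hκ : Integrable κ) (hk : Integrable (𝓕⁻ κ))
    {f : Rn n → ℂ} {C R : ℝ} (hf : AEStronglyMeasurable f volume) (hfC : ∀ᵐ x, ‖f x‖ ≤ C)
    (hR : ∀ ζ, R ≤ ‖ζ‖ → κ ζ = 0) {α β : Rn n → ℂ} (hα : MemLp α ∞ volume)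
    (hβ : MemLp β ∞ volume) (hαβ : ∀ ξ η, ‖ξ - η‖ < R → α ξ = 0 ∨ β η = 0)
    (ha : MemLp (fun x => ∫ y, 𝓕⁻ κ (x - y) * f y) ∞ volume) :
    FM m α ∘L mulOp (scalarMat m fun x => ∫ y, 𝓕⁻ κ (x - y) * f y) ∘L FM m β = 0 := by
  ext1 h
  refine ext_inner_left ℂ fun g => ?_
  have hs : MemLp (star α) ∞ volume := hα.star
  simp only [ContinuousLinearMap.comp_apply, zero_apply, inner_zero_right]
  have h1 : ∀ u, inner ℂ g (FM m α u) = inner ℂ (FM m (star α) g) u := fun u => by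
    rw [inner_FM hs, star_star]
  rw [h1, L2.inner_def]
  have hkey := integral_fourierInv_sub_mul_inner_eq_zero hκ hR hα hβ hαβ g h
  have hui := L2.integrable_inner (𝕜 := ℂ) (FM m (star α) g) (FM m β h)
  generalize FM m (star α) g = g₁ at *
  generalize FM m β h = h₁ at *
  have h8 : ∫ x, inner ℂ (g₁ x)
      ((mulOp (scalarMat m fun x => ∫ y, 𝓕⁻ κ (x - y) * f y) h₁ : L2 n m) x) =
      ∫ x, ∫ y, 𝓕⁻ κ (x - y) * f y * inner ℂ (g₁ x) (h₁ x) := by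
    refine integral_congr_ae ?_
    filter_upwards [mulOp_coeFn (memLp_scalarMat ha) h₁] with x h9
    rw [h9, scalarMat_apply, inner_smul_right, integral_mul_const]
  rw [h8, integral_integral_swap (integrable_mul_convolution_integrand hk hui hf hfC)]
  refine integral_eq_zero_of_ae (Eventually.of_forall fun y => ?_)
  calc ∫ x, 𝓕⁻ κ (x - y) * f y * inner ℂ (g₁ x) (h₁ x)
      = ∫ x, f y * (𝓕⁻ κ (x - y) * inner ℂ (g₁ x) (h₁ x)) := by
        congr 1; ext x; ring
    _ = 0 := by rw [integral_const_mul, hkey, mul_zero]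

end

noncomputable section

/-! ### Weak measurability and almost orthogonal sums -/

section Hilbert

variable {H : Type*} [NormedAddCommGroup H] [InnerProductSpace ℂ H]

theorem HilbertBasis.countable [TopologicalSpace.SeparableSpace H] {w : Set H}
    (b : HilbertBasis w ℂ H) : w.Countable := by
  have hb := b.orthonormal
  have hdist : ∀ i j : w, i ≠ j → 1 ≤ dist (b i) (b j) := by
    intro i j hij
    have h := norm_sub_sq (𝕜 := ℂ) (b i) (b j)
    rw [hb.2 hij, hb.1, hb.1] at h
    rw [dist_eq_norm]
    simp only [map_zero] at h
    nlinarith [norm_nonneg (b i - b j)]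
  have h := Pairwise.countable_of_isOpen_disjoint (s := fun i : w => Metric.ball (b i) (1 / 2))
    (fun i j hij => Metric.ball_disjoint_ball (by linarith [hdist i j hij]))
    (fun i => Metric.isOpen_ball) (fun i => ⟨b i, Metric.mem_ball_self (by norm_num)⟩)
  exact h

/-- Weak measurability implies strong measurability in separable Hilbert spaces. -/
theorem aestronglyMeasurable_of_inner [CompleteSpace H] [TopologicalSpace.SeparableSpace H]
    {α : Type*} [MeasurableSpace α] {μ : Measure α} {f : α → H}
    (h : ∀ g, AEStronglyMeasurable (fun s => inner ℂ g (f s)) μ) : AEStronglyMeasurable f μ := by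
  obtain ⟨w, b, -⟩ := exists_hilbertBasis ℂ H
  have : Countable w := b.countable
  refine aestronglyMeasurable_of_tendsto_ae (atTop : Filter (Finset w))
    (f := fun F s => ∑ i ∈ F, inner ℂ (b i) (f s) • b i) (fun F => ?_)
    (Eventually.of_forall fun s => ?_)
  · exact Finset.aestronglyMeasurable_fun_sum _ fun i _ => (h (b i)).smul_const (b i)
  · have := b.hasSum_repr (f s)
    simp only [b.repr_apply_apply] at this
    exact this

variable {ψ T : ℤ → H →L[ℂ] H} {N C : ℝ}

/-- The Cotlar-type estimate for a sum of operators which are localized by a family of bounded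
overlap. -/
theorem norm_sq_sum_localized_le (hψ : ∀ k x y, inner ℂ (ψ k x) y = inner ℂ x (ψ k y))
    (hN : ∀ (F : Finset ℤ) x, ∑ k ∈ F, ‖ψ k x‖ ^ 2 ≤ N * ‖x‖ ^ 2)
    (hT : ∀ k x, ψ k (T k (ψ k x)) = T k x) (hC : ∀ k, ‖T k‖ ≤ C) (F : Finset ℤ) (x : H) :
    ‖∑ k ∈ F, T k x‖ ^ 2 ≤ C ^ 2 * N * ∑ k ∈ F, ‖ψ k x‖ ^ 2 := by
  set y := ∑ k ∈ F, T k x with hy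
  have hC0 : 0 ≤ C := (norm_nonneg _).trans (hC 0)
  have h1 : ‖y‖ ^ 2 ≤ C * ∑ k ∈ F, ‖ψ k y‖ * ‖ψ k x‖ := by
    have h2 : ‖y‖ ^ 2 = ‖∑ k ∈ F, inner ℂ y (T k x)‖ := by
      rw [← inner_sum, ← hy, inner_self_eq_norm_sq_to_K, norm_pow, RCLike.norm_ofReal, abs_norm]
    rw [h2, Finset.mul_sum]
    refine (norm_sum_le _ _).trans (Finset.sum_le_sum fun k _ => ?_)
    rw [← hT, ← hψ]
    calc _ ≤ ‖ψ k y‖ * ‖T k (ψ k x)‖ := norm_inner_le_norm _ _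
      _ ≤ ‖ψ k y‖ * (C * ‖ψ k x‖) := by
          gcongr; exact (T k).le_of_opNorm_le (hC k) _
      _ = _ := by ring
  have hS : 0 ≤ ∑ k ∈ F, ‖ψ k x‖ ^ 2 := Finset.sum_nonneg fun _ _ => by positivity
  have h3 := Finset.sum_mul_sq_le_sq_mul_sq F (fun k => ‖ψ k y‖) (fun k => ‖ψ k x‖)
  have h4 : (‖y‖ ^ 2) ^ 2 ≤ C ^ 2 * (N * ‖y‖ ^ 2 * ∑ k ∈ F, ‖ψ k x‖ ^ 2) := by
    calc (‖y‖ ^ 2) ^ 2 ≤ (C * ∑ k ∈ F, ‖ψ k y‖ * ‖ψ k x‖) ^ 2 := by gcongr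
      _ = C ^ 2 * (∑ k ∈ F, ‖ψ k y‖ * ‖ψ k x‖) ^ 2 := by ring
      _ ≤ C ^ 2 * ((∑ k ∈ F, ‖ψ k y‖ ^ 2) * ∑ k ∈ F, ‖ψ k x‖ ^ 2) := by gcongr
      _ ≤ _ := by gcongr; exact hN F y
  rcases eq_or_ne y 0 with h0 | h0
  · have h5 : 0 ≤ N * ‖x‖ ^ 2 := hS.trans (hN F x)
    rcases eq_or_ne x 0 with hx | hx
    · simp [h0, hx]
    · have : 0 ≤ N := nonneg_of_mul_nonneg_left h5 (by positivity)
      rw [h0, norm_zero, zero_pow two_ne_zero]; positivity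
  · have : 0 < ‖y‖ ^ 2 := by positivity
    refine le_of_mul_le_mul_right ?_ this
    nlinarith

theorem summable_norm_sq_of_overlap
    (hN : ∀ (F : Finset ℤ) x, ∑ k ∈ F, ‖ψ k x‖ ^ 2 ≤ N * ‖x‖ ^ 2) (x : H) :
    Summable (fun k => ‖ψ k x‖ ^ 2) :=
  summable_of_sum_le (fun _ => sq_nonneg _) fun F => hN F x

/-- The localized sum converges strongly, since its blocks are controlled by the tails of
`∑ ‖ψ k x‖²`. -/
theorem summable_localized [CompleteSpace H] (hN0 : 0 ≤ N)
    (hψ : ∀ k x y, inner ℂ (ψ k x) y = inner ℂ x (ψ k y))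
    (hN : ∀ (F : Finset ℤ) x, ∑ k ∈ F, ‖ψ k x‖ ^ 2 ≤ N * ‖x‖ ^ 2)
    (hT : ∀ k x, ψ k (T k (ψ k x)) = T k x) (hC : ∀ k, ‖T k‖ ≤ C) (x : H) :
    Summable (fun k => T k x) := by
  rw [summable_iff_vanishing_norm]
  intro ε hε
  obtain ⟨s, hs⟩ := summable_iff_vanishing_norm.mp (summable_norm_sq_of_overlap hN x)
    (ε ^ 2 / (C ^ 2 * N + 1)) (by positivity)
  refine ⟨s, fun t ht => lt_of_pow_lt_pow_left₀ 2 hε.le ?_⟩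
  have h1 := hs t ht
  rw [Real.norm_of_nonneg (Finset.sum_nonneg fun _ _ => by positivity), lt_div_iff₀ (by positivity)]
    at h1
  have h2 := norm_sq_sum_localized_le hψ hN hT hC t x
  have h3 : 0 ≤ ∑ k ∈ t, ‖ψ k x‖ ^ 2 := Finset.sum_nonneg fun _ _ => by positivity
  linarith

/-- The sum of a family of operators which are localized by a family of bounded overlap. -/
theorem exists_hasSum_localized [CompleteSpace H] (hN0 : 0 ≤ N)
    (hψ : ∀ k x y, inner ℂ (ψ k x) y = inner ℂ x (ψ k y))
    (hN : ∀ (F : Finset ℤ) x, ∑ k ∈ F, ‖ψ k x‖ ^ 2 ≤ N * ‖x‖ ^ 2)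
    (hT : ∀ k x, ψ k (T k (ψ k x)) = T k x) (hC : ∀ k, ‖T k‖ ≤ C) :
    ∃ Γ : H →L[ℂ] H, (∀ x, HasSum (fun k => T k x) (Γ x)) ∧ ‖Γ‖ ≤ C * N := by
  have hC0 : 0 ≤ C := (norm_nonneg _).trans (hC 0)
  have hs := summable_localized hN0 hψ hN hT hC
  let L : H →ₗ[ℂ] H :=
    { toFun := fun x => ∑' k, T k x
      map_add' := fun x y => by
        simp only [map_add]; exact (hs x).tsum_add (hs y)
      map_smul' := fun c x => by
        simp only [map_smul, RingHom.id_apply]; exact (hs x).tsum_const_smul c }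
  have hL : ∀ x, ‖L x‖ ≤ C * N * ‖x‖ := by
    intro x
    have h1 : Tendsto (fun F => ‖∑ k ∈ F, T k x‖) atTop (𝓝 ‖L x‖) := ((hs x).hasSum).norm
    refine le_of_tendsto h1 (Eventually.of_forall fun F => ?_)
    refine le_of_sq_le_sq ?_ (by positivity)
    calc _ ≤ C ^ 2 * N * ∑ k ∈ F, ‖ψ k x‖ ^ 2 := norm_sq_sum_localized_le hψ hN hT hC F x
      _ ≤ C ^ 2 * N * (N * ‖x‖ ^ 2) := by gcongr; exact hN F x
      _ = _ := by ring
  exact ⟨L.mkContinuous _ hL, fun x => (hs x).hasSum, L.mkContinuous_norm_le (by positivity) hL⟩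

/-- Quadratic form estimates add up over a localized family. -/
theorem abs_re_inner_le_of_hasSum
    (hN : ∀ (F : Finset ℤ) x, ∑ k ∈ F, ‖ψ k x‖ ^ 2 ≤ N * ‖x‖ ^ 2) {Γ M J : H →L[ℂ] H}
    {x : H} (hΓ : HasSum (fun k => T k x) (Γ x)) {b : ℝ} (hb : 0 ≤ b)
    (h : ∀ k, |(inner ℂ (M (T k x)) (J x)).re| ≤ b * ‖ψ k x‖ ^ 2) :
    |(inner ℂ (M (Γ x)) (J x)).re| ≤ b * N * ‖x‖ ^ 2 := by
  have h1 : HasSum (fun k => (inner ℂ (J x) (M (T k x))).re) (inner ℂ (J x) (M (Γ x))).re :=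
    Complex.hasSum_re ((innerSL ℂ (J x) ∘L M).hasSum hΓ)
  have h2 := (summable_norm_sq_of_overlap hN x).mul_left b
  have h3 := HasSum.norm_le_of_bounded h1 h2.hasSum fun k => by
    rw [Real.norm_eq_abs, ← inner_conj_symm, Complex.conj_re]; exact h k
  rw [← inner_conj_symm, Complex.conj_re]
  refine h3.trans ?_
  rw [tsum_mul_left, mul_assoc]
  gcongr
  exact (summable_norm_sq_of_overlap hN x).tsum_le_of_sum_le fun F => hN F x

end Hilbert

/-! ### Symbols with integrable kernels -/

variable {n m : ℕ}

/-- A symbol `φ` whose kernel `𝓕⁻ φ` is integrable with norm at most `B` and has first absolute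
moment at most `D`. -/
structure SymbolBound (φ : Rn n → ℂ) (B D : ℝ) : Prop where
  cont : Continuous φ
  integrable : Integrable φ
  integrable_kernel : Integrable (𝓕⁻ φ)
  integrable_moment : Integrable fun z => ‖z‖ * ‖𝓕⁻ φ z‖
  norm_kernel : ∫ z, ‖𝓕⁻ φ z‖ ≤ B
  moment : ∫ z, ‖z‖ * ‖𝓕⁻ φ z‖ ≤ D

namespace SymbolBound

variable {φ : Rn n → ℂ} {B D : ℝ}

theorem fourier_kernel (h : SymbolBound φ B D) : 𝓕 (𝓕⁻ φ) = φ := by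
  refine h.cont.fourier_fourierInv_eq h.integrable ?_
  have := h.integrable_kernel.comp_neg
  rwa [show (fun x => 𝓕⁻ φ (-x)) = 𝓕 φ by
    ext x; rw [Real.fourierInv_eq_fourier_neg, neg_neg]] at this

theorem norm_le (h : SymbolBound φ B D) (ξ : Rn n) : ‖φ ξ‖ ≤ B := by
  rw [← h.fourier_kernel]
  exact (VectorFourier.norm_fourierIntegral_le_integral_norm _ _ _ _ _).trans h.norm_kernel

theorem bound_nonneg (h : SymbolBound φ B D) : 0 ≤ B := (norm_nonneg _).trans (h.norm_le 0)

theorem moment_nonneg (h : SymbolBound φ B D) : 0 ≤ D :=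
  (integral_nonneg fun z => by positivity).trans h.moment

theorem memLp (h : SymbolBound φ B D) : MemLp φ ∞ volume :=
  memLp_top_of_bound h.cont.aestronglyMeasurable B (Eventually.of_forall h.norm_le)

theorem norm_FM (h : SymbolBound φ B D) : ‖FM m φ‖ ≤ B := norm_FM_le h.bound_nonneg h.norm_le

theorem norm_commutator (h : SymbolBound φ B D) {M : Rn n → CVec m →L[ℂ] CVec m}
    (hM : MemLp M ∞ volume) {Λ : ℝ} (hΛ : 0 ≤ Λ) (hLip : ∀ x z, ‖M (x - z) - M x‖ ≤ Λ * ‖z‖) :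
    ‖FM m φ ∘L mulOp M - mulOp M ∘L FM m φ‖ ≤ Λ * D :=
  (norm_commutator_le h.integrable_kernel h.integrable_moment h.memLp
    (fun ξ => congrFun h.fourier_kernel ξ) hM hΛ hLip).trans (by gcongr; exact h.moment)

theorem mono (h : SymbolBound φ B D) {B' D' : ℝ} (hB : B ≤ B') (hD : D ≤ D') :
    SymbolBound φ B' D' :=
  { h with norm_kernel := h.norm_kernel.trans hB, moment := h.moment.trans hD }

theorem fourierInv_const_mul (c : ℂ) (φ : Rn n → ℂ) (z : Rn n) :
    𝓕⁻ (fun ξ => c * φ ξ) z = c * 𝓕⁻ φ z := by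
  rw [Real.fourierInv_eq, Real.fourierInv_eq, ← integral_const_mul]
  congr 1; ext v
  simp only [Circle.smul_def, smul_eq_mul]; ring

theorem const_mul (h : SymbolBound φ B D) (c : ℂ) :
    SymbolBound (fun ξ => c * φ ξ) (‖c‖ * B) (‖c‖ * D) where
  cont := continuous_const.mul h.cont
  integrable := h.integrable.const_mul c
  integrable_kernel := by
    rw [show 𝓕⁻ (fun ξ => c * φ ξ) = fun z => c * 𝓕⁻ φ z from funext (fourierInv_const_mul c φ)]
    exact h.integrable_kernel.const_mul c
  integrable_moment := by
    simp_rw [fourierInv_const_mul, norm_mul]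
    refine (h.integrable_moment.const_mul ‖c‖).congr (Eventually.of_forall fun z => ?_)
    ring
  norm_kernel := by
    simp_rw [fourierInv_const_mul, norm_mul, integral_const_mul]
    gcongr; exact h.norm_kernel
  moment := by
    simp_rw [fourierInv_const_mul, norm_mul]
    rw [show (fun z => ‖z‖ * (‖c‖ * ‖𝓕⁻ φ z‖)) = fun z => ‖c‖ * (‖z‖ * ‖𝓕⁻ φ z‖) by
      ext z; ring, integral_const_mul]
    gcongr; exact h.moment

theorem fourierInv_comp_smul (φ : Rn n → ℂ) {r : ℝ} (hr : 0 < r) (z : Rn n) :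
    𝓕⁻ (fun ξ => φ (r • ξ)) z = ((r ^ n)⁻¹ : ℝ) • 𝓕⁻ φ (r⁻¹ • z) := by
  have h := Measure.integral_comp_smul (volume : Measure (Rn n))
    (fun v => Real.fourierChar (inner ℝ v (r⁻¹ • z)) • φ v) r
  rw [finrank_euclideanSpace_fin, abs_of_nonneg (by positivity)] at h
  rw [Real.fourierInv_eq, Real.fourierInv_eq, ← h]
  congr 1; ext v
  rw [inner_smul_left, inner_smul_right]
  simp only [conj_trivial]
  rw [mul_inv_cancel_left₀ hr.ne']

/-- Dilations of the symbol preserve the `L¹` norm of the kernel and scale its first moment. This is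
what makes the bounds for dyadic symbols uniform in the frequency. -/
theorem comp_smul (h : SymbolBound φ B D) {r : ℝ} (hr : 0 < r) :
    SymbolBound (fun ξ => φ (r • ξ)) B (r * D) where
  cont := h.cont.comp (continuous_const_smul r)
  integrable := h.integrable.comp_smul hr.ne'
  integrable_kernel := by
    rw [show 𝓕⁻ (fun ξ => φ (r • ξ)) = fun z => ((r ^ n)⁻¹ : ℝ) • 𝓕⁻ φ (r⁻¹ • z) from
      funext (fourierInv_comp_smul φ hr)]
    exact (h.integrable_kernel.comp_smul (inv_ne_zero hr.ne')).smul ((r ^ n)⁻¹ : ℝ)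
  integrable_moment := by
    simp_rw [fourierInv_comp_smul φ hr, norm_smul]
    refine ((h.integrable_moment.comp_smul (inv_ne_zero hr.ne')).const_mul
      (r * ‖(r ^ n)⁻¹‖)).congr (Eventually.of_forall fun z => ?_)
    simp only [norm_smul, norm_inv, Real.norm_of_nonneg hr.le]
    field_simp
  norm_kernel := by
    simp_rw [fourierInv_comp_smul φ hr, norm_smul, integral_const_mul]
    rw [Measure.integral_comp_smul volume (fun z => ‖𝓕⁻ φ z‖), finrank_euclideanSpace_fin,
      smul_eq_mul, ← mul_assoc, Real.norm_of_nonneg (by positivity), abs_of_nonneg (by positivity),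
      inv_pow, inv_inv, inv_mul_cancel₀ (by positivity), one_mul]
    exact h.norm_kernel
  moment := by
    have h1 := Measure.integral_comp_smul volume (fun z : Rn n => ‖z‖ * ‖𝓕⁻ φ z‖) r⁻¹
    rw [finrank_euclideanSpace_fin, smul_eq_mul, abs_of_nonneg (by positivity), inv_pow,
      inv_inv] at h1
    have h2 : ∀ z, ‖z‖ * ‖𝓕⁻ (fun ξ => φ (r • ξ)) z‖ =
        (r * (r ^ n)⁻¹) * (‖r⁻¹ • z‖ * ‖𝓕⁻ φ (r⁻¹ • z)‖) := by
      intro z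
      rw [fourierInv_comp_smul φ hr, norm_smul, norm_smul, Real.norm_of_nonneg (by positivity),
        Real.norm_of_nonneg (by positivity)]
      field_simp
    simp_rw [h2]
    rw [integral_const_mul, h1, ← mul_assoc, mul_assoc r, inv_mul_cancel₀ (by positivity), mul_one]
    gcongr
    exact h.moment

end SymbolBound

/-- A smooth family of symbols with uniformly compact supports has uniformly bounded kernels over
compact sets of parameters. -/
theorem exists_symbolBound_of_contDiff {E : Type*} [NormedAddCommGroup E] [NormedSpace ℝ E]
    {F : E × Rn n → ℂ} (hF : ContDiff ℝ ∞ F) {P : Set E} (hP : IsCompact P) {R : ℝ}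
    (hR : ∀ p ∈ P, ∀ ξ, R < ‖ξ‖ → F (p, ξ) = 0) :
    ∃ C, ∀ p ∈ P, SymbolBound (fun ξ => F (p, ξ)) C C := by
  have hsm : ∀ p, ContDiff ℝ ∞ fun ξ => F (p, ξ) := fun p => hF.comp (by fun_prop)
  have hsupp : ∀ p ∈ P, HasCompactSupport fun ξ => F (p, ξ) := fun p hp =>
    HasCompactSupport.intro (isCompact_closedBall (0 : Rn n) R) fun ξ hξ =>
      hR p hp ξ (by simpa using hξ)
  let f : P → 𝓢(Rn n, ℂ) := fun p => (hsupp p p.2).toSchwartzMap (hsm p)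
  have hf : ∀ p ξ, f p ξ = F (p, ξ) := fun p ξ => rfl
  -- derivatives in `ξ` are restrictions of derivatives of `F`
  have hder : ∀ (i : ℕ) p ξ, ‖iteratedFDeriv ℝ i (fun ξ => F (p, ξ)) ξ‖ ≤
      ‖iteratedFDeriv ℝ i F (p, ξ)‖ * ‖ContinuousLinearMap.inr ℝ E (Rn n)‖ ^ i := by
    intro i p ξ
    have h1 : (fun ξ => F (p, ξ)) =
        (fun q => F (q + (p, 0))) ∘ ContinuousLinearMap.inr ℝ E (Rn n) := by
      ext ξ; simp
    have h2 : ContDiff ℝ ∞ (fun q => F (q + (p, 0))) := hF.comp (by fun_prop)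
    rw [h1, ContinuousLinearMap.iteratedFDeriv_comp_right _ h2 _ (by exact_mod_cast le_top),
      iteratedFDeriv_comp_add_right]
    refine (ContinuousMultilinearMap.norm_compContinuousLinearMap_le _ _).trans ?_
    simp
  have hbdd : Bornology.IsVonNBounded ℂ (range f) := by
    rw [(schwartz_withSeminorms ℂ (Rn n) ℂ).isVonNBounded_iff_seminorm_bounded]
    rintro ⟨k, i⟩
    have hcont : Continuous fun q : E × Rn n => ‖q.2‖ ^ k *
        (‖iteratedFDeriv ℝ i F q‖ * ‖ContinuousLinearMap.inr ℝ E (Rn n)‖ ^ i) := by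
      have := hF.continuous_iteratedFDeriv (m := i) (by exact_mod_cast le_top)
      fun_prop
    obtain ⟨M, hM⟩ := (hP.prod (isCompact_closedBall (0 : Rn n) R)).exists_bound_of_continuousOn
      hcont.continuousOn
    refine ⟨max M 0 + 1, by positivity, ?_⟩
    rintro _ ⟨p, rfl⟩
    refine lt_of_le_of_lt (SchwartzMap.seminorm_le_bound ℂ k i (f p) (le_max_right M 0)
      fun ξ => ?_) (lt_add_one _)
    have hfp : (⇑(f p)) = fun ξ => F (p, ξ) := rfl
    rw [hfp]
    by_cases hξ : ‖ξ‖ ≤ R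
    · refine le_max_of_le_left ?_
      have h3 := hM ((p : E), ξ) ⟨p.2, by simpa using hξ⟩
      refine le_trans ?_ ((Real.le_norm_self _).trans h3)
      gcongr
      exact hder i p ξ
    · have h4 : iteratedFDeriv ℝ i (fun ξ => F (p, ξ)) ξ = 0 := by
        have h5 : (fun ξ => F ((p : E), ξ)) =ᶠ[𝓝 ξ] fun _ => 0 := by
          have : {η : Rn n | R < ‖η‖} ∈ 𝓝 ξ :=
            (isOpen_lt continuous_const continuous_norm).mem_nhds (not_le.mp hξ)
          filter_upwards [this] with η hη using hR p p.2 η hη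
        rw [Filter.EventuallyEq.eq_of_nhds (Filter.EventuallyEq.iteratedFDeriv ℝ h5 i),
          iteratedFDeriv_fun_zero]; rfl
      rw [h4, norm_zero, mul_zero]
      exact le_max_right _ _
  have hbdd' := hbdd.image (FourierTransform.fourierInvCLM ℂ 𝓢(Rn n, ℂ))
  rw [(schwartz_withSeminorms ℂ (Rn n) ℂ).isVonNBounded_iff_seminorm_bounded] at hbdd'
  -- the moments of a Schwartz function are controlled by its seminorms
  have hmom : ∀ k : ℕ, ∃ C, ∀ p : P, ∫ z, ‖z‖ ^ k * ‖(𝓕⁻ (f p) : 𝓢(Rn n, ℂ)) z‖ ≤ C := by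
    intro k
    set l := (volume : Measure (Rn n)).integrablePower
    obtain ⟨r1, -, h1⟩ := hbdd' (0, 0)
    obtain ⟨r2, -, h2⟩ := hbdd' (k + l, 0)
    refine ⟨(2 ^ l * ∫ x : Rn n, (1 + ‖x‖) ^ (-(l : ℝ))) * (r1 + r2), fun p => ?_⟩
    have h3 := SchwartzMap.integral_pow_mul_iteratedFDeriv_le ℂ (volume : Measure (Rn n))
      (𝓕⁻ (f p) : 𝓢(Rn n, ℂ)) k 0
    simp only [norm_iteratedFDeriv_zero] at h3
    refine h3.trans ?_
    have h4 : 0 ≤ ∫ x : Rn n, (1 + ‖x‖) ^ (-(l : ℝ)) := integral_nonneg fun x => by positivity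
    gcongr
    · exact (h1 _ ⟨f p, mem_range_self p, rfl⟩).le
    · exact (h2 _ ⟨f p, mem_range_self p, rfl⟩).le
  obtain ⟨C0, hC0⟩ := hmom 0
  obtain ⟨C1, hC1⟩ := hmom 1
  refine ⟨max C0 C1, fun p hp => ?_⟩
  have h0 : (𝓕⁻ (f ⟨p, hp⟩) : 𝓢(Rn n, ℂ)) = 𝓕⁻ fun ξ => F (p, ξ) := SchwartzMap.fourierInv_coe _
  refine ⟨(hsm p).continuous, (f ⟨p, hp⟩).integrable, ?_, ?_, ?_, ?_⟩
  · rw [← h0]; exact SchwartzMap.integrable _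
  · have := SchwartzMap.integrable_pow_mul volume (𝓕⁻ (f ⟨p, hp⟩) : 𝓢(Rn n, ℂ)) 1
    simpa [h0] using this
  · have := hC0 ⟨p, hp⟩
    rw [h0] at this
    simp only [pow_zero, one_mul] at this
    exact this.trans (le_max_left _ _)
  · have := hC1 ⟨p, hp⟩
    rw [h0] at this
    simp only [pow_one] at this
    exact this.trans (le_max_right _ _)

end

noncomputable section

/-! ### Dyadic symbols -/

variable {n m : ℕ}

namespace LPCutoff

variable (χ : LPCutoff n)

theorem exists_bound : ∃ B : ℝ, 1 ≤ B ∧ ∀ ξ, |χ.toFun ξ| ≤ B := by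
  have hc : HasCompactSupport χ.toFun :=
    HasCompactSupport.intro (isCompact_closedBall (0 : Rn n) 2) fun ξ hξ =>
      χ.eq_zero ξ (by simpa using (not_le.mp (by simpa using hξ)).le)
  obtain ⟨B, hB⟩ := hc.exists_bound_of_continuous χ.smooth.continuous
  exact ⟨max B 1, le_max_right _ _, fun ξ => (hB ξ).trans (le_max_left _ _)⟩

/-- A bound for the cutoff function. -/
def bound : ℝ := χ.exists_bound.choose

theorem one_le_bound : 1 ≤ χ.bound := χ.exists_bound.choose_spec.1

theorem abs_le_bound (ξ : Rn n) : |χ.toFun ξ| ≤ χ.bound := χ.exists_bound.choose_spec.2 ξ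

theorem bound_pos : 0 < χ.bound := one_pos.trans_le χ.one_le_bound

/-- A smooth cutoff to the annulus `1/c ≤ ‖η‖ ≤ c`, supported in `1/(2c) ≤ ‖η‖ ≤ 2c`. -/
def annulus (c : ℝ) (η : Rn n) : ℝ := χ.toFun (c⁻¹ • η) - χ.toFun ((2 * c) • η)

theorem contDiff_annulus (c : ℝ) : ContDiff ℝ ∞ (χ.annulus c) := by
  have := χ.smooth
  unfold annulus
  exact (this.comp (by fun_prop)).sub (this.comp (by fun_prop))

theorem abs_annulus_le (c : ℝ) (η : Rn n) : |χ.annulus c η| ≤ 2 * χ.bound :=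
  (abs_sub _ _).trans (by linarith [χ.abs_le_bound (c⁻¹ • η), χ.abs_le_bound ((2 * c) • η)])

variable {c : ℝ}

theorem annulus_eq_one (hc : 1 ≤ c) {η : Rn n} (h1 : 1 ≤ c * ‖η‖) (h2 : ‖η‖ ≤ c) :
    χ.annulus c η = 1 := by
  have hc0 : 0 < c := by linarith
  rw [annulus, χ.eq_one, χ.eq_zero, sub_zero]
  · rw [norm_smul, Real.norm_of_nonneg (by positivity)]; linarith
  · rw [norm_smul, Real.norm_of_nonneg (by positivity), inv_mul_le_iff₀ hc0]; linarith

theorem annulus_eq_zero_of_small (hc : 1 ≤ c) {η : Rn n} (h : 2 * c * ‖η‖ ≤ 1) :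
    χ.annulus c η = 0 := by
  have hc0 : 0 < c := by linarith
  rw [annulus, χ.eq_one, χ.eq_one, sub_self]
  · rwa [norm_smul, Real.norm_of_nonneg (by positivity)]
  · rw [norm_smul, Real.norm_of_nonneg (by positivity), inv_mul_le_iff₀ hc0]
    nlinarith [norm_nonneg η]

theorem annulus_eq_zero_of_large (hc : 1 ≤ c) {η : Rn n} (h : 2 * c ≤ ‖η‖) :
    χ.annulus c η = 0 := by
  have hc0 : 0 < c := by linarith
  rw [annulus, χ.eq_zero, χ.eq_zero, sub_self]
  · rw [norm_smul, Real.norm_of_nonneg (by positivity)]; nlinarith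
  · rw [norm_smul, Real.norm_of_nonneg (by positivity), le_inv_mul_iff₀ hc0]
    linarith

theorem mem_of_annulus_ne_zero (hc : 1 ≤ c) {η : Rn n} (h : χ.annulus c η ≠ 0) :
    1 < 2 * c * ‖η‖ ∧ ‖η‖ < 2 * c :=
  ⟨lt_of_not_ge fun h' => h (χ.annulus_eq_zero_of_small hc h'),
    lt_of_not_ge fun h' => h (χ.annulus_eq_zero_of_large hc h')⟩

theorem annulus_mul_annulus (hc : 1 ≤ c) {c' : ℝ} (hc' : 2 * c ≤ c') (η : Rn n) :
    χ.annulus c η * χ.annulus c' η = χ.annulus c η := by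
  by_cases h : χ.annulus c η = 0
  · rw [h, zero_mul]
  · obtain ⟨h1, h2⟩ := χ.mem_of_annulus_ne_zero hc h
    rw [χ.annulus_eq_one (c := c') (by linarith) (by nlinarith [norm_nonneg η]) (by linarith),
      mul_one]

/-- The symbol of a smooth cutoff to the annulus `2 ^ k / c ≤ ‖ξ‖ ≤ 2 ^ k c`. -/
def annSymbol (c : ℝ) (k : ℤ) (ξ : Rn n) : ℂ := (χ.annulus c ((2 : ℝ) ^ (-k) • ξ) : ℂ)

theorem blockSymbol_eq_annSymbol (k : ℤ) : χ.blockSymbol k = χ.annSymbol 1 k := by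
  ext ξ
  rw [blockSymbol, lowSymbol, lowSymbol, annSymbol, annulus, smul_smul]
  push_cast
  congr 3
  · simp
  · rw [sub_eq_add_neg, zpow_add₀ two_ne_zero]; simp [mul_smul]

theorem continuous_annSymbol (c : ℝ) (k : ℤ) : Continuous (χ.annSymbol c k) :=
  Complex.continuous_ofReal.comp ((χ.contDiff_annulus c).continuous.comp (by fun_prop))

theorem norm_annSymbol_le (c : ℝ) (k : ℤ) (ξ : Rn n) : ‖χ.annSymbol c k ξ‖ ≤ 2 * χ.bound := by
  rw [annSymbol, Complex.norm_real]; exact χ.abs_annulus_le _ _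

theorem memLp_annSymbol (c : ℝ) (k : ℤ) : MemLp (χ.annSymbol c k) ∞ volume :=
  memLp_top_of_bound (χ.continuous_annSymbol c k).aestronglyMeasurable _
    (Eventually.of_forall (χ.norm_annSymbol_le c k))

theorem annSymbol_mul (hc : 1 ≤ c) {c' : ℝ} (hc' : 2 * c ≤ c') (k : ℤ) :
    χ.annSymbol c k * χ.annSymbol c' k = χ.annSymbol c k := by
  ext ξ
  rw [Pi.mul_apply, annSymbol, annSymbol, ← Complex.ofReal_mul, χ.annulus_mul_annulus hc hc']

theorem star_annSymbol (c : ℝ) (k : ℤ) : star (χ.annSymbol c k) = χ.annSymbol c k := by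
  ext ξ
  rw [Pi.star_apply, annSymbol, RCLike.star_def, Complex.conj_ofReal]

theorem mem_of_annSymbol_ne_zero (hc : 1 ≤ c) {k : ℤ} {ξ : Rn n} (h : χ.annSymbol c k ξ ≠ 0) :
    (2 : ℝ) ^ k < 2 * c * ‖ξ‖ ∧ ‖ξ‖ < 2 * c * 2 ^ k := by
  have h1 := χ.mem_of_annulus_ne_zero hc (η := (2 : ℝ) ^ (-k) • ξ)
    fun h' => h (by rw [annSymbol, h', Complex.ofReal_zero])
  have h2 : (0 : ℝ) < 2 ^ k := by positivity
  rw [norm_smul, Real.norm_of_nonneg (by positivity), zpow_neg] at h1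
  constructor
  · have := h1.1
    rw [mul_left_comm, ← div_eq_inv_mul, lt_div_iff₀ h2] at this
    linarith
  · have := h1.2
    rwa [inv_mul_lt_iff₀ h2, mul_comm] at this

/-- The dyadic annuli have bounded overlap. -/
theorem sum_annSymbol_sq_le (F : Finset ℤ) (ξ : Rn n) :
    ∑ k ∈ F, ‖χ.annSymbol 16 k ξ‖ ^ 2 ≤ 21 * (2 * χ.bound) ^ 2 := by
  classical
  rw [← Finset.sum_filter_add_sum_filter_not F (fun k => χ.annSymbol 16 k ξ ≠ 0)]
  have h0 : ∑ k ∈ F with ¬ (χ.annSymbol 16 k ξ ≠ 0), ‖χ.annSymbol 16 k ξ‖ ^ 2 = 0 := by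
    refine Finset.sum_eq_zero fun k hk => ?_
    rw [Finset.mem_filter, not_not] at hk
    rw [hk.2]; simp
  rw [h0, add_zero]
  rcases (F.filter (fun k => χ.annSymbol 16 k ξ ≠ 0)).eq_empty_or_nonempty with he | ⟨l, hl⟩
  · rw [he, Finset.sum_empty]; positivity
  have hcard : (F.filter (fun k => χ.annSymbol 16 k ξ ≠ 0)).card ≤ 21 := by
    refine (Finset.card_le_card (t := Finset.Icc (l - 10) (l + 10)) fun k hk => ?_).trans ?_
    · have h1 := χ.mem_of_annSymbol_ne_zero (by norm_num) (Finset.mem_filter.mp hk).2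
      have h2 := χ.mem_of_annSymbol_ne_zero (by norm_num) (Finset.mem_filter.mp hl).2
      have h3 : (2 : ℝ) ^ k < 2 ^ (l + 10) := by
        rw [zpow_add₀ two_ne_zero]; norm_num at h1 h2 ⊢; linarith
      have h4 : (2 : ℝ) ^ l < 2 ^ (k + 10) := by
        rw [zpow_add₀ two_ne_zero]; norm_num at h1 h2 ⊢; linarith
      rw [zpow_lt_zpow_iff_right₀ one_lt_two] at h3 h4
      rw [Finset.mem_Icc]; omega
    · rw [Int.card_Icc]; omega
  calc _ ≤ ∑ k ∈ F with χ.annSymbol 16 k ξ ≠ 0, (2 * χ.bound) ^ 2 := by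
        refine Finset.sum_le_sum fun k _ => ?_
        gcongr; exact χ.norm_annSymbol_le _ _ _
    _ ≤ _ := by
        rw [Finset.sum_const, nsmul_eq_mul]
        gcongr
        exact_mod_cast hcard

end LPCutoff

/-! ### Sobolev weights -/

/-- The symbol `(1 + ‖ξ‖²)^(τ/2)` of the Bessel potential of order `τ`. -/
def weight (τ : ℝ) (ξ : Rn n) : ℂ := (((1 + ‖ξ‖ ^ 2) ^ (τ / 2) : ℝ) : ℂ)

theorem continuous_weight (τ : ℝ) : Continuous (weight τ : Rn n → ℂ) := by
  refine Complex.continuous_ofReal.comp (Continuous.rpow_const (by fun_prop) fun ξ => Or.inl ?_)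
  positivity

theorem weight_mul (τ τ' : ℝ) : (weight τ * weight τ' : Rn n → ℂ) = weight (τ + τ') := by
  ext ξ
  rw [Pi.mul_apply, weight, weight, weight, ← Complex.ofReal_mul,
    ← Real.rpow_add (by positivity), add_div]

theorem weight_zero : (weight 0 : Rn n → ℂ) = 1 := by
  ext ξ; simp [weight]

theorem star_weight (τ : ℝ) : star (weight τ : Rn n → ℂ) = weight τ := by
  ext ξ
  rw [Pi.star_apply, weight, RCLike.star_def, Complex.conj_ofReal]

theorem norm_weight (τ : ℝ) (ξ : Rn n) : ‖weight τ ξ‖ = (1 + ‖ξ‖ ^ 2) ^ (τ / 2) := by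
  rw [weight, Complex.norm_real, Real.norm_of_nonneg (by positivity)]

/-- The size of the weight `1 + ‖ξ‖²` at the frequency `2 ^ k`. -/
def dyadicWeight (k : ℤ) : ℝ := 1 + ((2 : ℝ) ^ k) ^ 2

theorem dyadicWeight_pos (k : ℤ) : 0 < dyadicWeight k := by unfold dyadicWeight; positivity

/-- Powers of comparable quantities are comparable. On the support of the symbols `annSymbol c k`
with `c ≤ 8`, where `2 ^ k` and `‖ξ‖` agree up to a factor `16`, the squares in the weights agree up
to the factor `256`. -/
theorem rpow_le_of_comparable {a b : ℝ} (hb : 0 < b) (h1 : b ≤ 256 * a) (h2 : a ≤ 256 * b)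
    (τ : ℝ) : a ^ τ ≤ 256 ^ |τ| * b ^ τ := by
  have ha : 0 < a := by linarith
  rcases le_total 0 τ with h | h
  · rw [abs_of_nonneg h, ← Real.mul_rpow (by norm_num) hb.le]
    exact Real.rpow_le_rpow ha.le h2 h
  · have h3 : (256 : ℝ) ^ (-τ) = (256⁻¹ : ℝ) ^ τ := by
      rw [Real.inv_rpow (by norm_num), Real.rpow_neg (by norm_num)]
    rw [abs_of_nonpos h, h3, ← Real.mul_rpow (by norm_num) hb.le]
    refine Real.rpow_le_rpow_of_nonpos (by positivity) ?_ h
    linarith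

theorem norm_weight_le_of_annSymbol_ne_zero (χ : LPCutoff n) {c : ℝ} (hc : 1 ≤ c) (hc8 : c ≤ 8)
    {k : ℤ} {ξ : Rn n} (h : χ.annSymbol c k ξ ≠ 0) (τ : ℝ) :
    ‖weight τ ξ‖ ≤ 256 ^ |τ / 2| * dyadicWeight k ^ (τ / 2) := by
  obtain ⟨h1, h2⟩ := χ.mem_of_annSymbol_ne_zero hc h
  rw [norm_weight]
  have h3 : (0 : ℝ) < 2 ^ k := by positivity
  have h4 : (2 : ℝ) ^ k < 16 * ‖ξ‖ := by nlinarith [norm_nonneg ξ]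
  have h5 : ‖ξ‖ < 16 * 2 ^ k := by nlinarith
  refine rpow_le_of_comparable (dyadicWeight_pos k) ?_ ?_ _ <;> unfold dyadicWeight
  · nlinarith [norm_nonneg ξ]
  · nlinarith [norm_nonneg ξ]

theorem norm_annSymbol_mul_weight_le (χ : LPCutoff n) {c : ℝ} (hc : 1 ≤ c) (hc8 : c ≤ 8) (k : ℤ)
    (τ : ℝ) (ξ : Rn n) : ‖χ.annSymbol c k ξ * weight τ ξ‖ ≤
      2 * χ.bound * (256 ^ |τ / 2| * dyadicWeight k ^ (τ / 2)) := by
  have hb := χ.bound_pos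
  have hw := dyadicWeight_pos k
  by_cases h : χ.annSymbol c k ξ = 0
  · rw [h, zero_mul, norm_zero]; positivity
  · rw [norm_mul]
    gcongr
    · exact χ.norm_annSymbol_le c k ξ
    · exact norm_weight_le_of_annSymbol_ne_zero χ hc hc8 h τ

theorem memLp_annSymbol_mul_weight (χ : LPCutoff n) {c : ℝ} (hc : 1 ≤ c) (hc8 : c ≤ 8) (k : ℤ)
    (τ : ℝ) : MemLp (χ.annSymbol c k * weight τ) ∞ volume :=
  memLp_top_of_bound ((χ.continuous_annSymbol c k).mul (continuous_weight τ)).aestronglyMeasurable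
    _ (Eventually.of_forall (norm_annSymbol_mul_weight_le χ hc hc8 k τ))

namespace LPCutoff

variable (χ : LPCutoff n)

/-- The symbol `χ(ξ / 2 ^ K)` of the frequency truncation at scale `2 ^ K`. -/
def truncSymbol (K : ℕ) (ξ : Rn n) : ℂ := (χ.toFun ((2 : ℝ) ^ (-(K : ℤ)) • ξ) : ℂ)

theorem continuous_truncSymbol (K : ℕ) : Continuous (χ.truncSymbol K) :=
  Complex.continuous_ofReal.comp (χ.smooth.continuous.comp (by fun_prop))

theorem norm_truncSymbol_le (K : ℕ) (ξ : Rn n) : ‖χ.truncSymbol K ξ‖ ≤ χ.bound := by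
  rw [truncSymbol, Complex.norm_real]; exact χ.abs_le_bound _

theorem memLp_truncSymbol (K : ℕ) : MemLp (χ.truncSymbol K) ∞ volume :=
  memLp_top_of_bound (χ.continuous_truncSymbol K).aestronglyMeasurable _
    (Eventually.of_forall (χ.norm_truncSymbol_le K))

theorem star_truncSymbol (K : ℕ) : star (χ.truncSymbol K) = χ.truncSymbol K := by
  ext ξ
  rw [Pi.star_apply, truncSymbol, RCLike.star_def, Complex.conj_ofReal]

theorem truncSymbol_eq_zero {K : ℕ} {ξ : Rn n} (h : (2 : ℝ) ^ (K + 1) ≤ ‖ξ‖) :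
    χ.truncSymbol K ξ = 0 := by
  rw [truncSymbol, χ.eq_zero, Complex.ofReal_zero]
  rw [norm_smul, Real.norm_of_nonneg (by positivity), zpow_neg, zpow_natCast,
    le_inv_mul_iff₀ (by positivity)]
  rwa [pow_succ] at h

theorem truncSymbol_eq_one {K : ℕ} {ξ : Rn n} (h : ‖ξ‖ ≤ (2 : ℝ) ^ K) :
    χ.truncSymbol K ξ = 1 := by
  rw [truncSymbol, χ.eq_one, Complex.ofReal_one]
  rw [norm_smul, Real.norm_of_nonneg (by positivity), zpow_neg, zpow_natCast,
    inv_mul_le_iff₀ (by positivity)]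
  linarith

theorem truncSymbol_mul_succ (K : ℕ) :
    χ.truncSymbol K * χ.truncSymbol (K + 1) = χ.truncSymbol K := by
  ext ξ
  rw [Pi.mul_apply]
  rcases le_total ‖ξ‖ ((2 : ℝ) ^ (K + 1)) with h | h
  · rw [χ.truncSymbol_eq_one h, mul_one]
  · rw [χ.truncSymbol_eq_zero h, zero_mul]

theorem smul_toFun_contDiff : ContDiff ℝ ∞ fun q : (ℝ × ℝ) × Rn n => χ.toFun (q.1.1 • q.2) :=
  χ.smooth.comp (by fun_prop)

/-- The symbols `χ(ξ / 2 ^ K)² (1 + ‖ξ‖²)^σ` localized at the frequency `2 ^ k` have kernels with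
dyadic size, uniformly in the truncation parameter `K`. Rescaled to unit frequency, they form a
family which depends smoothly on the parameters `2 ^ (k - K)` and `arctan (2 ^ k)`, both of which
may be restricted to compact intervals. -/
theorem exists_symbolBound_energy (σ : ℝ) : ∃ C, ∀ (K : ℕ) (k : ℤ),
    SymbolBound (fun ξ => χ.truncSymbol K ξ ^ 2 * (χ.annSymbol 4 k ξ * weight (2 * σ) ξ))
      (C * dyadicWeight k ^ σ) (C * dyadicWeight k ^ σ * 2 ^ (-k)) := by
  -- on the annulus, `q` is the rescaled weight `cos² θ (1 + tan² θ ‖η‖²)` with `tan θ = 2 ^ k`;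
  -- the last term keeps it positive at `η = 0`, `θ = π / 2`, so that its powers are smooth
  set q : (ℝ × ℝ) × Rn n → ℝ := fun q => Real.cos q.1.2 ^ 2 + Real.sin q.1.2 ^ 2 *
    (‖q.2‖ ^ 2 + (1 - χ.annulus 8 q.2) ^ 2) with hq
  have hqpos : ∀ p, 0 < q p := by
    rintro ⟨⟨s, θ⟩, η⟩
    have h1 := Real.sin_sq_add_cos_sq θ
    have h2 : 0 < ‖η‖ ^ 2 + (1 - χ.annulus 8 η) ^ 2 := by
      rcases eq_or_ne η 0 with rfl | h
      · rw [χ.annulus_eq_zero_of_small (by norm_num) (by simp)]; norm_num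
      · have : 0 < ‖η‖ := norm_pos_iff.mpr h
        positivity
    simp only [hq]
    rcases eq_or_ne (Real.cos θ) 0 with h | h
    · rw [h] at h1 ⊢
      have : Real.sin θ ^ 2 = 1 := by linarith
      rw [this]; linarith
    · have : 0 < Real.cos θ ^ 2 := by positivity
      positivity
  have hqs : ContDiff ℝ ∞ q := by
    have h1 : ContDiff ℝ ∞ fun q : (ℝ × ℝ) × Rn n => χ.annulus 8 q.2 :=
      (χ.contDiff_annulus 8).comp contDiff_snd
    have h2 : ContDiff ℝ ∞ fun q : (ℝ × ℝ) × Rn n => ‖q.2‖ ^ 2 :=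
      (contDiff_norm_sq ℝ).comp contDiff_snd
    have h3 : ContDiff ℝ ∞ fun q : (ℝ × ℝ) × Rn n => Real.cos q.1.2 :=
      Real.contDiff_cos.comp (by fun_prop)
    have h4 : ContDiff ℝ ∞ fun q : (ℝ × ℝ) × Rn n => Real.sin q.1.2 :=
      Real.contDiff_sin.comp (by fun_prop)
    exact (h3.pow 2).add ((h4.pow 2).mul (h2.add ((contDiff_const.sub h1).pow 2)))
  set F : (ℝ × ℝ) × Rn n → ℂ := fun p =>
    ((χ.toFun (p.1.1 • p.2) ^ 2 * (χ.annulus 4 p.2 * q p ^ σ) : ℝ) : ℂ) with hF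
  have hFs : ContDiff ℝ ∞ F := by
    have h1 : ContDiff ℝ ∞ fun q : (ℝ × ℝ) × Rn n => χ.annulus 4 q.2 :=
      (χ.contDiff_annulus 4).comp contDiff_snd
    exact Complex.ofRealCLM.contDiff.comp ((χ.smul_toFun_contDiff.pow 2).mul
      (h1.mul (hqs.rpow_const_of_ne fun p => (hqpos p).ne')))
  obtain ⟨C, hC⟩ := exists_symbolBound_of_contDiff hFs
    (P := Icc 0 16 ×ˢ Icc 0 (Real.pi / 2)) (isCompact_Icc.prod isCompact_Icc) (R := 8)
    (fun p _ ξ hξ => by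
      simp only [hF]
      rw [χ.annulus_eq_zero_of_large (by norm_num) (by linarith)]; simp)
  have hC0 : 0 ≤ C := (hC (0, 0) ⟨⟨le_rfl, by norm_num⟩, ⟨le_rfl, by positivity⟩⟩).bound_nonneg
  refine ⟨C, fun K k => ?_⟩
  have hw := dyadicWeight_pos k
  have h2k : (0 : ℝ) < 2 ^ k := by positivity
  by_cases hs : (2 : ℝ) ^ (k - K) ≤ 16
  · have h1 := ((hC ((2 : ℝ) ^ (k - K), Real.arctan (2 ^ k)) ⟨⟨by positivity, hs⟩,
      ⟨Real.arctan_nonneg.mpr h2k.le, (Real.arctan_lt_pi_div_two _).le⟩⟩).comp_smul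
        (r := (2 : ℝ) ^ (-k)) (by positivity)).const_mul ((dyadicWeight k ^ σ : ℝ) : ℂ)
    rw [Complex.norm_real, Real.norm_of_nonneg (by positivity)] at h1
    have h2 : (fun ξ => χ.truncSymbol K ξ ^ 2 * (χ.annSymbol 4 k ξ * weight (2 * σ) ξ)) =
        fun ξ => ((dyadicWeight k ^ σ : ℝ) : ℂ) *
          F (((2 : ℝ) ^ (k - K), Real.arctan (2 ^ k)), (2 : ℝ) ^ (-k) • ξ) := by
      ext ξ
      simp only [hF, truncSymbol, annSymbol, weight]
      norm_cast
      have h3 : (2 : ℝ) ^ (k - K) • (2 : ℝ) ^ (-k) • ξ = (2 : ℝ) ^ (-(K : ℤ)) • ξ := by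
        rw [smul_smul, ← zpow_add₀ two_ne_zero]; congr 2; ring
      rw [h3]
      by_cases h4 : χ.annulus 4 ((2 : ℝ) ^ (-k) • ξ) = 0
      · rw [h4]; ring
      obtain ⟨h5, h6⟩ := χ.mem_of_annulus_ne_zero (by norm_num) h4
      have h7 : q (((2 : ℝ) ^ (k - K), Real.arctan (2 ^ k)), (2 : ℝ) ^ (-k) • ξ) =
          (dyadicWeight k)⁻¹ * (1 + ‖ξ‖ ^ 2) := by
        simp only [hq]
        rw [χ.annulus_eq_one (c := 8) (by norm_num) (by linarith) (by linarith), Real.cos_sq_arctan,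
          Real.sin_sq, Real.cos_sq_arctan, norm_smul, Real.norm_of_nonneg (by positivity), zpow_neg,
          dyadicWeight]
        field_simp
        ring
      rw [h7, Real.mul_rpow (by positivity) (by positivity), Real.inv_rpow (by positivity)]
      have h8 : dyadicWeight k ^ σ ≠ 0 := by positivity
      rw [mul_div_cancel_left₀ σ two_ne_zero]
      field_simp
    rw [h2]
    refine h1.mono (by linarith) (le_of_eq (by ring))
  · -- the frequency `2 ^ k` is so large that the truncation vanishes on the annulus
    have h2 : (fun ξ => χ.truncSymbol K ξ ^ 2 * (χ.annSymbol 4 k ξ * weight (2 * σ) ξ)) =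
        fun _ => 0 := by
      ext ξ
      by_cases h4 : χ.annSymbol 4 k ξ = 0
      · rw [h4]; ring
      have h5 := (χ.mem_of_annSymbol_ne_zero (by norm_num) h4).1
      rw [χ.truncSymbol_eq_zero]
      · ring
      · rw [not_le, zpow_sub₀ two_ne_zero, lt_div_iff₀ (by positivity), zpow_natCast] at hs
        rw [pow_succ]; linarith
    have h3 : (𝓕⁻ fun _ : Rn n => (0 : ℂ)) = fun _ => 0 := by
      ext z; rw [Real.fourierInv_eq]; simp
    rw [h2]
    refine ⟨continuous_const, integrable_zero _ _ _, ?_, ?_, ?_, ?_⟩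
    · rw [h3]; exact integrable_zero _ _ _
    · rw [h3]; simp
    · rw [h3]; simp; positivity
    · rw [h3]; simp; positivity

/-- The symbol `2πi ξ_j` of the partial derivative `∂_j`. -/
def _root_.derivSymbol (j : Fin n) (ξ : Rn n) : ℂ := 2 * Real.pi * Complex.I * (ξ j : ℂ)

theorem _root_.continuous_derivSymbol (j : Fin n) : Continuous (derivSymbol j) := by
  unfold derivSymbol; fun_prop

theorem _root_.norm_derivSymbol (j : Fin n) (ξ : Rn n) :
    ‖derivSymbol j ξ‖ = 2 * Real.pi * |ξ j| := by
  rw [derivSymbol, norm_mul, norm_mul, norm_mul, Complex.norm_I, Complex.norm_real,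
    Complex.norm_real, Real.norm_of_nonneg Real.pi_pos.le]
  simp

theorem _root_.norm_derivSymbol_le (j : Fin n) (ξ : Rn n) :
    ‖derivSymbol j ξ‖ ≤ 2 * Real.pi * ‖weight 1 ξ‖ := by
  rw [norm_derivSymbol, norm_weight, ← Real.sqrt_eq_rpow]
  gcongr
  refine (show |ξ j| ≤ ‖ξ‖ from PiLp.norm_apply_le ξ j).trans ?_
  exact Real.le_sqrt_of_sq_le (by linarith)

/-- The kernel of `P_k ∂_j` has dyadic size. -/
theorem exists_symbolBound_block_deriv (j : Fin n) : ∃ C, ∀ k : ℤ,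
    SymbolBound (fun ξ => χ.blockSymbol k ξ * derivSymbol j ξ) (C * 2 ^ k) C := by
  have h1 : ContDiff ℝ ∞ fun q : ℝ × Rn n => (χ.annulus 1 q.2 : ℂ) * derivSymbol j q.2 := by
    have h2 : ContDiff ℝ ∞ fun q : ℝ × Rn n => (χ.annulus 1 q.2 : ℂ) :=
      Complex.ofRealCLM.contDiff.comp ((χ.contDiff_annulus 1).comp contDiff_snd)
    have h3 : ContDiff ℝ ∞ fun q : ℝ × Rn n => (q.2 j : ℂ) :=
      Complex.ofRealCLM.contDiff.comp
        ((EuclideanSpace.proj j : Rn n →L[ℝ] ℝ).contDiff.comp contDiff_snd)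
    exact h2.mul (contDiff_const.mul h3)
  obtain ⟨C, hC⟩ := exists_symbolBound_of_contDiff h1 (P := {0}) isCompact_singleton (R := 2)
    (fun p _ ξ hξ => by
      simp only
      rw [χ.annulus_eq_zero_of_large le_rfl (by linarith)]; simp)
  refine ⟨C, fun k => ?_⟩
  have h2 := ((hC 0 rfl).comp_smul (r := (2 : ℝ) ^ (-k)) (by positivity)).const_mul
    ((2 : ℝ) ^ k : ℂ)
  have h3 : (fun ξ => χ.blockSymbol k ξ * derivSymbol j ξ) = fun ξ => ((2 : ℝ) ^ k : ℂ) *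
      ((χ.annulus 1 ((2 : ℝ) ^ (-k) • ξ) : ℂ) * derivSymbol j ((2 : ℝ) ^ (-k) • ξ)) := by
    ext ξ
    rw [blockSymbol_eq_annSymbol, annSymbol, derivSymbol, derivSymbol, PiLp.smul_apply, smul_eq_mul,
      zpow_neg]
    push_cast
    have : (2 : ℂ) ^ k ≠ 0 := zpow_ne_zero k two_ne_zero
    field_simp
  have h4 : ‖((2 : ℝ) ^ k : ℂ)‖ = 2 ^ k := by
    rw [← Complex.ofReal_zpow, Complex.norm_real, Real.norm_of_nonneg (by positivity)]
  rw [h3]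
  rw [h4] at h2
  refine h2.mono (le_of_eq (mul_comm _ _)) (le_of_eq ?_)
  rw [← mul_assoc, ← zpow_add₀ two_ne_zero, add_neg_cancel, zpow_zero, one_mul]

/-- The kernels of `P_{<j}` are bounded in `L¹` uniformly in `j`; their first moments are finite,
but not uniformly bounded. -/
theorem exists_symbolBound_low : ∃ C, ∀ j : ℤ, ∃ D, SymbolBound (χ.lowSymbol j) C D := by
  have h1 : ContDiff ℝ ∞ fun q : ℝ × Rn n => (χ.toFun q.2 : ℂ) :=
    Complex.ofRealCLM.contDiff.comp (χ.smooth.comp contDiff_snd)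
  obtain ⟨C, hC⟩ := exists_symbolBound_of_contDiff h1 (P := {0}) isCompact_singleton (R := 2)
    (fun p _ ξ hξ => by
      simp only
      rw [χ.eq_zero _ hξ.le]; simp)
  exact ⟨C, fun j => ⟨_, (hC 0 rfl).comp_smul (r := (2 : ℝ) ^ (1 - j)) (by positivity)⟩⟩

theorem lowSymbol_eq_zero {j : ℤ} {ξ : Rn n} (h : (2 : ℝ) ^ j ≤ ‖ξ‖) : χ.lowSymbol j ξ = 0 := by
  rw [lowSymbol, χ.eq_zero, Complex.ofReal_zero]
  rw [norm_smul, Real.norm_of_nonneg (by positivity), zpow_sub₀ two_ne_zero, zpow_one,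
    div_mul_eq_mul_div, le_div_iff₀ (by positivity)]
  linarith

end LPCutoff

end

noncomputable section

/-! ### Operators on `L²` and on tempered distributions -/

variable {n m : ℕ}

/-- The embedding of `L²` into the tempered distributions. -/
abbrev distr (n m : ℕ) : L2 n m →L[ℂ] 𝓢'(Rn n, CVec m) :=
  Lp.toTemperedDistributionCLM (CVec m) (volume : Measure (Rn n)) 2

theorem distr_injective : Function.Injective (distr n m) :=
  LinearMap.ker_eq_bot.mp Lp.ker_toTemperedDistributionCLM_eq_bot

theorem distr_apply (h : L2 n m) (φ : 𝓢(Rn n, ℂ)) : distr n m h φ = ∫ x, φ x • h x := by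
  rw [Lp.toTemperedDistributionCLM_apply, Lp.toTemperedDistribution_apply]

theorem fourier_distr (h : L2 n m) : 𝓕 (distr n m h) = distr n m (𝓕 h) :=
  Lp.fourier_toTemperedDistribution_eq h

theorem smulLeftCLM_distr {a : Rn n → ℂ} (ha : a.HasTemperateGrowth) (ha' : MemLp a ∞ volume)
    (h : L2 n m) :
    smulLeftCLM (CVec m) a (distr n m h) = distr n m (mulOp (scalarMat m a) h) := by
  have h1 := Lp.toTemperedDistribution_smul_eq (p := ∞) (q := 2) (r := 2) ha ha' h
  simp only [Lp.toTemperedDistributionCLM_apply]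
  rw [← h1]
  congr 1
  apply Lp.ext
  filter_upwards [Lp.coeFn_lpSMul (r := 2) (ha'.toLp a) h, ha'.coeFn_toLp,
    mulOp_coeFn (memLp_scalarMat ha') h] with x h2 h3 h4
  rw [h2, h4, Pi.smul_apply', h3, scalarMat_apply]

theorem fourierMultiplierCLM_distr {φ : Rn n → ℂ} (hφ : φ.HasTemperateGrowth)
    (hφ' : MemLp φ ∞ volume) (h : L2 n m) :
    fourierMultiplierCLM (CVec m) φ (distr n m h) = distr n m (FM m φ h) := by
  have h1 : 𝓕 (distr n m (FM m φ h)) = smulLeftCLM (CVec m) φ (𝓕 (distr n m h)) := by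
    rw [fourier_distr, fourier_FM, fourier_distr, smulLeftCLM_distr hφ hφ']
  rw [fourierMultiplierCLM_apply, ← h1, FourierTransform.fourierInv_fourier_eq]

/-- Multiplication by a constant matrix on `L²`. -/
def constOp (n : ℕ) (E : CVec m →L[ℂ] CVec m) : L2 n m →L[ℂ] L2 n m := mulOp fun _ => E

theorem constOp_coeFn (E : CVec m →L[ℂ] CVec m) (h : L2 n m) :
    constOp n E h =ᵐ[volume] fun x => E (h x) :=
  mulOp_coeFn (memLp_top_const E) h

theorem postcomp_distr (E : CVec m →L[ℂ] CVec m) (h : L2 n m) :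
    PointwiseConvergenceCLM.postcomp (𝓢(Rn n, ℂ)) E (distr n m h) =
      distr n m (constOp n E h) := by
  ext1 φ
  change E (distr n m h φ) = _
  rw [distr_apply, distr_apply, ← ContinuousLinearMap.integral_comp_comm]
  · refine integral_congr_ae ?_
    filter_upwards [constOp_coeFn E h] with x hx
    rw [hx, map_smul]
  · have h1 := (φ.memLp 2 (volume : Measure (Rn n)))
    exact memLp_one_iff_integrable.mp ((Lp.memLp h).smul (r := 1) h1)

theorem fourier_constOp (E : CVec m →L[ℂ] CVec m) (h : L2 n m) :
    𝓕 (constOp n E h) = constOp n E (𝓕 h) := by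
  apply distr_injective
  rw [← fourier_distr, ← postcomp_distr, ← postcomp_distr, ← fourier_distr]
  rfl

theorem FM_constOp {φ : Rn n → ℂ} (hφ : MemLp φ ∞ volume) (E : CVec m →L[ℂ] CVec m) (h : L2 n m) :
    FM m φ (constOp n E h) = constOp n E (FM m φ h) := by
  apply fourier_injective
  rw [fourier_FM, fourier_constOp, fourier_constOp, fourier_FM]
  apply Lp.ext
  filter_upwards [mulOp_coeFn (memLp_scalarMat hφ) (constOp n E (𝓕 h)),
    constOp_coeFn E (mulOp (scalarMat m φ) (𝓕 h)), mulOp_coeFn (memLp_scalarMat hφ) (𝓕 h),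
    constOp_coeFn E (𝓕 h)] with x h1 h2 h3 h4
  rw [h1, h2, h3, h4, scalarMat_apply, scalarMat_apply, map_smul]

theorem constOp_mulOp_scalarMat {a : Rn n → ℂ} (ha : MemLp a ∞ volume)
    (E : CVec m →L[ℂ] CVec m) (h : L2 n m) :
    constOp n E (mulOp (scalarMat m a) h) =ᵐ[volume] fun x => a x • E (h x) := by
  filter_upwards [constOp_coeFn E (mulOp (scalarMat m a) h), mulOp_coeFn (memLp_scalarMat ha) h]
    with x h1 h2
  rw [h1, h2, scalarMat_apply, map_smul]

/-! ### Low-frequency parts of bounded functions -/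

section Convolution

variable {F : Type} [NormedAddCommGroup F] [NormedSpace ℝ F] {a : Rn n → ℝ} {A : ℝ}

/-- The translates of a Schwartz function by vectors of norm at most one have a common integrable
majorant, which permits differentiation under the integral in convolutions. -/
theorem SchwartzMap.exists_integrable_translate_bound (K : 𝓢(Rn n, F)) :
    ∃ g : Rn n → ℝ, Integrable g ∧ ∀ z h : Rn n, ‖h‖ ≤ 1 → ‖K (z + h)‖ ≤ g z := by
  set l := (volume : Measure (Rn n)).integrablePower
  set C : ℝ := 2 ^ l * ((Finset.Iic (l, 0)).sup fun m => SchwartzMap.seminorm ℝ m.1 m.2) K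
  refine ⟨fun z => C * 2 ^ l * (1 + ‖z‖) ^ (-(l : ℝ)),
    (Measure.integrable_pow_neg_integrablePower volume).const_mul _, fun z h hh => ?_⟩
  have h1 := SchwartzMap.one_add_le_sup_seminorm_apply (𝕜 := ℝ) (m := (l, 0)) (k := l) (n := 0)
    le_rfl le_rfl K (z + h)
  rw [norm_iteratedFDeriv_zero] at h1
  have h2 : 1 + ‖z‖ ≤ 2 * (1 + ‖z + h‖) := by
    have : ‖z‖ ≤ ‖z + h‖ + ‖h‖ := by simpa using norm_sub_le (z + h) h
    linarith [norm_nonneg (z + h)]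
  have h3 : (1 + ‖z‖) ^ l ≤ 2 ^ l * (1 + ‖z + h‖) ^ l := by
    rw [← mul_pow]; gcongr
  have h4 : 0 < 1 + ‖z‖ := by positivity
  simp only
  rw [Real.rpow_neg h4.le, Real.rpow_natCast, ← div_eq_mul_inv, le_div_iff₀ (by positivity)]
  calc ‖K (z + h)‖ * (1 + ‖z‖) ^ l ≤ ‖K (z + h)‖ * (2 ^ l * (1 + ‖z + h‖) ^ l) := by gcongr
    _ = 2 ^ l * ((1 + ‖z + h‖) ^ l * ‖K (z + h)‖) := by ring
    _ ≤ 2 ^ l * C := by gcongr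
    _ = C * 2 ^ l := by ring

theorem SchwartzMap.integrable_smul_translate (K : 𝓢(Rn n, F)) (ha : AEStronglyMeasurable a volume)
    (hA : ∀ᵐ y, ‖a y‖ ≤ A) (x : Rn n) : Integrable fun y => a y • K (x - y) :=
  (K.integrable.comp_sub_left x).bdd_smul A ha hA

theorem SchwartzMap.hasFDerivAt_convolution [CompleteSpace F] (K : 𝓢(Rn n, F))
    (ha : AEStronglyMeasurable a volume) (hA : ∀ᵐ y, ‖a y‖ ≤ A) (x : Rn n) :
    HasFDerivAt (fun x => ∫ y, a y • K (x - y))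
      (∫ y, a y • SchwartzMap.fderivCLM ℝ (Rn n) F K (x - y)) x := by
  obtain ⟨g, hg, hg'⟩ := (SchwartzMap.fderivCLM ℝ (Rn n) F K).exists_integrable_translate_bound
  refine hasFDerivAt_integral_of_dominated_of_fderiv_le (s := Metric.ball x 1)
    (F' := fun x y => a y • SchwartzMap.fderivCLM ℝ (Rn n) F K (x - y))
    (bound := fun y => A * g (x - y)) (Metric.ball_mem_nhds x one_pos)
    (Eventually.of_forall fun x' => (K.integrable_smul_translate ha hA x').1)
    (K.integrable_smul_translate ha hA x)
    ((SchwartzMap.fderivCLM ℝ (Rn n) F K).integrable_smul_translate ha hA x).1 ?_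
    ((hg.comp_sub_left x).const_mul A) ?_
  · filter_upwards [hA] with y hy x' hx'
    rw [norm_smul]
    have h1 := hg' (x - y) (x' - x) (by rw [← dist_eq_norm]; exact (Metric.mem_ball.mp hx').le)
    rw [show x - y + (x' - x) = x' - y by abel] at h1
    have := (norm_nonneg (a y)).trans hy
    gcongr
  · refine Eventually.of_forall fun y x' _ => ?_
    have h1 : HasFDerivAt K (fderiv ℝ K (x' - y)) (x' - y) :=
      (K.differentiable _).hasFDerivAt
    have h2 : HasFDerivAt (fun x => K (x - y)) (fderiv ℝ K (x' - y)) x' :=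
      (hasFDerivAt_comp_sub y).mpr h1
    rw [SchwartzMap.fderivCLM_apply]
    exact h2.const_smul (a y)

theorem SchwartzMap.norm_convolution_le (K : 𝓢(Rn n, F)) (hA : ∀ᵐ y, ‖a y‖ ≤ A) (x : Rn n) :
    ‖∫ y, a y • K (x - y)‖ ≤ A * ∫ z, ‖K z‖ := by
  rw [← integral_sub_left_eq_self (fun z => ‖K z‖) volume x, ← integral_const_mul]
  refine norm_integral_le_of_norm_le ((K.integrable.comp_sub_left x).norm.const_mul A) ?_
  filter_upwards [hA] with y hy
  rw [norm_smul]
  gcongr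

/-- The convolution of a bounded function with a Schwartz function is smooth with bounded
derivatives. The target space is generalized over because each derivative falls on the kernel and
turns it into an operator-valued one. -/
theorem SchwartzMap.contDiff_convolution (ha : AEStronglyMeasurable a volume)
    (hA : ∀ᵐ y, ‖a y‖ ≤ A) (l : ℕ) : ∀ {F : Type} [NormedAddCommGroup F] [NormedSpace ℝ F]
    [CompleteSpace F] (K : 𝓢(Rn n, F)), ContDiff ℝ l (fun x => ∫ y, a y • K (x - y)) ∧
      ∃ C, ∀ x, ‖iteratedFDeriv ℝ l (fun x => ∫ y, a y • K (x - y)) x‖ ≤ C := by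
  induction l with
  | zero =>
    intro F _ _ _ K
    refine ⟨?_, A * ∫ z, ‖K z‖, fun x => ?_⟩
    · exact contDiff_zero.mpr (continuous_iff_continuousAt.mpr fun x =>
        (K.hasFDerivAt_convolution ha hA x).continuousAt)
    · rw [norm_iteratedFDeriv_zero]; exact K.norm_convolution_le hA x
  | succ l ih =>
    intro F _ _ _ K
    obtain ⟨h1, C, hC⟩ := ih (SchwartzMap.fderivCLM ℝ (Rn n) F K)
    refine ⟨?_, C, fun x => ?_⟩
    · push_cast
      exact contDiff_succ_iff_hasFDerivAt.mpr ⟨_, h1, K.hasFDerivAt_convolution ha hA⟩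
    · rw [← norm_iteratedFDeriv_fderiv,
        show fderiv ℝ (fun x => ∫ y, a y • K (x - y)) = _ from
          funext fun x => (K.hasFDerivAt_convolution ha hA x).fderiv]
      exact hC x

end Convolution

namespace LPCutoff

variable (χ : LPCutoff n)

theorem hasCompactSupport_lowSymbol (j : ℤ) : HasCompactSupport (χ.lowSymbol j) :=
  HasCompactSupport.intro (isCompact_closedBall (0 : Rn n) (2 ^ j)) fun ξ hξ =>
    χ.lowSymbol_eq_zero (not_le.mp (by simpa using hξ)).le

theorem contDiff_lowSymbol (j : ℤ) : ContDiff ℝ ∞ (χ.lowSymbol j) :=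
  Complex.ofRealCLM.contDiff.comp (χ.smooth.comp (by fun_prop))

/-- The kernel of `P_{<j}`. -/
def lowKernel (j : ℤ) : 𝓢(Rn n, ℂ) :=
  𝓕⁻ ((χ.hasCompactSupport_lowSymbol j).toSchwartzMap (χ.contDiff_lowSymbol j))

theorem lowKernel_apply (j : ℤ) (x : Rn n) : χ.lowKernel j x = 𝓕⁻ (χ.lowSymbol j) x := by
  rw [lowKernel, SchwartzMap.fourierInv_coe]; rfl

theorem lowPass_eq (j : ℤ) (f : Rn n → ℝ) :
    χ.lowPass j f = fun x => ∫ y, f y • χ.lowKernel j (x - y) := by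
  ext x
  rw [lowPass]
  congr 1; ext y
  rw [lowKernel_apply, Complex.real_smul, mul_comm]

theorem lowPass_congr {f g : Rn n → ℝ} (h : f =ᵐ[volume] g) (j : ℤ) :
    χ.lowPass j f = χ.lowPass j g := by
  ext x
  refine integral_congr_ae ?_
  filter_upwards [h] with y hy
  rw [hy]

/-- A bound for the `L¹` norms of the kernels of `P_{<j}`. -/
def lowBound : ℝ := χ.exists_symbolBound_low.choose

theorem integral_lowKernel_le (j : ℤ) : ∫ z, ‖χ.lowKernel j z‖ ≤ χ.lowBound := by
  obtain ⟨D, hD⟩ := χ.exists_symbolBound_low.choose_spec j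
  simp_rw [lowKernel_apply]
  exact hD.norm_kernel

theorem lowBound_nonneg : 0 ≤ χ.lowBound :=
  (integral_nonneg fun _ => norm_nonneg _).trans (χ.integral_lowKernel_le 0)

variable {f : Rn n → ℝ} {A : ℝ}

theorem norm_lowPass_le (hf : ∀ᵐ y, ‖f y‖ ≤ A) (hA : 0 ≤ A) (j : ℤ) (x : Rn n) :
    ‖χ.lowPass j f x‖ ≤ χ.lowBound * A := by
  rw [lowPass_eq, mul_comm]
  exact ((χ.lowKernel j).norm_convolution_le hf x).trans
    (by gcongr; exact χ.integral_lowKernel_le j)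

theorem hasTemperateGrowth_lowPass (hf : AEStronglyMeasurable f volume) (hA : ∀ᵐ y, ‖f y‖ ≤ A)
    (j : ℤ) : (χ.lowPass j f).HasTemperateGrowth := by
  rw [lowPass_eq]
  refine ⟨contDiff_infty.mpr fun l => (SchwartzMap.contDiff_convolution hf hA l _).1, fun l => ?_⟩
  obtain ⟨C, hC⟩ := (SchwartzMap.contDiff_convolution hf hA l (χ.lowKernel j)).2
  exact ⟨0, C, fun x => by simpa using hC x⟩

theorem memLp_lowPass (hf : AEStronglyMeasurable f volume) (hA : ∀ᵐ y, ‖f y‖ ≤ A) (j : ℤ) :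
    MemLp (χ.lowPass j f) ∞ volume := by
  refine memLp_top_of_bound
    (χ.hasTemperateGrowth_lowPass hf hA j).1.continuous.aestronglyMeasurable
    (A * ∫ z, ‖χ.lowKernel j z‖) (Eventually.of_forall fun x => ?_)
  rw [lowPass_eq]
  exact (χ.lowKernel j).norm_convolution_le hA x

theorem norm_lowPass_sub_le (hf : AEStronglyMeasurable f volume) (hA : ∀ᵐ y, ‖f y‖ ≤ A) {L : ℝ}
    (hL : 0 ≤ L) (hLip : ∀ x y, ‖f x - f y‖ ≤ L * ‖x - y‖) (j : ℤ) (x z : Rn n) :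
    ‖χ.lowPass j f (x - z) - χ.lowPass j f x‖ ≤ χ.lowBound * L * ‖z‖ := by
  have h1 : ∀ x, χ.lowPass j f x = ∫ y, f (x - y) • χ.lowKernel j y := by
    intro x
    rw [lowPass_eq]
    have := integral_sub_left_eq_self (fun y => f y • χ.lowKernel j (x - y)) volume x
    simp only [sub_sub_cancel] at this
    exact this.symm
  have h2 : ∀ x, Integrable fun y => f (x - y) • χ.lowKernel j y := by
    intro x
    have := ((χ.lowKernel j).integrable_smul_translate hf hA x).comp_sub_left x
    simpa using this
  rw [h1, h1, ← integral_sub (h2 _) (h2 _)]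
  calc _ ≤ ∫ y, L * ‖z‖ * ‖χ.lowKernel j y‖ := by
        refine norm_integral_le_of_norm_le ((χ.lowKernel j).integrable.norm.const_mul _)
          (Eventually.of_forall fun y => ?_)
        rw [← sub_smul, norm_smul]
        gcongr
        refine (hLip _ _).trans (le_of_eq ?_)
        rw [show x - z - y - (x - y) = -z by abel, norm_neg]
    _ ≤ _ := by
        rw [integral_const_mul]
        nlinarith [χ.integral_lowKernel_le j, mul_nonneg hL (norm_nonneg z)]

theorem lowSymbol_neg (j : ℤ) (ξ : Rn n) : χ.lowSymbol j (-ξ) = χ.lowSymbol j ξ := by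
  rw [lowSymbol, lowSymbol, χ.radial _ ((2 : ℝ) ^ (1 - j) • ξ) (by rw [smul_neg, norm_neg])]

theorem conj_lowKernel (j : ℤ) (x : Rn n) :
    (starRingEnd ℂ) (χ.lowKernel j x) = χ.lowKernel j x := by
  rw [lowKernel_apply, Real.fourierInv_eq, ← integral_conj,
    ← integral_neg_eq_self (fun v => Real.fourierChar (inner ℝ v x) • χ.lowSymbol j v)]
  congr 1; ext v
  rw [lowSymbol_neg, Circle.smul_def, Circle.smul_def, smul_eq_mul, smul_eq_mul, map_mul,
    inner_neg_left, AddChar.map_neg_eq_inv, Circle.coe_inv_eq_conj]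
  congr 1
  rw [lowSymbol, Complex.conj_ofReal]

theorem conj_lowPass (j : ℤ) (f : Rn n → ℝ) (x : Rn n) :
    (starRingEnd ℂ) (χ.lowPass j f x) = χ.lowPass j f x := by
  rw [lowPass_eq]
  simp only
  rw [← integral_conj]
  congr 1; ext y
  rw [Complex.real_smul, map_mul, Complex.conj_ofReal, conj_lowKernel]

end LPCutoff

end

noncomputable section

variable {n m : ℕ}

/-! ### Low-frequency parts of matrix-valued coefficients -/

/-- An essentially bounded real matrix-valued coefficient. -/
structure IsCoeff (M : Rn n → Matrix (Fin m) (Fin m) ℝ) (a : ℝ) : Prop where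
  measurable : ∀ i j, AEStronglyMeasurable (fun x => M x i j) volume
  bounded : ∀ i j, ∀ᵐ x, ‖M x i j‖ ≤ a
  nonneg : 0 ≤ a

theorem matrixUnit_apply (i j : Fin m) (v : CVec m) :
    matrixUnit i j v = v j • EuclideanSpace.single i (1 : ℂ) := rfl

theorem inner_matrixUnit (i j : Fin m) (v w : CVec m) :
    inner ℂ (matrixUnit i j v) w = inner ℂ v (matrixUnit j i w) := by
  rw [matrixUnit_apply, matrixUnit_apply, inner_smul_left, inner_smul_right,
    EuclideanSpace.inner_single_left, EuclideanSpace.inner_single_right]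
  simp [mul_comm]

/-- The sum of the norms of the matrix units. -/
def unitBound (m : ℕ) : ℝ := ∑ i : Fin m, ∑ j : Fin m, ‖matrixUnit i j‖

theorem unitBound_nonneg (m : ℕ) : 0 ≤ unitBound m := by unfold unitBound; positivity

namespace LPCutoff

variable (χ : LPCutoff n) {M : Rn n → Matrix (Fin m) (Fin m) ℝ} {a : ℝ}

/-- The low frequency part of a matrix-valued function, acting on `ℂᵐ`. -/
def lowPassMat (j : ℤ) (M : Rn n → Matrix (Fin m) (Fin m) ℝ) (x : Rn n) : CVec m →L[ℂ] CVec m :=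
  ∑ i, ∑ l, χ.lowPass j (fun y => M y i l) x • matrixUnit i l

theorem norm_sum_smul_matrixUnit_le {c : Fin m → Fin m → ℂ} {b : ℝ} (h : ∀ i l, ‖c i l‖ ≤ b) :
    ‖∑ i, ∑ l, c i l • matrixUnit i l‖ ≤ b * unitBound m := by
  rw [unitBound, Finset.mul_sum]
  refine (norm_sum_le _ _).trans (Finset.sum_le_sum fun i _ => ?_)
  rw [Finset.mul_sum]
  refine (norm_sum_le _ _).trans (Finset.sum_le_sum fun l _ => ?_)
  rw [norm_smul]
  gcongr
  exact h i l

theorem norm_lowPassMat_le (hM : IsCoeff M a) (j : ℤ) (x : Rn n) :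
    ‖χ.lowPassMat j M x‖ ≤ χ.lowBound * unitBound m * a :=
  (norm_sum_smul_matrixUnit_le fun i l =>
    χ.norm_lowPass_le (hM.bounded i l) hM.nonneg j x).trans (le_of_eq (by ring))

theorem continuous_lowPassMat (hM : IsCoeff M a) (j : ℤ) : Continuous (χ.lowPassMat j M) := by
  unfold lowPassMat
  refine continuous_finsetSum _ fun i _ => continuous_finsetSum _ fun l _ => ?_
  exact (χ.hasTemperateGrowth_lowPass (hM.measurable i l) (hM.bounded i l) j).1.continuous.smul
    continuous_const

theorem memLp_lowPassMat (hM : IsCoeff M a) (j : ℤ) : MemLp (χ.lowPassMat j M) ∞ volume :=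
  memLp_top_of_bound (χ.continuous_lowPassMat hM j).aestronglyMeasurable _
    (Eventually.of_forall (χ.norm_lowPassMat_le hM j))

/-- Low-frequency parts of real symmetric matrices are self-adjoint, because the cutoff is even, so
that its kernel is real. -/
theorem inner_lowPassMat (hs : ∀ x, (M x).IsSymm) (j : ℤ) (x : Rn n) (v w : CVec m) :
    inner ℂ (χ.lowPassMat j M x v) w = inner ℂ v (χ.lowPassMat j M x w) := by
  have h1 : ∀ i l, (fun y => M y i l) = fun y => M y l i := fun i l =>
    funext fun y => (hs y).apply l i
  simp only [lowPassMat, sum_apply, smul_apply, sum_inner, inner_sum, inner_smul_left,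
    inner_smul_right, conj_lowPass, inner_matrixUnit]
  rw [Finset.sum_comm]
  refine Finset.sum_congr rfl fun i _ => Finset.sum_congr rfl fun l _ => ?_
  rw [h1 l i]

/-- Low-frequency parts inherit Lipschitz bounds uniformly in the frequency. The coefficient is only
required to agree almost everywhere with a Lipschitz function. -/
theorem norm_lowPassMat_sub_le (hM : IsCoeff M a) {L : ℝ} (hL : 0 ≤ L)
    (hLip : ∀ i l, ∃ g : Rn n → ℝ, (fun x => M x i l) =ᵐ[volume] g ∧
      ∀ x y, ‖g x - g y‖ ≤ L * ‖x - y‖) (j : ℤ) (x z : Rn n) :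
    ‖χ.lowPassMat j M (x - z) - χ.lowPassMat j M x‖ ≤ χ.lowBound * unitBound m * L * ‖z‖ := by
  have h1 : χ.lowPassMat j M (x - z) - χ.lowPassMat j M x = ∑ i, ∑ l,
      (χ.lowPass j (fun y => M y i l) (x - z) - χ.lowPass j (fun y => M y i l) x) •
        matrixUnit i l := by
    ext1 v
    simp only [lowPassMat, sub_apply, sum_apply, smul_apply, sub_smul, Finset.sum_sub_distrib]
  rw [h1]
  refine (norm_sum_smul_matrixUnit_le (b := χ.lowBound * L * ‖z‖) fun i l => ?_).trans
    (le_of_eq (by ring))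
  obtain ⟨g, hg, hg'⟩ := hLip i l
  rw [χ.lowPass_congr hg]
  refine χ.norm_lowPass_sub_le ((hM.measurable i l).congr hg) (A := a) ?_ hL hg' j x z
  filter_upwards [hM.bounded i l, hg] with y hy hy'
  rw [← hy']; exact hy

theorem mulOp_lowPassMat (hM : IsCoeff M a) (j : ℤ) (h : L2 n m) :
    mulOp (χ.lowPassMat j M) h = ∑ i, ∑ l, constOp n (matrixUnit i l)
      (mulOp (scalarMat m (χ.lowPass j fun y => M y i l)) h) := by
  apply Lp.ext
  have h1 : ∀ᵐ x, ∀ i l, constOp n (matrixUnit i l)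
      (mulOp (scalarMat m (χ.lowPass j fun y => M y i l)) h) x =
        χ.lowPass j (fun y => M y i l) x • matrixUnit i l (h x) := by
    rw [ae_all_iff]; intro i; rw [ae_all_iff]; intro l
    exact constOp_mulOp_scalarMat
      (χ.memLp_lowPass (hM.measurable i l) (hM.bounded i l) j) _ h
  set F : Fin m → Fin m → L2 n m := fun i l => constOp n (matrixUnit i l)
    (mulOp (scalarMat m (χ.lowPass j fun y => M y i l)) h) with hF
  have h4 : ∀ᵐ x, ∀ i, (∑ l, F i l : L2 n m) x = ∑ l, F i l x := by
    rw [ae_all_iff]; intro i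
    filter_upwards [Lp.coeFn_finsetSum Finset.univ (F i)] with x hx
    rw [hx, Finset.sum_apply]
  filter_upwards [h1, h4, Lp.coeFn_finsetSum Finset.univ (fun i => ∑ l, F i l),
    mulOp_coeFn (χ.memLp_lowPassMat hM j) h] with x h1 h4 h2 h3
  rw [h2, h3, Finset.sum_apply]
  simp only [h4]
  simp only [hF, lowPassMat, sum_apply, smul_apply, h1]

/-- The product of the low frequency part of a bounded function with a function at the frequency
`2 ^ k` is localized at the frequency `2 ^ k`. -/
theorem FM_annSymbol_mulOp_lowPass {f : Rn n → ℝ} (hf : AEStronglyMeasurable f volume)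
    (hb : ∀ᵐ y, ‖f y‖ ≤ a) {N k : ℤ} (hN : 3 ≤ N) {β : Rn n → ℂ}
    (hβ : MemLp (χ.annSymbol 1 k * β) ∞ volume) (h : L2 n m) :
    FM m (χ.annSymbol 4 k) (mulOp (scalarMat m (χ.lowPass (k - N) f))
      (FM m (χ.annSymbol 1 k * β) h)) =
      mulOp (scalarMat m (χ.lowPass (k - N) f)) (FM m (χ.annSymbol 1 k * β) h) := by
  have hone : MemLp (1 : Rn n → ℂ) ∞ volume := memLp_top_const 1
  have hα : MemLp (1 - χ.annSymbol 4 k) ∞ volume := hone.sub (χ.memLp_annSymbol 4 k)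
  obtain ⟨C, hC⟩ := χ.exists_symbolBound_low
  obtain ⟨D, hD⟩ := hC (k - N)
  have h2 := FM_mulOp_FM_eq_zero (m := m) hD.integrable hD.integrable_kernel
    (f := fun y => (f y : ℂ)) (C := a) (R := 2 ^ (k - N))
    (Complex.continuous_ofReal.comp_aestronglyMeasurable hf)
    (by filter_upwards [hb] with x hx; rwa [Complex.norm_real])
    (fun ζ hζ => χ.lowSymbol_eq_zero hζ) hα hβ ?_
    (χ.memLp_lowPass hf hb (k - N))
  · have h3 := congrArg (fun T : L2 n m →L[ℂ] L2 n m => T h) h2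
    simp only [ContinuousLinearMap.comp_apply, zero_apply] at h3
    rw [FM_sub hone (χ.memLp_annSymbol 4 k), FM_one, sub_apply, sub_eq_zero] at h3
    exact h3.symm
  · intro ξ η hξη
    by_cases h4 : χ.annSymbol 1 k η = 0
    · right; rw [Pi.mul_apply, h4, zero_mul]
    left
    obtain ⟨h5, h6⟩ := χ.mem_of_annSymbol_ne_zero le_rfl h4
    have h7 : (2 : ℝ) ^ (k - N) ≤ 2 ^ k / 8 := by
      calc (2 : ℝ) ^ (k - N) ≤ 2 ^ (k - 3) := zpow_le_zpow_right₀ one_le_two (by omega)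
        _ = 2 ^ k / 8 := by rw [zpow_sub₀ two_ne_zero]; norm_num
    have h8 : (0 : ℝ) < 2 ^ k := by positivity
    have h9 := norm_sub_norm_le ξ η
    have h10 := norm_sub_norm_le η ξ
    rw [norm_sub_rev] at h10
    rw [Pi.sub_apply, Pi.one_apply, annSymbol, χ.annulus_eq_one (by norm_num),
      Complex.ofReal_one, sub_self]
    · rw [norm_smul, Real.norm_of_nonneg (by positivity), zpow_neg, mul_left_comm,
        ← div_eq_inv_mul, le_div_iff₀ h8]
      linarith
    · rw [norm_smul, Real.norm_of_nonneg (by positivity), zpow_neg, inv_mul_le_iff₀ h8]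
      linarith

/-! ### Dyadic pieces of the paradifferential operator -/

/-- A continuous symbol of order at most one. -/
structure _root_.IsFirstOrder (c : Rn n → ℂ) (c₀ : ℝ) : Prop where
  cont : Continuous c
  bound : ∀ ξ, ‖c ξ‖ ≤ c₀ * ‖weight 1 ξ‖

theorem _root_.isFirstOrder_derivSymbol (j : Fin n) :
    IsFirstOrder (derivSymbol j) (2 * Real.pi) :=
  ⟨continuous_derivSymbol j, norm_derivSymbol_le j⟩

theorem _root_.isFirstOrder_one : IsFirstOrder (1 : Rn n → ℂ) 1 := by
  refine ⟨continuous_const, fun ξ => ?_⟩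
  rw [Pi.one_apply, norm_one, one_mul, norm_weight]
  exact Real.one_le_rpow (by nlinarith [sq_nonneg ‖ξ‖]) (by norm_num)

/-- The operator `Λ^τ A c(D) P_k Λ^(-τ-1)`, localized in its output at the frequency `2 ^ k`. The
cutoffs `annSymbol c k` with `c = 1, 4, 8, 16` are used throughout: each equals one on the support
of its predecessors, and can therefore be inserted next to them. -/
def paraTerm (τ : ℝ) (k : ℤ) (c : Rn n → ℂ) (A : Rn n → CVec m →L[ℂ] CVec m) :
    L2 n m →L[ℂ] L2 n m :=
  FM m (χ.annSymbol 4 k * weight τ) ∘L mulOp A ∘L FM m (χ.annSymbol 1 k * (c * weight (-τ - 1)))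

variable {c : Rn n → ℂ} {c₀ : ℝ} {A : Rn n → CVec m →L[ℂ] CVec m}

theorem norm_annSymbol_mul_le (hc : IsFirstOrder c c₀) (τ : ℝ) (k : ℤ) (ξ : Rn n) :
    ‖(χ.annSymbol 1 k * (c * weight (-τ - 1)) : Rn n → ℂ) ξ‖ ≤
      c₀ * (2 * χ.bound * (256 ^ |-τ / 2| * dyadicWeight k ^ (-τ / 2))) := by
  have h1 : ‖weight 1 ξ‖ * ‖weight (-τ - 1) ξ‖ = ‖weight (-τ) ξ‖ := by
    rw [← norm_mul, ← Pi.mul_apply, weight_mul]; congr 2; ring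
  have hc0 : 0 ≤ c₀ := by
    have := (norm_nonneg _).trans (hc.bound 0)
    simpa [weight] using this
  rw [Pi.mul_apply, Pi.mul_apply, norm_mul, norm_mul]
  calc _ ≤ ‖χ.annSymbol 1 k ξ‖ * (c₀ * ‖weight 1 ξ‖ * ‖weight (-τ - 1) ξ‖) := by
        gcongr; exact hc.bound ξ
    _ = c₀ * ‖χ.annSymbol 1 k ξ * weight (-τ) ξ‖ := by rw [norm_mul, ← h1]; ring
    _ ≤ _ := by
        gcongr
        exact norm_annSymbol_mul_weight_le χ le_rfl (by norm_num) k (-τ) ξ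

theorem memLp_annSymbol_mul (hc : IsFirstOrder c c₀) (τ : ℝ) (k : ℤ) :
    MemLp (χ.annSymbol 1 k * (c * weight (-τ - 1))) ∞ volume :=
  memLp_top_of_bound ((χ.continuous_annSymbol 1 k).mul
    (hc.cont.mul (continuous_weight _))).aestronglyMeasurable _
    (Eventually.of_forall (χ.norm_annSymbol_mul_le hc τ k))

theorem memLp_annSymbol_mul' (hc : IsFirstOrder c c₀) (k : ℤ) :
    MemLp (χ.annSymbol 1 k * c) ∞ volume := by
  have := χ.memLp_annSymbol_mul hc (-1) k
  rwa [show -(-1 : ℝ) - 1 = 0 by norm_num, weight_zero, mul_one] at this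

/-- The pieces are bounded on `L²` uniformly in `k`: the weights before and after the multiplication
are of size `dyadicWeight k ^ (∓ τ / 2)` and cancel. -/
theorem norm_paraTerm_le (hc : IsFirstOrder c c₀) (τ : ℝ) (k : ℤ) {b : ℝ} (hb : 0 ≤ b)
    (hA : ∀ x, ‖A x‖ ≤ b) :
    ‖χ.paraTerm τ k c A‖ ≤ (2 * χ.bound * 256 ^ |τ / 2|) ^ 2 * c₀ * b := by
  have hB := χ.bound_pos
  have hw := dyadicWeight_pos k
  have h1 : ‖FM m (χ.annSymbol 4 k * weight τ)‖ ≤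
      2 * χ.bound * (256 ^ |τ / 2| * dyadicWeight k ^ (τ / 2)) :=
    norm_FM_le (by positivity)
      (norm_annSymbol_mul_weight_le χ (by norm_num) (by norm_num) k τ)
  have h2 : ‖FM m (χ.annSymbol 1 k * (c * weight (-τ - 1)))‖ ≤ _ :=
    norm_FM_le ((norm_nonneg _).trans (χ.norm_annSymbol_mul_le hc τ k 0))
      (χ.norm_annSymbol_mul_le hc τ k)
  have h3 := norm_mulOp_le hb (Eventually.of_forall hA)
  have h4 : dyadicWeight k ^ (τ / 2) * dyadicWeight k ^ (-τ / 2) = 1 := by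
    rw [← Real.rpow_add hw, show τ / 2 + -τ / 2 = 0 by ring, Real.rpow_zero]
  have h5 : |-τ / 2| = |τ / 2| := by rw [neg_div, abs_neg]
  calc ‖χ.paraTerm τ k c A‖ ≤ ‖FM m (χ.annSymbol 4 k * weight τ)‖ * (‖mulOp A‖ *
        ‖FM m (χ.annSymbol 1 k * (c * weight (-τ - 1)))‖) :=
        (ContinuousLinearMap.opNorm_comp_le _ _).trans
          (by gcongr; exact ContinuousLinearMap.opNorm_comp_le _ _)
    _ ≤ (2 * χ.bound * (256 ^ |τ / 2| * dyadicWeight k ^ (τ / 2))) * (b *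
        (c₀ * (2 * χ.bound * (256 ^ |-τ / 2| * dyadicWeight k ^ (-τ / 2))))) := by gcongr
    _ = (2 * χ.bound * 256 ^ |τ / 2|) ^ 2 * c₀ * b *
        (dyadicWeight k ^ (τ / 2) * dyadicWeight k ^ (-τ / 2)) := by rw [h5]; ring
    _ = _ := by rw [h4, mul_one]

/-- The pieces are localized at the frequency `2 ^ k` in their input and in their output, which
makes their sum almost orthogonal. -/
theorem FM_paraTerm_FM (hc : IsFirstOrder c c₀) (τ : ℝ) (k : ℤ) (x : L2 n m) :
    FM m (χ.annSymbol 16 k) (χ.paraTerm τ k c A (FM m (χ.annSymbol 16 k) x)) =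
      χ.paraTerm τ k c A x := by
  have h16 := χ.memLp_annSymbol 16 k
  simp only [paraTerm, ContinuousLinearMap.comp_apply]
  rw [FM_comp_apply h16 (memLp_annSymbol_mul_weight χ (by norm_num) (by norm_num) k τ),
    FM_comp_apply (χ.memLp_annSymbol_mul hc τ k) h16, ← mul_assoc,
    mul_comm (χ.annSymbol 16 k), χ.annSymbol_mul (by norm_num) (by norm_num), mul_right_comm,
    χ.annSymbol_mul (by norm_num) (by norm_num)]

/-! ### The energy estimate for dyadic pieces -/

/-- The pairing which enters the energy estimate, in terms of the symbol
`χ(ξ / 2 ^ K)² (1 + ‖ξ‖²)^(τ+1)` of the energy. -/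
theorem inner_paraTerm (hc : IsFirstOrder c c₀) (τ : ℝ) (K : ℕ) (k : ℤ) (x : L2 n m)
    (hM : MemLp (χ.truncSymbol K * weight 1) ∞ volume)
    (hΘ : MemLp (fun ξ => χ.truncSymbol K ξ ^ 2 *
      (χ.annSymbol 4 k ξ * weight (2 * (τ + 1)) ξ)) ∞ volume) :
    let y := FM m (χ.annSymbol 8 k * weight (-(τ + 1))) (FM m (χ.annSymbol 16 k) x)
    inner ℂ (FM m (χ.truncSymbol K * weight 1) (χ.paraTerm τ k c A x))
        (FM m (χ.truncSymbol K) x) =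
      inner ℂ (mulOp A (FM m (χ.annSymbol 1 k * c) y)) (FM m (fun ξ => χ.truncSymbol K ξ ^ 2 *
        (χ.annSymbol 4 k ξ * weight (2 * (τ + 1)) ξ)) y) := by
  intro y
  have h4 := memLp_annSymbol_mul_weight χ (c := 4) (by norm_num) (by norm_num) k τ
  have h8 := memLp_annSymbol_mul_weight χ (c := 8) (by norm_num) (by norm_num) k (-(τ + 1))
  have h16 := χ.memLp_annSymbol 16 k
  have hJ := χ.memLp_truncSymbol K
  have hs1 : star (χ.truncSymbol K * weight 1) = χ.truncSymbol K * weight 1 := by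
    rw [star_mul, star_truncSymbol, star_weight, mul_comm]
  have hs2 : star (χ.annSymbol 4 k * weight τ) = χ.annSymbol 4 k * weight τ := by
    rw [star_mul, star_annSymbol, star_weight, mul_comm]
  have hp := χ.memLp_annSymbol_mul' hc k
  have h816 : MemLp ((χ.annSymbol 8 k * weight (-(τ + 1))) * χ.annSymbol 16 k) ∞ volume :=
    h16.mul h8
  have hMJ : MemLp ((χ.truncSymbol K * weight 1) * χ.truncSymbol K) ∞ volume := hJ.mul hM
  have e14 : χ.annSymbol 1 k * χ.annSymbol 8 k = χ.annSymbol 1 k :=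
    χ.annSymbol_mul (by norm_num) (by norm_num) k
  have e48 : χ.annSymbol 4 k * χ.annSymbol 8 k = χ.annSymbol 4 k :=
    χ.annSymbol_mul (by norm_num) (by norm_num) k
  have e816 : χ.annSymbol 8 k * χ.annSymbol 16 k = χ.annSymbol 8 k :=
    χ.annSymbol_mul (by norm_num) (by norm_num) k
  have hw1 : (weight τ * weight 1 : Rn n → ℂ) = weight (τ + 1) := weight_mul _ _
  have hw2 : (weight (2 * (τ + 1)) * weight (-(τ + 1)) : Rn n → ℂ) = weight (τ + 1) := by
    rw [weight_mul]; congr 1; ring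
  simp only [paraTerm, ContinuousLinearMap.comp_apply]
  rw [inner_FM hM, inner_FM h4, hs1, hs2, FM_comp_apply hM hJ, FM_comp_apply h4 hMJ]
  have hy : y = FM m ((χ.annSymbol 8 k * weight (-(τ + 1))) * χ.annSymbol 16 k) x :=
    FM_comp_apply h8 h16 x
  have hl : χ.annSymbol 1 k * (c * weight (-τ - 1)) = χ.annSymbol 1 k * c *
      (χ.annSymbol 8 k * weight (-(τ + 1)) * χ.annSymbol 16 k) := by
    rw [show -τ - 1 = -(τ + 1) by ring]
    ext ξ
    have e1 := congrFun e14 ξ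
    have e2 := congrFun e816 ξ
    simp only [Pi.mul_apply] at *
    linear_combination (-c ξ * weight (-(τ + 1)) ξ) * e1 -
      c ξ * weight (-(τ + 1)) ξ * χ.annSymbol 1 k ξ * e2
  have hr : χ.annSymbol 4 k * weight τ * (χ.truncSymbol K * weight 1 * χ.truncSymbol K) =
      (fun ξ => χ.truncSymbol K ξ ^ 2 * (χ.annSymbol 4 k ξ * weight (2 * (τ + 1)) ξ)) *
      (χ.annSymbol 8 k * weight (-(τ + 1)) * χ.annSymbol 16 k) := by
    ext ξ
    have e1 := congrFun e48 ξ
    have e2 := congrFun e816 ξ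
    have e3 := congrFun hw1 ξ
    have e4 := congrFun hw2 ξ
    simp only [Pi.mul_apply] at *
    linear_combination (χ.truncSymbol K ξ ^ 2 * χ.annSymbol 4 k ξ) * e3 -
      (χ.truncSymbol K ξ ^ 2 * weight (τ + 1) ξ) * e1 -
      (χ.truncSymbol K ξ ^ 2 * weight (τ + 1) ξ * χ.annSymbol 4 k ξ) * e2 -
      (χ.truncSymbol K ξ ^ 2 * χ.annSymbol 4 k ξ * χ.annSymbol 8 k ξ * χ.annSymbol 16 k ξ) * e4
  rw [hy, FM_comp_apply hp h816, FM_comp_apply hΘ h816, hl, hr]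

theorem memLp_truncSymbol_mul_weight (K : ℕ) (τ : ℝ) :
    MemLp (χ.truncSymbol K * weight τ) ∞ volume := by
  have h : HasCompactSupport (χ.truncSymbol K * weight τ) :=
    HasCompactSupport.intro (isCompact_closedBall (0 : Rn n) (2 ^ (K + 1))) fun ξ hξ => by
      rw [Pi.mul_apply, χ.truncSymbol_eq_zero (not_le.mp (by simpa using hξ)).le, zero_mul]
  have hc := (χ.continuous_truncSymbol K).mul (continuous_weight τ)
  obtain ⟨C, hC⟩ := h.exists_bound_of_continuous hc
  exact memLp_top_of_bound hc.aestronglyMeasurable C (Eventually.of_forall hC)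

/-- The weight of the energy symbol at the frequency `2 ^ k` is absorbed by the Bessel potential of
order `-σ`. -/
theorem norm_sq_localized_le (σ : ℝ) (k : ℤ) (x : L2 n m) :
    dyadicWeight k ^ σ *
      ‖FM m (χ.annSymbol 8 k * weight (-σ)) (FM m (χ.annSymbol 16 k) x)‖ ^ 2 ≤
      (2 * χ.bound * 256 ^ |σ / 2|) ^ 2 * ‖FM m (χ.annSymbol 16 k) x‖ ^ 2 := by
  have hB := χ.bound_pos
  have hw := dyadicWeight_pos k
  have h1 : ‖FM m (χ.annSymbol 8 k * weight (-σ))‖ ≤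
      2 * χ.bound * (256 ^ |-σ / 2| * dyadicWeight k ^ (-σ / 2)) :=
    norm_FM_le (by positivity)
      (norm_annSymbol_mul_weight_le χ (by norm_num) le_rfl k (-σ))
  have h2 := ContinuousLinearMap.le_of_opNorm_le _ h1 (FM m (χ.annSymbol 16 k) x)
  have h3 : dyadicWeight k ^ σ * (dyadicWeight k ^ (-σ / 2)) ^ 2 = 1 := by
    rw [← Real.rpow_natCast, ← Real.rpow_mul hw.le, ← Real.rpow_add hw,
      show σ + -σ / 2 * ((2 : ℕ) : ℝ) = 0 by push_cast; ring, Real.rpow_zero]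
  have h5 : |-σ / 2| = |σ / 2| := by rw [neg_div, abs_neg]
  calc _ ≤ dyadicWeight k ^ σ * (2 * χ.bound * (256 ^ |-σ / 2| * dyadicWeight k ^ (-σ / 2)) *
        ‖FM m (χ.annSymbol 16 k) x‖) ^ 2 := by gcongr
    _ = (2 * χ.bound * 256 ^ |σ / 2|) ^ 2 * ‖FM m (χ.annSymbol 16 k) x‖ ^ 2 *
        (dyadicWeight k ^ σ * (dyadicWeight k ^ (-σ / 2)) ^ 2) := by rw [h5]; ring
    _ = _ := by rw [h3, mul_one]

/-- For self-adjoint `Θ`, `A` and a skew-adjoint `g` which commutes with `Θ`, the quadratic form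
`Re ⟨A g y, Θ y⟩` is given by commutators, since
`Θ A g + (Θ A g)* = Θ A g - g A Θ = [Θ, A] g - [g, A] Θ`. -/
theorem _root_.abs_re_inner_le_commutator {H : Type*} [NormedAddCommGroup H]
    [InnerProductSpace ℂ H] {Θ A g : H →L[ℂ] H}
    (hΘ : ∀ x y, inner ℂ (Θ x) y = inner ℂ x (Θ y)) (hA : ∀ x y, inner ℂ (A x) y = inner ℂ x (A y))
    (hg : ∀ x y, inner ℂ (g x) y = -inner ℂ x (g y)) (hcomm : ∀ x, Θ (g x) = g (Θ x)) (y : H) :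
    |(inner ℂ (A (g y)) (Θ y)).re| ≤
      (‖Θ ∘L A - A ∘L Θ‖ * ‖g‖ + ‖g ∘L A - A ∘L g‖ * ‖Θ‖) * ‖y‖ ^ 2 := by
  have h1 : inner ℂ (A (g y)) (Θ y) + inner ℂ (Θ y) (A (g y)) =
      inner ℂ ((Θ ∘L A - A ∘L Θ) (g y)) y - inner ℂ ((g ∘L A - A ∘L g) (Θ y)) y := by
    simp only [sub_apply, ContinuousLinearMap.comp_apply, inner_sub_left]
    rw [hΘ (A (g y)) y, hcomm, hg (A (Θ y)) y, hA (Θ y) (g y)]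
    ring
  have h2 : 2 * (inner ℂ (A (g y)) (Θ y)).re = (inner ℂ ((Θ ∘L A - A ∘L Θ) (g y)) y -
      inner ℂ ((g ∘L A - A ∘L g) (Θ y)) y).re := by
    rw [← h1, Complex.add_re, ← inner_conj_symm (Θ y), Complex.conj_re]; ring
  have h3 : ∀ (P Q : H →L[ℂ] H), ‖inner ℂ (P (Q y)) y‖ ≤ ‖P‖ * ‖Q‖ * ‖y‖ ^ 2 := by
    intro P Q
    calc _ ≤ ‖P (Q y)‖ * ‖y‖ := norm_inner_le_norm _ _
      _ ≤ ‖P‖ * (‖Q‖ * ‖y‖) * ‖y‖ := by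
        gcongr
        exact P.le_opNorm_of_le (Q.le_opNorm y)
      _ = _ := by ring
  have h4 := (Complex.abs_re_le_norm _).trans (norm_sub_le
    (inner ℂ ((Θ ∘L A - A ∘L Θ) (g y)) y) (inner ℂ ((g ∘L A - A ∘L g) (Θ y)) y))
  rw [← h2, abs_mul, abs_two] at h4
  have h5 := h3 (Θ ∘L A - A ∘L Θ) g
  have h6 := h3 (g ∘L A - A ∘L g) Θ
  have h7 := abs_nonneg (inner ℂ (A (g y)) (Θ y)).re
  linarith

/-- The quadratic form of a symmetric multiplication operator and a skew multiplier `g`, tested with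
the real symbol `Θ`, is bounded by the Lipschitz constant of the coefficient. -/
theorem _root_.abs_re_inner_mulOp_le {Θ g : Rn n → ℂ} {B₁ D₁ B₂ D₂ L : ℝ}
    (hΘ : SymbolBound Θ B₁ D₁) (hg : SymbolBound g B₂ D₂) (hsΘ : star Θ = Θ)
    (hsg : star g = (-1 : ℂ) • g) (hL : 0 ≤ L) (hA : MemLp A ∞ volume)
    (hsymm : ∀ x v w, inner ℂ (A x v) w = inner ℂ v (A x w))
    (hLip : ∀ x z, ‖A (x - z) - A x‖ ≤ L * ‖z‖) (y : L2 n m) :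
    |(inner ℂ (mulOp A (FM m g y)) (FM m Θ y)).re| ≤ L * (D₁ * B₂ + D₂ * B₁) * ‖y‖ ^ 2 := by
  have h1 := abs_re_inner_le_commutator (Θ := FM m Θ) (A := mulOp A) (g := FM m g)
    (fun u v => by rw [inner_FM hΘ.memLp, hsΘ])
    (fun u v => inner_mulOp hA hA (Eventually.of_forall hsymm) u v)
    (fun u v => by
      rw [inner_FM hg.memLp, hsg, FM_smul hg.memLp, smul_apply, inner_smul_right]; ring)
    (fun u => congrArg (fun T : L2 n m →L[ℂ] L2 n m => T u) (FM_comm hΘ.memLp hg.memLp)) y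
  have h2 := hΘ.norm_commutator hA hL hLip
  have h3 := hg.norm_commutator hA hL hLip
  have h4 := hΘ.norm_FM (m := m)
  have h5 := hg.norm_FM (m := m)
  have h6 := hΘ.moment_nonneg
  have h7 := hg.moment_nonneg
  have h8 := hΘ.bound_nonneg
  have h9 := hg.bound_nonneg
  refine h1.trans ?_
  calc _ ≤ (L * D₁ * B₂ + L * D₂ * B₁) * ‖y‖ ^ 2 := by gcongr
    _ = _ := by ring

theorem star_energySymbol (K : ℕ) (k : ℤ) (σ : ℝ) :
    star (fun ξ => χ.truncSymbol K ξ ^ 2 * (χ.annSymbol 4 k ξ * weight σ ξ)) =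
      fun ξ => χ.truncSymbol K ξ ^ 2 * (χ.annSymbol 4 k ξ * weight σ ξ) := by
  ext ξ
  simp only [Pi.star_apply, RCLike.star_def, truncSymbol, annSymbol, weight, map_mul, map_pow,
    Complex.conj_ofReal]

theorem star_block_derivSymbol (k : ℤ) (j : Fin n) :
    star (χ.annSymbol 1 k * derivSymbol j) = (-1 : ℂ) • (χ.annSymbol 1 k * derivSymbol j) := by
  ext ξ
  simp only [Pi.mul_apply, Pi.star_apply, Pi.smul_apply, annSymbol, derivSymbol, RCLike.star_def,
    map_mul, Complex.conj_ofReal, Complex.conj_I, map_ofNat, smul_eq_mul]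
  ring

/-- The energy estimate for a first order piece. The commutators gain the factor `2 ^ (-k)` which
compensates the derivative, so that the bound involves only the Lipschitz constant of the symmetric
coefficient, and is uniform in the truncation `K` and in the frequency `2 ^ k`. -/
theorem exists_energy_bound_deriv (τ : ℝ) : ∃ C, 0 ≤ C ∧ ∀ (j : Fin n) (K : ℕ) (k : ℤ)
    (A : Rn n → CVec m →L[ℂ] CVec m) (L : ℝ), 0 ≤ L → MemLp A ∞ volume →
    (∀ x v w, inner ℂ (A x v) w = inner ℂ v (A x w)) →
    (∀ x z, ‖A (x - z) - A x‖ ≤ L * ‖z‖) → ∀ x : L2 n m,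
    |(inner ℂ (FM m (χ.truncSymbol K * weight 1) (χ.paraTerm τ k (derivSymbol j) A x))
      (FM m (χ.truncSymbol K) x)).re| ≤ C * L * ‖FM m (χ.annSymbol 16 k) x‖ ^ 2 := by
  obtain ⟨C₁, hC₁⟩ := χ.exists_symbolBound_energy (τ + 1)
  choose C₂ hC₂ using χ.exists_symbolBound_block_deriv
  have hC₁0 : 0 ≤ C₁ := nonneg_of_mul_nonneg_left (hC₁ 0 0).bound_nonneg
    (Real.rpow_pos_of_pos (dyadicWeight_pos 0) _)
  have hC₂0 : ∀ j, 0 ≤ C₂ j := fun j => (hC₂ j 0).moment_nonneg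
  set B := (2 * χ.bound * 256 ^ |(τ + 1) / 2|) ^ 2
  refine ⟨2 * C₁ * (∑ j, C₂ j) * B, by
    have := Finset.sum_nonneg fun j (_ : j ∈ Finset.univ) => hC₂0 j
    positivity, fun j K k A L hL hA hsymm hLip x => ?_⟩
  have hΘ := hC₁ K k
  have hg := hC₂ j k
  rw [show (fun ξ => χ.blockSymbol k ξ * derivSymbol j ξ) = χ.annSymbol 1 k * derivSymbol j by
    rw [χ.blockSymbol_eq_annSymbol]; rfl] at hg
  rw [χ.inner_paraTerm (isFirstOrder_derivSymbol j) τ K k x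
    (χ.memLp_truncSymbol_mul_weight K 1) hΘ.memLp]
  have h8 := χ.norm_sq_localized_le (τ + 1) k x
  generalize FM m (χ.annSymbol 8 k * weight (-(τ + 1))) (FM m (χ.annSymbol 16 k) x) = y at *
  refine (abs_re_inner_mulOp_le hΘ hg (χ.star_energySymbol K k _) (χ.star_block_derivSymbol k j)
    hL hA hsymm hLip y).trans ?_
  have h6 : (2 : ℝ) ^ (-k) * 2 ^ k = 1 := by
    rw [← zpow_add₀ two_ne_zero, neg_add_cancel, zpow_zero]
  calc _ = 2 * L * C₁ * C₂ j * (dyadicWeight k ^ (τ + 1) * ‖y‖ ^ 2) +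
        L * C₁ * C₂ j * (dyadicWeight k ^ (τ + 1) * ‖y‖ ^ 2) * (2 ^ (-k) * 2 ^ k - 1) := by ring
    _ = 2 * L * C₁ * C₂ j * (dyadicWeight k ^ (τ + 1) * ‖y‖ ^ 2) := by rw [h6]; ring
    _ ≤ 2 * L * C₁ * (∑ j, C₂ j) * (B * ‖FM m (χ.annSymbol 16 k) x‖ ^ 2) := by
        have h7 : C₂ j ≤ ∑ j, C₂ j :=
          Finset.single_le_sum (fun j _ => hC₂0 j) (Finset.mem_univ j)
        have h9 := (hC₂0 j).trans h7
        have h10 := dyadicWeight_pos k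
        exact mul_le_mul (by gcongr) h8 (by positivity) (by positivity)
    _ = _ := by ring

/-- The energy estimate for a piece of order zero, where no cancellation is needed. -/
theorem exists_energy_bound_one (τ : ℝ) : ∃ C, 0 ≤ C ∧ ∀ (K : ℕ) (k : ℤ)
    (A : Rn n → CVec m →L[ℂ] CVec m) (b : ℝ), 0 ≤ b → (∀ x, ‖A x‖ ≤ b) → ∀ x : L2 n m,
    |(inner ℂ (FM m (χ.truncSymbol K * weight 1) (χ.paraTerm τ k 1 A x))
      (FM m (χ.truncSymbol K) x)).re| ≤ C * b * ‖FM m (χ.annSymbol 16 k) x‖ ^ 2 := by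
  obtain ⟨C₁, hC₁⟩ := χ.exists_symbolBound_energy (τ + 1)
  have hC₁0 : 0 ≤ C₁ := nonneg_of_mul_nonneg_left (hC₁ 0 0).bound_nonneg
    (Real.rpow_pos_of_pos (dyadicWeight_pos 0) _)
  set B := (2 * χ.bound * 256 ^ |(τ + 1) / 2|) ^ 2
  have hB := χ.bound_pos
  refine ⟨2 * χ.bound * C₁ * B, by positivity, fun K k A b hb hA x => ?_⟩
  have hΘ := hC₁ K k
  rw [χ.inner_paraTerm isFirstOrder_one τ K k x (χ.memLp_truncSymbol_mul_weight K 1) hΘ.memLp,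
    mul_one]
  set y := FM m (χ.annSymbol 8 k * weight (-(τ + 1))) (FM m (χ.annSymbol 16 k) x) with hy
  have h1 : ‖FM m (χ.annSymbol 1 k)‖ ≤ 2 * χ.bound :=
    norm_FM_le (by positivity) (χ.norm_annSymbol_le 1 k)
  have h2 := norm_mulOp_le hb (Eventually.of_forall hA)
  refine (Complex.abs_re_le_norm _).trans ((norm_inner_le_norm _ _).trans ?_)
  calc _ ≤ (b * (2 * χ.bound * ‖y‖)) * (C₁ * dyadicWeight k ^ (τ + 1) * ‖y‖) := by
        gcongr
        · exact ContinuousLinearMap.le_of_opNorm_le_of_le _ h2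
            (ContinuousLinearMap.le_of_opNorm_le _ h1 y)
        · exact ContinuousLinearMap.le_of_opNorm_le _ hΘ.norm_FM y
    _ = 2 * χ.bound * C₁ * b * (dyadicWeight k ^ (τ + 1) * ‖y‖ ^ 2) := by ring
    _ ≤ 2 * χ.bound * C₁ * b * (B * ‖FM m (χ.annSymbol 16 k) x‖ ^ 2) := by
        exact mul_le_mul_of_nonneg_left (χ.norm_sq_localized_le (τ + 1) k x) (by positivity)
    _ = _ := by ring

end LPCutoff

end

noncomputable section

variable {n m : ℕ}

/-! ### The regularization by frequency truncation -/

theorem norm_weight_le_one {τ : ℝ} (hτ : τ ≤ 0) (ξ : Rn n) : ‖weight τ ξ‖ ≤ 1 := by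
  rw [norm_weight]
  exact Real.rpow_le_one_of_one_le_of_nonpos (by nlinarith [sq_nonneg ‖ξ‖]) (by linarith)

theorem memLp_weight {τ : ℝ} (hτ : τ ≤ 0) : MemLp (weight τ : Rn n → ℂ) ∞ volume :=
  memLp_top_of_bound (continuous_weight τ).aestronglyMeasurable 1
    (Eventually.of_forall (norm_weight_le_one hτ))

theorem norm_weight_neg_one_mul_le (ξ : Rn n) : ‖weight (-1) ξ‖ * ‖ξ‖ ≤ 1 := by
  have h1 : ‖ξ‖ ≤ ‖weight 1 ξ‖ := by
    rw [norm_weight, ← Real.sqrt_eq_rpow]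
    exact Real.le_sqrt_of_sq_le (by linarith)
  have h2 : ‖weight (-1) ξ‖ * ‖weight 1 ξ‖ = 1 := by
    rw [← norm_mul, ← Pi.mul_apply, weight_mul]; simp [weight]
  have h3 := mul_le_mul_of_nonneg_left h1 (norm_nonneg (weight (-1) ξ))
  rwa [h2] at h3

theorem FM_add {φ ψ : Rn n → ℂ} (hφ : MemLp φ ∞ volume) (hψ : MemLp ψ ∞ volume) :
    FM m (φ + ψ) = FM m φ + FM m ψ := by
  have h : MemLp ((-1 : ℂ) • ψ) ∞ volume := hψ.const_smul (-1)
  have h1 := FM_sub (m := m) hφ h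
  rw [FM_smul hψ] at h1
  rw [show φ + ψ = φ - (-1 : ℂ) • ψ by rw [neg_one_smul, sub_neg_eq_add], h1]
  ext1 x
  simp

theorem FM_zero : FM m (0 : Rn n → ℂ) = 0 := by
  have h := FM_sub (m := m) (memLp_top_const (μ := (volume : Measure (Rn n))) (1 : ℂ))
    (memLp_top_const (1 : ℂ))
  rwa [sub_self, sub_self] at h

theorem FM_sum {ι : Type*} (F : Finset ι) {φ : ι → Rn n → ℂ} (h : ∀ i, MemLp (φ i) ∞ volume) :
    FM m (∑ i ∈ F, φ i) = ∑ i ∈ F, FM m (φ i) ∧ MemLp (∑ i ∈ F, φ i) ∞ volume := by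
  classical
  induction F using Finset.induction_on with
  | empty => exact ⟨by simp [FM_zero], by simp⟩
  | insert i F hi ih =>
    rw [Finset.sum_insert hi, Finset.sum_insert hi, FM_add (h i) ih.2, ih.1]
    exact ⟨rfl, (h i).add ih.2⟩

namespace LPCutoff

variable (χ : LPCutoff n)

theorem tendsto_FM_truncSymbol (x : L2 n m) :
    Tendsto (fun K => FM m (χ.truncSymbol K) x) atTop (𝓝 x) := by
  rw [tendsto_iff_norm_sub_tendsto_zero]
  have hone : MemLp (1 : Rn n → ℂ) ∞ volume := memLp_top_const 1
  have hm : ∀ K, MemLp (χ.truncSymbol K - 1) ∞ volume := fun K => (χ.memLp_truncSymbol K).sub hone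
  have h1 : ∀ K, ‖FM m (χ.truncSymbol K) x - x‖ ^ 2 =
      ∫ ξ, ‖χ.truncSymbol K ξ - 1‖ ^ 2 * ‖(𝓕 x : L2 n m) ξ‖ ^ 2 := by
    intro K
    have h2 : FM m (χ.truncSymbol K) x - x = FM m (χ.truncSymbol K - 1) x := by
      rw [FM_sub (χ.memLp_truncSymbol K) hone, FM_one]; rfl
    have hsq : ∀ {H : Type} [NormedAddCommGroup H] [InnerProductSpace ℂ H] (v : H),
        inner ℂ v v = ((‖v‖ ^ 2 : ℝ) : ℂ) := fun v => by
      rw [inner_self_eq_norm_sq_to_K]; simp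
    have h3 := hsq (FM m (χ.truncSymbol K - 1) x)
    rw [← Lp.inner_fourier_eq, L2.inner_def] at h3
    have h4 : ∫ ξ, inner ℂ ((𝓕 (FM m (χ.truncSymbol K - 1) x) : L2 n m) ξ)
        ((𝓕 (FM m (χ.truncSymbol K - 1) x) : L2 n m) ξ) =
        ∫ ξ, ((‖χ.truncSymbol K ξ - 1‖ ^ 2 * ‖(𝓕 x : L2 n m) ξ‖ ^ 2 : ℝ) : ℂ) := by
      refine integral_congr_ae ?_
      filter_upwards [fourier_FM_coeFn (hm K) x] with ξ h5
      rw [h5, hsq, norm_smul, Pi.sub_apply, Pi.one_apply, mul_pow]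
    rw [h4, integral_complex_ofReal] at h3
    rw [h2]
    exact (Complex.ofReal_injective h3).symm
  have hint : Integrable fun ξ => (χ.bound + 1) ^ 2 * ‖(𝓕 x : L2 n m) ξ‖ ^ 2 :=
    (((Lp.memLp (𝓕 x : L2 n m)).integrable_norm_pow two_ne_zero).const_mul _)
  have h2 : Tendsto (fun K => ‖FM m (χ.truncSymbol K) x - x‖ ^ 2) atTop (𝓝 0) := by
    simp_rw [h1]
    have h3 : (0 : ℝ) = ∫ ξ : Rn n, (0 : ℝ) := by simp
    rw [h3]
    refine tendsto_integral_of_dominated_convergence _ (fun K => ?_) hint (fun K => ?_) ?_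
    · exact (((χ.continuous_truncSymbol K).sub
        continuous_const).norm.pow 2).aestronglyMeasurable.mul
        ((Lp.aestronglyMeasurable (𝓕 x : L2 n m)).norm.pow 2)
    · refine Eventually.of_forall fun ξ => ?_
      rw [Real.norm_of_nonneg (by positivity)]
      have h4 : ‖χ.truncSymbol K ξ - 1‖ ≤ χ.bound + 1 := by
        refine (norm_sub_le _ _).trans ?_
        rw [norm_one]; gcongr; exact χ.norm_truncSymbol_le K ξ
      gcongr
    · refine Eventually.of_forall fun ξ => tendsto_const_nhds.congr' ?_
      obtain ⟨K₀, hK₀⟩ := pow_unbounded_of_one_lt ‖ξ‖ one_lt_two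
      filter_upwards [eventually_ge_atTop K₀] with K hK
      rw [χ.truncSymbol_eq_one (hK₀.le.trans (pow_le_pow_right₀ one_le_two hK))]
      simp
  have h3 := h2.sqrt
  simpa [Real.sqrt_sq] using h3

/-- The frequency truncations regularize the Bessel potential of order `-1`. -/
theorem regularization : Regularization (FM m (weight (-1) : Rn n → ℂ))
    (fun K => FM m (χ.truncSymbol K)) (fun K => FM m (χ.truncSymbol K * weight 1)) := by
  have hS : MemLp (weight (-1) : Rn n → ℂ) ∞ volume := memLp_weight (by norm_num)
  have hJ := χ.memLp_truncSymbol
  have hM := fun K => χ.memLp_truncSymbol_mul_weight K 1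
  have hw : (weight 1 * weight (-1) : Rn n → ℂ) = 1 := by
    rw [weight_mul, add_neg_cancel, weight_zero]
  have hone : MemLp (1 : Rn n → ℂ) ∞ volume := memLp_top_const 1
  refine ⟨fun K => ?_, fun K => ?_, fun K => ?_, fun K => ?_, fun K => ?_, fun K x y => ?_,
    χ.tendsto_FM_truncSymbol, ⟨χ.bound, fun K => ?_⟩, ?_⟩
  · rw [FM_comp (hM K) hS, mul_assoc, hw, mul_one]
  · rw [FM_comp hS (hM K), mul_comm, mul_assoc, hw, mul_one]
  · exact FM_comm (hJ K) hS
  · rw [FM_comp (hJ K) (hM (K + 1)), ← mul_assoc, truncSymbol_mul_succ]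
  · rw [FM_comp (hJ _) (hJ K), mul_comm, truncSymbol_mul_succ]
  · rw [inner_FM (hJ K), star_truncSymbol]
  · exact norm_FM_le χ.bound_pos.le (χ.norm_truncSymbol_le K)
  · refine squeeze_zero (fun _ => norm_nonneg _) (fun K => ?_)
      (show Tendsto (fun K : ℕ => (χ.bound + 1) * (2⁻¹ : ℝ) ^ K) atTop (𝓝 0) by
        simpa using (tendsto_pow_atTop_nhds_zero_of_lt_one (by norm_num : (0 : ℝ) ≤ 2⁻¹)
          (by norm_num)).const_mul (χ.bound + 1))
    rw [← FM_one, ← FM_sub (hJ K) hone, FM_comp ((hJ K).sub hone) hS]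
    have hB := χ.bound_pos
    refine norm_FM_le (by positivity) fun ξ => ?_
    rw [Pi.mul_apply, Pi.sub_apply, Pi.one_apply, norm_mul]
    rcases le_total ‖ξ‖ (2 ^ K) with h | h
    · rw [χ.truncSymbol_eq_one h, sub_self, norm_zero, zero_mul]; positivity
    · have h1 : ‖χ.truncSymbol K ξ - 1‖ ≤ χ.bound + 1 := by
        refine (norm_sub_le _ _).trans ?_
        rw [norm_one]; gcongr; exact χ.norm_truncSymbol_le K ξ
      have h2 : ‖weight (-1) ξ‖ ≤ (2⁻¹ : ℝ) ^ K := by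
        rw [inv_pow, ← one_div, le_div_iff₀ (by positivity)]
        exact (mul_le_mul_of_nonneg_left h (norm_nonneg _)).trans (norm_weight_neg_one_mul_le ξ)
      gcongr

/-- The frequency annuli have bounded overlap. -/
theorem sum_norm_sq_FM_le (F : Finset ℤ) (x : L2 n m) :
    ∑ k ∈ F, ‖FM m (χ.annSymbol 16 k) x‖ ^ 2 ≤ 21 * (2 * χ.bound) ^ 2 * ‖x‖ ^ 2 := by
  have hm := χ.memLp_annSymbol 16
  have hm2 : ∀ k, MemLp (χ.annSymbol 16 k * χ.annSymbol 16 k) ∞ volume := fun k => (hm k).mul (hm k)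
  have h1 : ∑ k ∈ F, ‖FM m (χ.annSymbol 16 k) x‖ ^ 2 =
      (inner ℂ x (FM m (∑ k ∈ F, χ.annSymbol 16 k * χ.annSymbol 16 k) x)).re := by
    rw [(FM_sum F hm2).1, sum_apply, inner_sum, Complex.re_sum]
    refine Finset.sum_congr rfl fun k _ => ?_
    have h2 := inner_FM (hm k) x (FM m (χ.annSymbol 16 k) x)
    rw [χ.star_annSymbol, FM_comp_apply (hm k) (hm k)] at h2
    rw [← h2, inner_self_eq_norm_sq_to_K]
    norm_cast
  rw [h1]
  have hB := χ.bound_pos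
  have h2 : ‖FM m (∑ k ∈ F, χ.annSymbol 16 k * χ.annSymbol 16 k)‖ ≤ 21 * (2 * χ.bound) ^ 2 := by
    refine norm_FM_le (by positivity) fun ξ => ?_
    refine le_trans ?_ (χ.sum_annSymbol_sq_le F ξ)
    rw [Finset.sum_apply]
    refine (norm_sum_le _ _).trans (Finset.sum_le_sum fun k _ => ?_)
    rw [Pi.mul_apply, norm_mul, sq]
  refine (Complex.re_le_norm _).trans ((norm_inner_le_norm _ _).trans ?_)
  calc _ ≤ ‖x‖ * (21 * (2 * χ.bound) ^ 2 * ‖x‖) := by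
        gcongr; exact ContinuousLinearMap.le_of_opNorm_le _ h2 x
    _ = _ := by ring

/-- Bessel potentials intertwine the dyadic pieces of different orders. -/
theorem weight_comp_paraTerm {c : Rn n → ℂ} {c₀ : ℝ} (hc : IsFirstOrder c c₀) (τ : ℝ) (k : ℤ)
    (A : Rn n → CVec m →L[ℂ] CVec m) :
    FM m (weight (-1)) ∘L χ.paraTerm (τ + 1) k c A = χ.paraTerm τ k c A ∘L FM m (weight (-1)) := by
  have hS : MemLp (weight (-1) : Rn n → ℂ) ∞ volume := memLp_weight (by norm_num)
  have h1 := memLp_annSymbol_mul_weight χ (c := 4) (by norm_num) (by norm_num) k (τ + 1)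
  have h2 := χ.memLp_annSymbol_mul hc τ k
  have h3 : (weight (-1) : Rn n → ℂ) * (χ.annSymbol 4 k * weight (τ + 1)) =
      χ.annSymbol 4 k * weight τ := by
    rw [mul_left_comm, weight_mul]; congr 2; ring
  have h4 : χ.annSymbol 1 k * (c * weight (-τ - 1)) * weight (-1) =
      χ.annSymbol 1 k * (c * weight (-(τ + 1) - 1)) := by
    rw [mul_assoc, mul_assoc, weight_mul]; congr 3; ring
  rw [paraTerm, paraTerm, ← ContinuousLinearMap.comp_assoc, FM_comp hS h1, h3,
    ContinuousLinearMap.comp_assoc, ContinuousLinearMap.comp_assoc, FM_comp h2 hS, h4]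

end LPCutoff

/-! ### The paradifferential operator at a fixed time -/

namespace ParaQuantization

variable (Q : ParaQuantization n)

open Classical in
/-- The piece at frequency `2 ^ k` of the paradifferential operator with coefficients `A j` and
zeroth order coefficient `Z`, conjugated to an operator on `L²` by Bessel potentials of order `τ`
and `τ + 1`. -/
def rhsTerm (A : Fin n → Rn n → Matrix (Fin m) (Fin m) ℝ) (Z : Rn n → Matrix (Fin m) (Fin m) ℝ)
    (τ : ℝ) (k : ℤ) : L2 n m →L[ℂ] L2 n m :=
  if Q.lowest < (k : WithBot ℤ) then
    ∑ j, Q.cutoff.paraTerm τ k (derivSymbol j) (Q.cutoff.lowPassMat (k - Q.gap) (A j)) +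
      Q.cutoff.paraTerm τ k 1 (Q.cutoff.lowPassMat (k - Q.gap) Z)
  else 0

open Classical in
/-- The paradifferential operator with coefficients `A j` and `Z`, conjugated to an operator on `L²`
by Bessel potentials of order `τ` and `τ + 1`. -/
def rhsOp (A : Fin n → Rn n → Matrix (Fin m) (Fin m) ℝ) (Z : Rn n → Matrix (Fin m) (Fin m) ℝ)
    (τ : ℝ) : L2 n m →L[ℂ] L2 n m :=
  if h : ∃ Γ : L2 n m →L[ℂ] L2 n m, ∀ x, HasSum (fun k => Q.rhsTerm A Z τ k x) (Γ x) then
    h.choose else 0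

/-- A bound for the pieces of the paradifferential operator, relative to their coefficients. -/
def termBound (Q : ParaQuantization n) (m : ℕ) (τ : ℝ) : ℝ :=
  (2 * Q.cutoff.bound * 256 ^ |τ / 2|) ^ 2 * (2 * Real.pi * n + 1) *
    (Q.cutoff.lowBound * unitBound m)

theorem termBound_nonneg (m : ℕ) (τ : ℝ) : 0 ≤ Q.termBound m τ := by
  have h1 := Q.cutoff.lowBound_nonneg
  have h2 := unitBound_nonneg m
  have h3 := Real.pi_pos
  unfold termBound; positivity

variable {A : Fin n → Rn n → Matrix (Fin m) (Fin m) ℝ} {Z : Rn n → Matrix (Fin m) (Fin m) ℝ}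
  {a z : ℝ}

theorem norm_rhsTerm_le (hA : ∀ j, IsCoeff (A j) a) (ha : 0 ≤ a) (hZ : IsCoeff Z z) (τ : ℝ)
    (k : ℤ) : ‖Q.rhsTerm A Z τ k‖ ≤ Q.termBound m τ * (a + z) := by
  have hz := hZ.nonneg
  have h1 := Q.cutoff.lowBound_nonneg
  have h2 := unitBound_nonneg m
  have h3 := Real.pi_pos
  rw [rhsTerm]
  split_ifs
  · set B := (2 * Q.cutoff.bound * 256 ^ |τ / 2|) ^ 2
    set l := Q.cutoff.lowBound * unitBound m
    have h4 : ∀ j, ‖Q.cutoff.paraTerm τ k (derivSymbol j)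
        (Q.cutoff.lowPassMat (k - Q.gap) (A j))‖ ≤ B * (2 * Real.pi) * (l * a) := fun j =>
      Q.cutoff.norm_paraTerm_le (isFirstOrder_derivSymbol j) τ k (by positivity)
        (Q.cutoff.norm_lowPassMat_le (hA j) _)
    have h5 : ‖Q.cutoff.paraTerm τ k 1 (Q.cutoff.lowPassMat (k - Q.gap) Z)‖ ≤ B * 1 * (l * z) :=
      Q.cutoff.norm_paraTerm_le isFirstOrder_one τ k (by positivity)
        (Q.cutoff.norm_lowPassMat_le hZ _)
    have h6 := (norm_sum_le Finset.univ (fun j => Q.cutoff.paraTerm τ k (derivSymbol j)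
        (Q.cutoff.lowPassMat (k - Q.gap) (A j)))).trans (Finset.sum_le_sum fun j _ => h4 j)
    rw [Finset.sum_const, Finset.card_univ, Fintype.card_fin, nsmul_eq_mul] at h6
    refine (norm_add_le _ _).trans ((add_le_add h6 h5).trans ?_)
    have h7 : Q.termBound m τ = B * (2 * Real.pi * n + 1) * l := rfl
    rw [h7]
    have h8 : 0 ≤ B * l * (a + 2 * Real.pi * n * z) := by positivity
    nlinarith
  · rw [norm_zero]
    have := Q.termBound_nonneg m τ
    positivity

theorem FM_rhsTerm_FM (τ : ℝ) (k : ℤ) (x : L2 n m) :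
    FM m (Q.cutoff.annSymbol 16 k) (Q.rhsTerm A Z τ k (FM m (Q.cutoff.annSymbol 16 k) x)) =
      Q.rhsTerm A Z τ k x := by
  rw [rhsTerm]
  split_ifs
  · simp only [add_apply, sum_apply, map_add, map_sum]
    congr 1
    · refine Finset.sum_congr rfl fun j _ => ?_
      exact Q.cutoff.FM_paraTerm_FM (isFirstOrder_derivSymbol j) τ k x
    · exact Q.cutoff.FM_paraTerm_FM isFirstOrder_one τ k x
  · simp

/-- The dyadic pieces sum strongly to a bounded operator, with norm controlled by the size of the
coefficients alone. In particular `rhsOp` does not take its default value. -/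
theorem hasSum_rhsOp_and_norm_le (hA : ∀ j, IsCoeff (A j) a) (ha : 0 ≤ a) (hZ : IsCoeff Z z)
    (τ : ℝ) : (∀ x, HasSum (fun k => Q.rhsTerm A Z τ k x) (Q.rhsOp A Z τ x)) ∧
      ‖Q.rhsOp A Z τ‖ ≤ Q.termBound m τ * (a + z) * (21 * (2 * Q.cutoff.bound) ^ 2) := by
  have hB := Q.cutoff.bound_pos
  obtain ⟨Γ, hΓ, hΓ'⟩ := exists_hasSum_localized (ψ := fun k => FM m (Q.cutoff.annSymbol 16 k))
    (T := Q.rhsTerm A Z τ) (N := 21 * (2 * Q.cutoff.bound) ^ 2) (by positivity)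
    (fun k x y => by rw [inner_FM (Q.cutoff.memLp_annSymbol 16 k), Q.cutoff.star_annSymbol])
    Q.cutoff.sum_norm_sq_FM_le (Q.FM_rhsTerm_FM τ) (Q.norm_rhsTerm_le hA ha hZ τ)
  have h : ∃ Γ : L2 n m →L[ℂ] L2 n m, ∀ x, HasSum (fun k => Q.rhsTerm A Z τ k x) (Γ x) := ⟨Γ, hΓ⟩
  have h1 : ∀ x, HasSum (fun k => Q.rhsTerm A Z τ k x) (Q.rhsOp A Z τ x) := by
    rw [rhsOp, dif_pos h]; exact h.choose_spec
  refine ⟨h1, ?_⟩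
  rwa [show Q.rhsOp A Z τ = Γ from ContinuousLinearMap.ext fun x => (h1 x).unique (hΓ x)]

/-- Bessel potentials intertwine the conjugated operators of different orders, which represent the
same operator on tempered distributions. -/
theorem weight_comp_rhsOp (hA : ∀ j, IsCoeff (A j) a) (ha : 0 ≤ a) (hZ : IsCoeff Z z) (τ : ℝ) :
    FM m (weight (-1)) ∘L Q.rhsOp A Z (τ + 1) = Q.rhsOp A Z τ ∘L FM m (weight (-1)) := by
  ext1 x
  have h1 := (FM m (weight (-1))).hasSum ((Q.hasSum_rhsOp_and_norm_le hA ha hZ (τ + 1)).1 x)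
  have h2 := (Q.hasSum_rhsOp_and_norm_le hA ha hZ τ).1 (FM m (weight (-1)) x)
  suffices h : (fun k => FM m (weight (-1)) (Q.rhsTerm A Z (τ + 1) k x)) =
      fun k => Q.rhsTerm A Z τ k (FM m (weight (-1)) x) by
    rw [h] at h1; exact h1.unique h2
  ext1 k
  simp only [rhsTerm]
  split_ifs
  · simp only [add_apply, sum_apply, map_add, map_sum]
    congr 1
    · refine Finset.sum_congr rfl fun j _ => ?_
      exact congrArg (fun T : L2 n m →L[ℂ] L2 n m => T x)
        (Q.cutoff.weight_comp_paraTerm (isFirstOrder_derivSymbol j) τ k _)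
    · exact congrArg (fun T : L2 n m →L[ℂ] L2 n m => T x)
        (Q.cutoff.weight_comp_paraTerm isFirstOrder_one τ k _)
  · simp

/-- The energy estimate for the paradifferential operator: only the Lipschitz constants of the
coefficients `A j` and the size of `Z` enter. -/
theorem exists_energy_bound (m : ℕ) (τ : ℝ) : ∃ C, 0 ≤ C ∧
    ∀ (A : Fin n → Rn n → Matrix (Fin m) (Fin m) ℝ) (Z : Rn n → Matrix (Fin m) (Fin m) ℝ)
      (a z L : ℝ), (∀ j, IsCoeff (A j) a) → 0 ≤ a → IsCoeff Z z → 0 ≤ L →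
      (∀ j x, (A j x).IsSymm) →
      (∀ j i l, ∃ g : Rn n → ℝ, (fun x => A j x i l) =ᵐ[volume] g ∧
        ∀ x y, ‖g x - g y‖ ≤ L * ‖x - y‖) →
      ∀ (K : ℕ) (x : L2 n m), |(inner ℂ (FM m (Q.cutoff.truncSymbol K * weight 1)
        (Q.rhsOp A Z τ x)) (FM m (Q.cutoff.truncSymbol K) x)).re| ≤ C * (L + z) * ‖x‖ ^ 2 := by
  obtain ⟨C₁, hC₁, h₁⟩ := Q.cutoff.exists_energy_bound_deriv (m := m) τ
  obtain ⟨C₂, hC₂, h₂⟩ := Q.cutoff.exists_energy_bound_one (m := m) τ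
  have hl := Q.cutoff.lowBound_nonneg
  have hu := unitBound_nonneg m
  have hB := Q.cutoff.bound_pos
  set l := Q.cutoff.lowBound * unitBound m with hl'
  have hl0 : 0 ≤ l := by positivity
  refine ⟨(n * C₁ + C₂) * l * (21 * (2 * Q.cutoff.bound) ^ 2), by positivity,
    fun A Z a z L hA ha hZ hL hs hLip K x => ?_⟩
  have hz := hZ.nonneg
  have h3 := abs_re_inner_le_of_hasSum (M := FM m (Q.cutoff.truncSymbol K * weight 1))
    (J := FM m (Q.cutoff.truncSymbol K)) Q.cutoff.sum_norm_sq_FM_le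
    ((Q.hasSum_rhsOp_and_norm_le hA ha hZ τ).1 x)
    (b := (n * C₁ + C₂) * l * (L + z)) (by positivity) (fun k => ?_)
  · refine h3.trans (le_of_eq (by ring))
  rw [rhsTerm]
  split_ifs
  · rw [add_apply, sum_apply, map_add, map_sum, inner_add_left, sum_inner, Complex.add_re,
      Complex.re_sum]
    have h4 : ∀ j, |(inner ℂ (FM m (Q.cutoff.truncSymbol K * weight 1)
        (Q.cutoff.paraTerm τ k (derivSymbol j) (Q.cutoff.lowPassMat (k - Q.gap) (A j)) x))
        (FM m (Q.cutoff.truncSymbol K) x)).re| ≤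
        C₁ * (l * L) * ‖FM m (Q.cutoff.annSymbol 16 k) x‖ ^ 2 := fun j =>
      h₁ j K k _ (l * L) (by positivity) (Q.cutoff.memLp_lowPassMat (hA j) _)
        (Q.cutoff.inner_lowPassMat (hs j) _)
        (Q.cutoff.norm_lowPassMat_sub_le (hA j) hL (hLip j) _) x
    have h5 := h₂ K k _ (l * z) (by positivity) (Q.cutoff.norm_lowPassMat_le hZ (k - Q.gap)) x
    have h6 := (Finset.abs_sum_le_sum_abs (fun j => (inner ℂ
        (FM m (Q.cutoff.truncSymbol K * weight 1) (Q.cutoff.paraTerm τ k (derivSymbol j)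
          (Q.cutoff.lowPassMat (k - Q.gap) (A j)) x))
        (FM m (Q.cutoff.truncSymbol K) x)).re) Finset.univ).trans
        (Finset.sum_le_sum fun j _ => h4 j)
    rw [Finset.sum_const, Finset.card_univ, Fintype.card_fin, nsmul_eq_mul] at h6
    refine (abs_add_le _ _).trans ((add_le_add h6 h5).trans ?_)
    have h7 : 0 ≤ l * (n * C₁ * z + C₂ * L) * ‖FM m (Q.cutoff.annSymbol 16 k) x‖ ^ 2 := by
      positivity
    linarith
  · rw [zero_apply, map_zero, inner_zero_left, Complex.zero_re, abs_zero]
    positivity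

end ParaQuantization

end

noncomputable section

variable {n m : ℕ}

/-! ### Lipschitz bounds from bounds of the weak gradient -/

/-- A bounded function whose weak gradient is bounded by `B` is Lipschitz continuous with constant
`B` on a set of full measure, as the almost everywhere limit of its mollifications. -/
theorem exists_lipschitz_of_weakGradient {w : Rn n → ℝ} {G : Rn n → (Rn n →L[ℝ] ℝ)} {A B : ℝ}
    (hw : AEStronglyMeasurable w volume) (hA : ∀ᵐ x, ‖w x‖ ≤ A) (hB0 : 0 ≤ B)
    (hB : ∀ᵐ x, ‖G x‖ ≤ B)
    (h : ∀ φ : Rn n → ℝ, ContDiff ℝ ∞ φ → HasCompactSupport φ → ∀ v : Rn n,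
      ∫ x, fderiv ℝ φ x v * w x = -∫ x, φ x * G x v) :
    ∃ E : Set (Rn n), (∀ᵐ x, x ∈ E) ∧ ∀ x ∈ E, ∀ y ∈ E, ‖w x - w y‖ ≤ B * ‖x - y‖ := by
  let φ : ℕ → ContDiffBump (0 : Rn n) := fun i =>
    { rIn := 1 / ((i : ℝ) + 1)
      rOut := 2 * (1 / ((i : ℝ) + 1))
      rIn_pos := by positivity
      rIn_lt_rOut := by
        have : 0 < 1 / ((i : ℝ) + 1) := by positivity
        linarith }
  have hφ0 : Tendsto (fun i => (φ i).rOut) atTop (𝓝 0) := by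
    have h := (tendsto_one_div_add_atTop_nhds_zero_nat (𝕜 := ℝ)).const_mul 2
    rwa [mul_zero] at h
  have hloc : LocallyIntegrable w volume := by
    refine (memLp_top_of_bound hw A hA).locallyIntegrable le_top
  have hlim := ContDiffBump.ae_convolution_tendsto_right_of_locallyIntegrable (K := 2) hφ0
    (Eventually.of_forall fun i => le_rfl) hloc
  refine ⟨_, hlim, fun x hx y hy => ?_⟩
  refine le_of_tendsto (Tendsto.norm (Tendsto.sub hx hy)) (Eventually.of_forall fun i => ?_)
  set ρ : Rn n → ℝ := (φ i).normed volume with hρ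
  have hρs : ContDiff ℝ ∞ ρ := (φ i).contDiff_normed (n := ⊤)
  have hρc : HasCompactSupport ρ := (φ i).hasCompactSupport_normed
  set K : 𝓢(Rn n, ℝ) := hρc.toSchwartzMap hρs with hK
  have hKρ : ∀ z, K z = ρ z := fun z => rfl
  have hconv : ∀ x, convolution ρ w (ContinuousLinearMap.lsmul ℝ ℝ) volume x =
      ∫ t, w t • K (x - t) := by
    intro x
    rw [← integral_sub_left_eq_self _ volume x]
    simp only [convolution, ContinuousLinearMap.lsmul_apply, smul_eq_mul, sub_sub_cancel, hKρ]
    congr 1; ext t; ring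
  rw [hconv, hconv]
  refine Convex.norm_image_sub_le_of_norm_hasFDerivWithin_le (𝕜 := ℝ) (s := univ)
    (fun z _ => (K.hasFDerivAt_convolution hw hA z).hasFDerivWithinAt) (fun z _ => ?_)
    convex_univ (mem_univ _) (mem_univ _)
  refine ContinuousLinearMap.opNorm_le_bound _ hB0 fun v => ?_
  rw [ContinuousLinearMap.integral_apply
    ((SchwartzMap.fderivCLM ℝ (Rn n) ℝ K).integrable_smul_translate hw hA z)]
  -- the weak gradient is tested with the reflected translate of the mollifier
  have h1 : ∀ t, fderiv ℝ (fun t => ρ (z - t)) t v = -(fderiv ℝ ρ (z - t) v) := by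
    intro t
    have h2 : HasFDerivAt ρ (fderiv ℝ ρ (z - t)) (z - t) :=
      (hρs.differentiable (by simp) _).hasFDerivAt
    have h3 := h2.comp t ((hasFDerivAt_id t).const_sub z)
    have h4 : fderiv ℝ (fun t => ρ (z - t)) t = _ := h3.fderiv
    rw [h4]
    simp
  have h2 := h (fun t => ρ (z - t)) (hρs.comp (by fun_prop))
    (hρc.comp_homeomorph (Homeomorph.subLeft z)) v
  simp only [h1, neg_mul, integral_neg, neg_inj] at h2
  have h3 : ∫ t, (w t • SchwartzMap.fderivCLM ℝ (Rn n) ℝ K (z - t)) v =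
      ∫ t, ρ (z - t) * G t v := by
    rw [← h2]
    congr 1; ext t
    rw [SchwartzMap.fderivCLM_apply, smul_apply, smul_eq_mul, mul_comm]
    rfl
  rw [h3]
  have h4 : ∫ t, ρ (z - t) = 1 := by
    rw [integral_sub_left_eq_self ρ volume z]; exact (φ i).integral_normed
  calc ‖∫ t, ρ (z - t) * G t v‖ ≤ ∫ t, ρ (z - t) * (B * ‖v‖) := by
        refine norm_integral_le_of_norm_le ?_ ?_
        · exact ((K.integrable.comp_sub_left z).mul_const _)
        · filter_upwards [hB] with t ht
          rw [norm_mul, Real.norm_of_nonneg ((φ i).nonneg_normed _)]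
          gcongr
          · exact (φ i).nonneg_normed _
          · exact (G t).le_of_opNorm_le ht v
    _ = B * ‖v‖ := by rw [integral_mul_const, h4, one_mul]

/-- The background state at a fixed time: bounded by `A`, with weak gradient bounded by `B`. -/
structure IsBackgroundSlice (A B : ℝ) (U : Rn n → RVec m) (DU : Rn n → (Rn n →L[ℝ] RVec m)) :
    Prop where
  measurable_U : AEStronglyMeasurable U volume
  measurable_DU : AEStronglyMeasurable DU volume
  bounded : ∀ᵐ x, ‖U x‖ ≤ A
  bounded_DU : ∀ᵐ x, ‖DU x‖ ≤ B
  nonneg : 0 ≤ B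
  gradient : HasWeakGradient U DU

theorem EuclideanSpace.norm_le_sum_abs (v : RVec m) : ‖v‖ ≤ ∑ c, |v c| := by
  have h := (EuclideanSpace.basisFun (Fin m) ℝ).sum_repr v
  conv_lhs => rw [← h]
  refine (norm_sum_le _ _).trans (Finset.sum_le_sum fun c _ => ?_)
  rw [norm_smul, OrthonormalBasis.norm_eq_one, mul_one]
  simp

namespace IsBackgroundSlice

variable {A B : ℝ} {U : Rn n → RVec m} {DU : Rn n → (Rn n →L[ℝ] RVec m)}

theorem integrable_smul {E : Type*} [NormedAddCommGroup E] [NormedSpace ℝ E] {φ : Rn n → ℝ}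
    (hφ : Continuous φ) (hφc : HasCompactSupport φ) {f : Rn n → E} {C : ℝ}
    (hf : AEStronglyMeasurable f volume) (hC : ∀ᵐ x, ‖f x‖ ≤ C) :
    Integrable fun x => φ x • f x := by
  have h1 : Integrable φ := hφ.integrable_of_hasCompactSupport hφc
  exact h1.smul_bdd C hf hC

/-- The background state is Lipschitz continuous on a set of full measure. -/
theorem exists_lipschitz (h : IsBackgroundSlice A B U DU) :
    ∃ E : Set (Rn n), (∀ᵐ x, x ∈ E) ∧ ∀ x ∈ E, ∀ y ∈ E, ‖U x - U y‖ ≤ m * B * ‖x - y‖ := by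
  have h1 : ∀ c : Fin m, ∃ E : Set (Rn n), (∀ᵐ x, x ∈ E) ∧
      ∀ x ∈ E, ∀ y ∈ E, ‖U x c - U y c‖ ≤ B * ‖x - y‖ := by
    intro c
    have hp : ∀ v : RVec m, ‖v c‖ ≤ ‖v‖ := fun v => PiLp.norm_apply_le v c
    refine exists_lipschitz_of_weakGradient
      (G := fun x => (EuclideanSpace.proj c : RVec m →L[ℝ] ℝ) ∘L DU x) (A := A)
      ((EuclideanSpace.proj c : RVec m →L[ℝ] ℝ).continuous.comp_aestronglyMeasurable
        h.measurable_U) ?_ h.nonneg ?_ fun φ hφ hφc v => ?_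
    · filter_upwards [h.bounded] with x hx using (hp _).trans hx
    · filter_upwards [h.bounded_DU] with x hx
      refine ContinuousLinearMap.opNorm_le_bound _ h.nonneg fun v => ?_
      exact (hp _).trans ((DU x).le_of_opNorm_le hx v)
    · have h2 := congrArg (EuclideanSpace.proj c : RVec m →L[ℝ] ℝ) (h.gradient φ hφ hφc v)
      have hd : Continuous fun x => fderiv ℝ φ x v :=
        (hφ.continuous_fderiv (by simp)).clm_apply continuous_const
      have hdc : HasCompactSupport fun x => fderiv ℝ φ x v := hφc.fderiv_apply (𝕜 := ℝ) v
      rw [map_neg, ← ContinuousLinearMap.integral_comp_comm _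
        (integrable_smul hd hdc h.measurable_U h.bounded),
        ← ContinuousLinearMap.integral_comp_comm] at h2
      · exact h2
      · refine integrable_smul (C := B * ‖v‖) hφ.continuous hφc
          (h.measurable_DU.apply_continuousLinearMap v) ?_
        filter_upwards [h.bounded_DU] with x hx using (DU x).le_of_opNorm_le hx v
  choose E hE hE' using h1
  refine ⟨⋂ c, E c, by simpa [mem_iInter, ae_all_iff] using hE, fun x hx y hy => ?_⟩
  rw [mem_iInter] at hx hy
  refine (EuclideanSpace.norm_le_sum_abs _).trans ?_
  calc ∑ c, |(U x - U y) c| ≤ ∑ _c : Fin m, B * ‖x - y‖ :=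
        Finset.sum_le_sum fun c _ => hE' c x (hx c) y (hy c)
    _ = _ := by simp [mul_assoc]

end IsBackgroundSlice

/-! ### The coefficients of the paradifferential equation -/

section Coefficients

variable {𝒜 : Fin n → RVec m → Matrix (Fin m) (Fin m) ℝ}

/-- The coefficients and their derivatives are bounded on the ball of radius `A`. This bound is the
only way in which `𝒜` enters the constant of the energy estimate. -/
theorem exists_bound_coefficients (h : ∀ j a b, ContDiff ℝ ∞ (fun V => 𝒜 j V a b)) (A : ℝ) :
    ∃ K, 0 ≤ K ∧ ∀ j a b V, ‖V‖ ≤ A →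
      ‖𝒜 j V a b‖ ≤ K ∧ ‖fderiv ℝ (fun V => 𝒜 j V a b) V‖ ≤ K := by
  have h1 : ∀ j a b, ∃ K, ∀ V ∈ Metric.closedBall (0 : RVec m) A,
      ‖𝒜 j V a b‖ + ‖fderiv ℝ (fun V => 𝒜 j V a b) V‖ ≤ K := by
    intro j a b
    have hc : Continuous fun V => ‖𝒜 j V a b‖ + ‖fderiv ℝ (fun V => 𝒜 j V a b) V‖ :=
      (h j a b).continuous.norm.add ((h j a b).continuous_fderiv (by simp)).norm
    obtain ⟨K, hK⟩ := (isCompact_closedBall (0 : RVec m) A).exists_bound_of_continuousOn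
      hc.continuousOn
    exact ⟨K, fun V hV => (Real.le_norm_self _).trans (hK V hV)⟩
  choose K hK using h1
  refine ⟨∑ j, ∑ a, ∑ b, |K j a b|, by positivity, fun j a b V hV => ?_⟩
  have h2 := hK j a b V (by simpa using hV)
  have h3 : K j a b ≤ ∑ j, ∑ a, ∑ b, |K j a b| :=
    (le_abs_self _).trans ((Finset.single_le_sum (f := fun b => |K j a b|)
      (fun _ _ => abs_nonneg _) (Finset.mem_univ b)).trans
      ((Finset.single_le_sum (f := fun a => ∑ b, |K j a b|)
        (fun _ _ => Finset.sum_nonneg fun _ _ => abs_nonneg _) (Finset.mem_univ a)).trans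
        (Finset.single_le_sum (f := fun j => ∑ a, ∑ b, |K j a b|)
          (fun _ _ => Finset.sum_nonneg fun _ _ => Finset.sum_nonneg fun _ _ => abs_nonneg _)
          (Finset.mem_univ j))))
  constructor
  · linarith [norm_nonneg (fderiv ℝ (fun V => 𝒜 j V a b) V)]
  · linarith [norm_nonneg (𝒜 j V a b)]

variable {A B K : ℝ} {U : Rn n → RVec m} {DU : Rn n → (Rn n →L[ℝ] RVec m)}

theorem IsBackgroundSlice.isCoeff (hU : IsBackgroundSlice A B U DU)
    (h : ∀ j a b, ContDiff ℝ ∞ (fun V => 𝒜 j V a b)) (hK0 : 0 ≤ K)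
    (hK : ∀ j a b V, ‖V‖ ≤ A → ‖𝒜 j V a b‖ ≤ K ∧ ‖fderiv ℝ (fun V => 𝒜 j V a b) V‖ ≤ K)
    (j : Fin n) : IsCoeff (fun x => 𝒜 j (U x)) K where
  measurable a b := (h j a b).continuous.comp_aestronglyMeasurable hU.measurable_U
  bounded a b := by filter_upwards [hU.bounded] with x hx using (hK j a b _ hx).1
  nonneg := hK0

theorem continuous_zerothOrderCoeff (h : ∀ j a b, ContDiff ℝ ∞ (fun V => 𝒜 j V a b))
    (a b : Fin m) : Continuous fun p : RVec m × (Rn n →L[ℝ] RVec m) =>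
      zerothOrderCoeff 𝒜 p.1 p.2 a b := by
  unfold zerothOrderCoeff
  refine continuous_finsetSum _ fun j _ => continuous_finsetSum _ fun c _ => Continuous.mul ?_ ?_
  · exact (((h j a c).continuous_fderiv (by simp)).comp continuous_fst).clm_apply continuous_const
  · exact (EuclideanSpace.proj c : RVec m →L[ℝ] ℝ).continuous.comp
      (continuous_snd.clm_apply continuous_const)

theorem norm_zerothOrderCoeff_le (hK0 : 0 ≤ K)
    (hK : ∀ j a b V, ‖V‖ ≤ A → ‖𝒜 j V a b‖ ≤ K ∧ ‖fderiv ℝ (fun V => 𝒜 j V a b) V‖ ≤ K)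
    {V : RVec m} (hV : ‖V‖ ≤ A) {G : Rn n →L[ℝ] RVec m} (hG : ‖G‖ ≤ B) (a b : Fin m) :
    ‖zerothOrderCoeff 𝒜 V G a b‖ ≤ n * m * K * B := by
  have h0 : ∀ j c, ‖fderiv ℝ (fun V => 𝒜 j V a c) V (EuclideanSpace.single b 1) *
      G (EuclideanSpace.single j 1) c‖ ≤ K * B := by
    intro j c
    have h1 := ContinuousLinearMap.le_of_opNorm_le _ (hK j a c V hV).2
      (EuclideanSpace.single b (1 : ℝ))
    have h2 := (PiLp.norm_apply_le (G (EuclideanSpace.single j 1)) c).trans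
      (ContinuousLinearMap.le_of_opNorm_le _ hG (EuclideanSpace.single j (1 : ℝ)))
    rw [PiLp.norm_single, norm_one, mul_one] at h1
    rw [PiLp.norm_single, norm_one, mul_one] at h2
    rw [norm_mul]
    exact mul_le_mul h1 h2 (norm_nonneg _) hK0
  calc ‖zerothOrderCoeff 𝒜 V G a b‖ ≤ ∑ _j : Fin n, ∑ _c : Fin m, K * B :=
        (norm_sum_le _ _).trans (Finset.sum_le_sum fun j _ =>
          (norm_sum_le _ _).trans (Finset.sum_le_sum fun c _ => h0 j c))
    _ = _ := by
        simp only [Finset.sum_const, Finset.card_univ, Fintype.card_fin, nsmul_eq_mul]; ring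

theorem IsBackgroundSlice.isCoeff_zerothOrder (hU : IsBackgroundSlice A B U DU)
    (h : ∀ j a b, ContDiff ℝ ∞ (fun V => 𝒜 j V a b)) (hK0 : 0 ≤ K)
    (hK : ∀ j a b V, ‖V‖ ≤ A → ‖𝒜 j V a b‖ ≤ K ∧ ‖fderiv ℝ (fun V => 𝒜 j V a b) V‖ ≤ K) :
    IsCoeff (fun x => zerothOrderCoeff 𝒜 (U x) (DU x)) (n * m * K * B) := by
  refine ⟨fun a b => ?_, fun a b => ?_, ?_⟩
  · have h1 : AEStronglyMeasurable (fun x => (U x, DU x)) volume :=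
      hU.measurable_U.prodMk hU.measurable_DU
    have h2 := (continuous_zerothOrderCoeff h a b).comp_aestronglyMeasurable h1
    exact h2
  · filter_upwards [hU.bounded, hU.bounded_DU] with x hx hx'
    exact norm_zerothOrderCoeff_le hK0 hK hx hx' a b
  · have := hU.nonneg
    positivity

/-- The coefficients `𝒜 j (U x)` agree almost everywhere with functions whose Lipschitz constants
are proportional to the bound `B` of the gradient. -/
theorem IsBackgroundSlice.exists_lipschitz_coeff (hU : IsBackgroundSlice A B U DU)
    (h : ∀ j a b, ContDiff ℝ ∞ (fun V => 𝒜 j V a b)) (hK0 : 0 ≤ K)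
    (hK : ∀ j a b V, ‖V‖ ≤ A → ‖𝒜 j V a b‖ ≤ K ∧ ‖fderiv ℝ (fun V => 𝒜 j V a b) V‖ ≤ K)
    (j : Fin n) (a b : Fin m) : ∃ g : Rn n → ℝ, (fun x => 𝒜 j (U x) a b) =ᵐ[volume] g ∧
      ∀ x y, ‖g x - g y‖ ≤ K * (m * B) * ‖x - y‖ := by
  obtain ⟨E, hE, hE'⟩ := hU.exists_lipschitz
  have hB := hU.nonneg
  have h1 : LipschitzOnWith (K * (m * B)).toNNReal (fun x => 𝒜 j (U x) a b)
      (E ∩ {x | ‖U x‖ ≤ A}) := by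
    refine LipschitzOnWith.of_dist_le_mul fun x hx y hy => ?_
    rw [Real.coe_toNNReal _ (by positivity), dist_eq_norm, dist_eq_norm]
    have h2 := Convex.norm_image_sub_le_of_norm_hasFDerivWithin_le (𝕜 := ℝ)
      (f := fun V => 𝒜 j V a b) (s := Metric.closedBall (0 : RVec m) A) (x := U y) (y := U x)
      (fun V _ => ((h j a b).differentiable (by simp) V).hasFDerivAt.hasFDerivWithinAt)
      (fun V hV => (hK j a b V (by simpa using hV)).2) (convex_closedBall _ _)
      (by simpa using hy.2) (by simpa using hx.2)
    refine h2.trans ?_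
    rw [mul_assoc]
    gcongr
    exact hE' x hx.1 y hy.1
  obtain ⟨g, hg, hg'⟩ := h1.extend_real
  refine ⟨g, ?_, fun x y => ?_⟩
  · filter_upwards [hE, hU.bounded] with x hx hx' using hg' ⟨hx, hx'⟩
  · have h2 := hg.dist_le_mul x y
    rwa [Real.coe_toNNReal _ (by positivity), dist_eq_norm, dist_eq_norm] at h2

end Coefficients

end

noncomputable section

variable {n m : ℕ}

/-! ### Measurable dependence on time -/

section Measurability

variable {α : Type*} [MeasurableSpace α] {ν : Measure α}

theorem aemeasurable_eLpNorm_top_slice {E : Type*} [NormedAddCommGroup E] {f : α → Rn n → E}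
    (hf : AEStronglyMeasurable (Function.uncurry f) (ν.prod volume)) :
    AEMeasurable (fun s => eLpNorm (f s) ∞ (volume : Measure (Rn n))) ν := by
  obtain ⟨g, hg, hfg⟩ := hf
  refine ⟨fun s => eLpNorm (fun x => g (s, x)) ∞ (volume : Measure (Rn n)), ?_, ?_⟩
  · refine measurable_of_Iic fun c => ?_
    have h1 : (fun s => eLpNorm (fun x => g (s, x)) ∞ (volume : Measure (Rn n))) ⁻¹' Iic c =
        {s | volume (Prod.mk s ⁻¹' {p : α × Rn n | c < ‖g p‖ₑ}) = 0} := by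
      ext s
      simp only [mem_preimage, mem_Iic, mem_ofPred_eq, eLpNorm_exponent_top]
      constructor
      · intro h
        have h2 : ∀ᵐ x : Rn n, ‖g (s, x)‖ₑ ≤ c := by
          filter_upwards [enorm_ae_le_eLpNormEssSup (fun x => g (s, x)) volume] with x hx
            using hx.trans h
        simpa [ae_iff] using h2
      · intro h
        refine essSup_le_of_ae_le _ ?_
        have h2 : ∀ᵐ x : Rn n, ‖g (s, x)‖ₑ ≤ c := by simpa [ae_iff] using h
        exact h2
    rw [h1]
    have h2 : MeasurableSet {p : α × Rn n | c < ‖g p‖ₑ} :=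
      measurableSet_lt measurable_const hg.enorm
    exact measurable_measure_prodMk_left h2 (measurableSet_singleton 0)
  · filter_upwards [Measure.ae_ae_of_ae_prod hfg] with s hs
    exact eLpNorm_congr_ae hs

theorem LPCutoff.stronglyMeasurable_lowPass (χ : LPCutoff n) (j : ℤ) {f : α × Rn n → ℝ}
    (hf : StronglyMeasurable f) :
    StronglyMeasurable fun p : α × Rn n => χ.lowPass j (fun y => f (p.1, y)) p.2 := by
  simp_rw [χ.lowPass_eq]
  have h1 : StronglyMeasurable fun q : (α × Rn n) × Rn n =>
      f (q.1.1, q.2) • χ.lowKernel j (q.1.2 - q.2) := by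
    have h2 : StronglyMeasurable fun q : (α × Rn n) × Rn n => f (q.1.1, q.2) :=
      hf.comp_measurable (by fun_prop)
    have h3 : StronglyMeasurable fun q : (α × Rn n) × Rn n => χ.lowKernel j (q.1.2 - q.2) :=
      (χ.lowKernel j).continuous.stronglyMeasurable.comp_measurable (by fun_prop)
    exact h2.smul h3
  exact h1.integral_prod_right'

/-- Multiplication by the low-frequency part is a strongly measurable family of operators. By
separability of `L²` it suffices to test with inner products, which are measurable by Fubini's
theorem. -/
theorem LPCutoff.aestronglyMeasurable_mulOp_lowPass (χ : LPCutoff n) (j : ℤ) {f : α → Rn n → ℝ}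
    (hf : AEStronglyMeasurable (Function.uncurry f) (ν.prod volume))
    (hb : ∀ᵐ s ∂ν, ∃ a, ∀ᵐ x, ‖f s x‖ ≤ a) (h : L2 n m) :
    AEStronglyMeasurable (fun s => mulOp (scalarMat m (χ.lowPass j (f s))) h) ν := by
  have : Fact ((2 : ℝ≥0∞) ≠ ⊤) := ⟨by simp⟩
  refine aestronglyMeasurable_of_inner fun g => ?_
  obtain ⟨f', hf', hff'⟩ := hf
  refine ⟨fun s => ∫ x, inner ℂ (g x) (χ.lowPass j (fun y => f' (s, y)) x • h x), ?_, ?_⟩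
  · have h1 : StronglyMeasurable fun p : α × Rn n =>
        inner ℂ (g p.2) (χ.lowPass j (fun y => f' (p.1, y)) p.2 • h p.2) :=
      StronglyMeasurable.inner ((Lp.stronglyMeasurable g).comp_measurable measurable_snd)
        ((χ.stronglyMeasurable_lowPass j hf').smul
          ((Lp.stronglyMeasurable h).comp_measurable measurable_snd))
    exact h1.integral_prod_right'
  · filter_upwards [Measure.ae_ae_of_ae_prod hff', hb] with s hs ⟨a, ha⟩
    have h2 : AEStronglyMeasurable (f s) (volume : Measure (Rn n)) :=
      ⟨fun x => f' (s, x), hf'.comp_measurable measurable_prodMk_left, hs⟩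
    rw [L2.inner_def, ← χ.lowPass_congr (f := f s) (g := fun y => f' (s, y)) hs j]
    refine integral_congr_ae ?_
    filter_upwards [mulOp_coeFn (memLp_scalarMat (m := m) (χ.memLp_lowPass h2 ha j)) h] with x hx
    rw [hx, scalarMat_apply]

/-- A measurable family of coefficients. -/
structure IsCoeffFamily (ν : Measure α) (M : α → Rn n → Matrix (Fin m) (Fin m) ℝ) : Prop where
  measurable : ∀ i l, AEStronglyMeasurable (fun p : α × Rn n => M p.1 p.2 i l) (ν.prod volume)
  isCoeff : ∀ᵐ s ∂ν, ∃ a, IsCoeff (M s) a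

theorem LPCutoff.aestronglyMeasurable_mulOp_lowPassMat (χ : LPCutoff n) (j : ℤ)
    {M : α → Rn n → Matrix (Fin m) (Fin m) ℝ} (hM : IsCoeffFamily ν M) (h : L2 n m) :
    AEStronglyMeasurable (fun s => mulOp (χ.lowPassMat j (M s)) h) ν := by
  have h1 : (fun s => mulOp (χ.lowPassMat j (M s)) h) =ᵐ[ν] fun s => ∑ i, ∑ l,
      constOp n (matrixUnit i l) (mulOp (scalarMat m (χ.lowPass j fun y => M s y i l)) h) := by
    filter_upwards [hM.isCoeff] with s ⟨a, ha⟩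
    exact χ.mulOp_lowPassMat ha j h
  refine AEStronglyMeasurable.congr ?_ h1.symm
  refine Finset.aestronglyMeasurable_fun_sum _ fun i _ =>
    Finset.aestronglyMeasurable_fun_sum _ fun l _ => ?_
  refine (constOp n (matrixUnit i l)).continuous.comp_aestronglyMeasurable ?_
  refine χ.aestronglyMeasurable_mulOp_lowPass j (f := fun s y => M s y i l) (hM.measurable i l) ?_ h
  filter_upwards [hM.isCoeff] with s ⟨a, ha⟩ using ⟨a, ha.bounded i l⟩

theorem ParaQuantization.aestronglyMeasurable_rhsOp (Q : ParaQuantization n)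
    {A : α → Fin n → Rn n → Matrix (Fin m) (Fin m) ℝ} {Z : α → Rn n → Matrix (Fin m) (Fin m) ℝ}
    (hA : ∀ j, IsCoeffFamily ν fun s => A s j) (hZ : IsCoeffFamily ν Z) (τ : ℝ)
    (hAa : ∀ᵐ s ∂ν, ∃ a, 0 ≤ a ∧ ∀ j, IsCoeff (A s j) a) (x : L2 n m) :
    AEStronglyMeasurable (fun s => Q.rhsOp (A s) (Z s) τ x) ν := by
  have hterm : ∀ (k : ℤ) (c : Rn n → ℂ) (M : α → Rn n → Matrix (Fin m) (Fin m) ℝ),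
      IsCoeffFamily ν M → AEStronglyMeasurable (fun s => Q.cutoff.paraTerm τ k c
        (Q.cutoff.lowPassMat (k - Q.gap) (M s)) x) ν := by
    intro k c M hM
    exact (FM m (Q.cutoff.annSymbol 4 k * weight τ)).continuous.comp_aestronglyMeasurable
      (Q.cutoff.aestronglyMeasurable_mulOp_lowPassMat (k - Q.gap) hM _)
  refine aestronglyMeasurable_of_tendsto_ae (atTop : Filter (Finset ℤ))
    (f := fun F s => ∑ k ∈ F, Q.rhsTerm (A s) (Z s) τ k x) (fun F => ?_) ?_
  · refine Finset.aestronglyMeasurable_fun_sum _ fun k _ => ?_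
    simp only [rhsTerm]
    split_ifs
    · simp only [add_apply, sum_apply]
      exact (Finset.aestronglyMeasurable_fun_sum _ fun j _ => hterm k _ _ (hA j)).add
        (hterm k _ _ hZ)
    · simp only [zero_apply]
      exact aestronglyMeasurable_const
  · filter_upwards [hAa, hZ.isCoeff] with s ⟨a, ha, h1⟩ ⟨z, h2⟩
    exact (Q.hasSum_rhsOp_and_norm_le h1 ha h2 τ).1 x

end Measurability

/-! ### The generator of the paradifferential equation -/

namespace IsBackground

variable {T A : ℝ} {u : ℝ → Rn n → RVec m} {Du : ℝ → Rn n → (Rn n →L[ℝ] RVec m)}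

theorem aemeasurable_controlB (h : IsBackground T A u Du) :
    AEMeasurable (controlB Du) (volume.restrict (Icc 0 T)) :=
  aemeasurable_eLpNorm_top_slice h.measurable_Du

/-- At almost every time the bounds `A` and `B(t) < ∞` hold for almost every position. -/
theorem ae_slice (h : IsBackground T A u Du) : ∀ᵐ s ∂(volume.restrict (Icc 0 T)),
    IsBackgroundSlice A (controlB Du s).toReal (u s) (Du s) := by
  filter_upwards [h.measurable_u.prodMk_left, h.measurable_Du.prodMk_left,
    Measure.ae_ae_of_ae_prod h.bounded, h.gradient,
    ae_lt_top' h.aemeasurable_controlB h.integrable_B.ne] with s h1 h2 h3 h4 h5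
  refine ⟨h1, h2, h3, ?_, ENNReal.toReal_nonneg, h4⟩
  filter_upwards [enorm_ae_le_eLpNormEssSup (Du s) volume] with x hx
  rw [← eLpNorm_exponent_top] at hx
  have h6 := ENNReal.toReal_mono h5.ne hx
  simpa using h6

theorem intervalIntegrable_controlB (h : IsBackground T A u Du) (hT : 0 ≤ T) :
    IntervalIntegrable (fun s => (controlB Du s).toReal) volume 0 T := by
  rw [intervalIntegrable_iff_integrableOn_Icc_of_le hT]
  exact integrable_toReal_of_lintegral_ne_top h.aemeasurable_controlB h.integrable_B.ne

end IsBackground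

namespace ParaQuantization

variable (Q : ParaQuantization n) (𝒜 : Fin n → RVec m → Matrix (Fin m) (Fin m) ℝ)

/-- The right-hand side of the paradifferential equation at time `s`, conjugated to an operator on
`L²` by Bessel potentials of order `τ` and `τ + 1`. -/
def generator (u : ℝ → Rn n → RVec m) (Du : ℝ → Rn n → (Rn n →L[ℝ] RVec m)) (τ s : ℝ) :
    L2 n m →L[ℂ] L2 n m :=
  Q.rhsOp (fun j x => 𝒜 j (u s x)) (fun x => zerothOrderCoeff 𝒜 (u s x) (Du s x)) τ

variable {𝒜}

theorem weight_comp_generator (h_smooth : ∀ j a b, ContDiff ℝ ∞ (fun V => 𝒜 j V a b)) {T A : ℝ}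
    {u : ℝ → Rn n → RVec m} {Du : ℝ → Rn n → (Rn n →L[ℝ] RVec m)} (hu : IsBackground T A u Du)
    (τ : ℝ) : ∀ᵐ s ∂(volume.restrict (Icc 0 T)), FM m (weight (-1)) ∘L
      Q.generator 𝒜 u Du (τ + 1) s = Q.generator 𝒜 u Du τ s ∘L FM m (weight (-1)) := by
  obtain ⟨K, hK0, hK⟩ := exists_bound_coefficients h_smooth A
  filter_upwards [hu.ae_slice] with s hs
  exact Q.weight_comp_rhsOp (hs.isCoeff h_smooth hK0 hK) hK0
    (hs.isCoeff_zerothOrder h_smooth hK0 hK) τ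

/-- The paradifferential equation has an energy generator, with `b` proportional to `B(t)`. The
constant depends only on `Q`, `𝒜`, `τ` and `A`, and may be enlarged, so that a single constant
serves several orders `τ`. -/
theorem exists_energyGenerator (h_smooth : ∀ j a b, ContDiff ℝ ∞ (fun V => 𝒜 j V a b))
    (h_symm : ∀ j V, (𝒜 j V).IsSymm) (τ A : ℝ) : ∃ C, 0 ≤ C ∧ ∀ (T : ℝ)
      (u : ℝ → Rn n → RVec m) (Du : ℝ → Rn n → (Rn n →L[ℝ] RVec m)),
      0 ≤ T → IsBackground T A u Du → ∀ C', C ≤ C' →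
      EnergyGenerator T (fun K => FM m (Q.cutoff.truncSymbol K))
        (fun K => FM m (Q.cutoff.truncSymbol K * weight 1)) (Q.generator 𝒜 u Du τ)
        (fun s => C' * (1 + (controlB Du s).toReal)) (fun s => C' * (controlB Du s).toReal) := by
  obtain ⟨K, hK0, hK⟩ := exists_bound_coefficients h_smooth A
  obtain ⟨C₁, hC₁, h₁⟩ := Q.exists_energy_bound m τ
  have hB := Q.cutoff.bound_pos
  have ht := Q.termBound_nonneg m τ
  set D := Q.termBound m τ * (21 * (2 * Q.cutoff.bound) ^ 2) with hD
  have hD0 : 0 ≤ D := by positivity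
  refine ⟨D * (K + n * m * K) + C₁ * (K * m + n * m * K), by positivity,
    fun T u Du hT hu C' hC' => ?_⟩
  have hC₁' : 0 ≤ C₁ * (K * m + n * m * K) := by positivity
  have hD' : 0 ≤ D * (K + n * m * K) := by positivity
  have hb := hu.intervalIntegrable_controlB hT
  have hcont := fun j a b => (h_smooth j a b).continuous
  refine ⟨?_, ?_, ?_, ?_, ?_, ?_⟩
  · refine Q.aestronglyMeasurable_rhsOp (A := fun s j x => 𝒜 j (u s x))
      (Z := fun s x => zerothOrderCoeff 𝒜 (u s x) (Du s x)) (fun j => ⟨fun a b => ?_, ?_⟩)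
      ⟨fun a b => ?_, ?_⟩ τ ?_
    · exact (hcont j a b).comp_aestronglyMeasurable hu.measurable_u
    · filter_upwards [hu.ae_slice] with s hs using ⟨K, hs.isCoeff h_smooth hK0 hK j⟩
    · have h2 : AEStronglyMeasurable (fun p : ℝ × Rn n => (u p.1 p.2, Du p.1 p.2))
          ((volume.restrict (Icc 0 T)).prod volume) := hu.measurable_u.prodMk hu.measurable_Du
      have h3 := (continuous_zerothOrderCoeff h_smooth a b).comp_aestronglyMeasurable h2
      exact h3
    · filter_upwards [hu.ae_slice] with s hs using ⟨_, hs.isCoeff_zerothOrder h_smooth hK0 hK⟩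
    · filter_upwards [hu.ae_slice] with s hs using ⟨K, hK0, hs.isCoeff h_smooth hK0 hK⟩
  · filter_upwards [hu.ae_slice] with s hs
    refine (Q.hasSum_rhsOp_and_norm_le (hs.isCoeff h_smooth hK0 hK) hK0
      (hs.isCoeff_zerothOrder h_smooth hK0 hK) τ).2.trans ?_
    have hs0 := hs.nonneg
    set b := (controlB Du s).toReal
    have h2 : Q.termBound m τ * (K + n * m * K * b) * (21 * (2 * Q.cutoff.bound) ^ 2) =
        D * (K + n * m * K * b) := by rw [hD]; ring
    rw [h2]
    calc D * (K + n * m * K * b) ≤ D * ((K + n * m * K) * (1 + b)) := by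
          gcongr
          have : 0 ≤ n * m * K + K * b := by positivity
          linarith
      _ = D * (K + n * m * K) * (1 + b) := by ring
      _ ≤ C' * (1 + b) := by gcongr; linarith
  · exact (intervalIntegrable_const.add hb).const_mul C'
  · exact hb.const_mul C'
  · exact Eventually.of_forall fun s => mul_nonneg (by linarith) ENNReal.toReal_nonneg
  · filter_upwards [hu.ae_slice] with s hs k x
    have hs0 := hs.nonneg
    refine (h₁ _ _ K _ (K * (m * (controlB Du s).toReal)) (hs.isCoeff h_smooth hK0 hK) hK0
      (hs.isCoeff_zerothOrder h_smooth hK0 hK) (by positivity) (fun j x => h_symm j _)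
      (hs.exists_lipschitz_coeff h_smooth hK0 hK) k x).trans ?_
    refine mul_le_mul_of_nonneg_right ?_ (sq_nonneg _)
    calc _ = C₁ * (K * m + n * m * K) * (controlB Du s).toReal := by ring
      _ ≤ _ := by gcongr; linarith

end ParaQuantization

end

noncomputable section

variable {n m : ℕ}

/-! ### Sobolev spaces as copies of `L²` -/

theorem hasTemperateGrowth_weight (τ : ℝ) : (weight τ : Rn n → ℂ).HasTemperateGrowth := by
  unfold weight; fun_prop

theorem hasTemperateGrowth_derivSymbol (j : Fin n) :
    (derivSymbol j : Rn n → ℂ).HasTemperateGrowth := by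
  have h1 : (fun ξ : Rn n => ((EuclideanSpace.proj j : Rn n →L[ℝ] ℝ) ξ : ℂ)).HasTemperateGrowth :=
    (Complex.ofRealCLM ∘L (EuclideanSpace.proj j : Rn n →L[ℝ] ℝ)).hasTemperateGrowth
  exact (Function.HasTemperateGrowth.const (2 * Real.pi * Complex.I)).mul h1

theorem LPCutoff.hasTemperateGrowth_annSymbol (χ : LPCutoff n) {c : ℝ} (hc : 1 ≤ c) (k : ℤ) :
    (χ.annSymbol c k).HasTemperateGrowth := by
  refine HasCompactSupport.hasTemperateGrowth ?_ ?_
  · refine HasCompactSupport.intro (isCompact_closedBall (0 : Rn n) (2 ^ k * (2 * c)))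
      fun ξ hξ => ?_
    rw [annSymbol, χ.annulus_eq_zero_of_large hc, Complex.ofReal_zero]
    have h1 : 2 ^ k * (2 * c) < ‖ξ‖ := by simpa using hξ
    rw [norm_smul, Real.norm_of_nonneg (by positivity), zpow_neg, le_inv_mul_iff₀ (by positivity)]
    exact h1.le
  · have := χ.contDiff_annulus c
    exact Complex.ofRealCLM.contDiff.comp (this.comp (by fun_prop))

/-- The isomorphism of `L²` onto `H^σ`. -/
def sobolevEmb (n m : ℕ) (σ : ℝ) : L2 n m →L[ℂ] 𝓢'(Rn n, CVec m) :=
  besselPotential (Rn n) (CVec m) (-σ) ∘L distr n m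

theorem sobolevEmb_apply (σ : ℝ) (v : L2 n m) :
    sobolevEmb n m σ v = fourierMultiplierCLM (CVec m) (weight (-σ)) (distr n m v) := rfl

theorem besselPotential_sobolevEmb (σ : ℝ) (v : L2 n m) :
    besselPotential (Rn n) (CVec m) σ (sobolevEmb n m σ v) = distr n m v :=
  (besselPotential_neg_apply_eq_iff σ (distr n m v) (sobolevEmb n m σ v)).mp rfl

theorem memSobolev_sobolevEmb (σ : ℝ) (v : L2 n m) : MemSobolev σ 2 (sobolevEmb n m σ v) :=
  ⟨v, besselPotential_sobolevEmb σ v⟩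

theorem sobolevNorm_sobolevEmb (σ : ℝ) (v : L2 n m) : sobolevNorm σ (sobolevEmb n m σ v) = ‖v‖ :=
  sobolevNorm_eq (besselPotential_sobolevEmb σ v)

theorem exists_sobolevEmb_eq {σ : ℝ} {f : 𝓢'(Rn n, CVec m)} (hf : MemSobolev σ 2 f) :
    ∃ v, sobolevEmb n m σ v = f := by
  obtain ⟨v, hv⟩ := hf
  exact ⟨v, (besselPotential_neg_apply_eq_iff σ (distr n m v) f).mpr hv⟩

theorem sobolevEmb_injective (σ : ℝ) : Function.Injective (sobolevEmb n m σ) := fun v w h =>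
  distr_injective (by rw [← besselPotential_sobolevEmb σ v, h, besselPotential_sobolevEmb])

/-- Lowering the order by one is the Bessel potential of order `-1` on `L²`; this is the smoothing
operator `S` of the evolution equation. -/
theorem sobolevEmb_FM_weight (σ : ℝ) (v : L2 n m) :
    sobolevEmb n m (σ - 1) (FM m (weight (-1)) v) = sobolevEmb n m σ v := by
  rw [sobolevEmb_apply, sobolevEmb_apply,
    ← fourierMultiplierCLM_distr (hasTemperateGrowth_weight _) (memLp_weight (by norm_num)),
    fourierMultiplierCLM_fourierMultiplierCLM_apply (hasTemperateGrowth_weight _)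
      (hasTemperateGrowth_weight _), weight_mul]
  congr 3
  ring

theorem postcomp_fourierMultiplierCLM (E : CVec m →L[ℂ] CVec m) (φ : Rn n → ℂ)
    (f : 𝓢'(Rn n, CVec m)) : PointwiseConvergenceCLM.postcomp (𝓢(Rn n, ℂ)) E
      (fourierMultiplierCLM (CVec m) φ f) = fourierMultiplierCLM (CVec m) φ
        (PointwiseConvergenceCLM.postcomp (𝓢(Rn n, ℂ)) E f) := rfl

theorem postcomp_sobolevEmb (E : CVec m →L[ℂ] CVec m) (σ : ℝ) (v : L2 n m) :
    PointwiseConvergenceCLM.postcomp (𝓢(Rn n, ℂ)) E (sobolevEmb n m σ v) =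
      sobolevEmb n m σ (constOp n E v) := by
  rw [sobolevEmb_apply, sobolevEmb_apply, postcomp_fourierMultiplierCLM, postcomp_distr]

/-! ### Paraproducts on Sobolev spaces -/

namespace LPCutoff

variable (χ : LPCutoff n) {c : Rn n → ℂ} {c₀ : ℝ} {f : Rn n → ℝ} {a : ℝ}

theorem block_sobolevEmb (hc : IsFirstOrder c c₀) (hc' : c.HasTemperateGrowth) (τ : ℝ) (k : ℤ)
    (v : L2 n m) :
    χ.block k (fourierMultiplierCLM (CVec m) c (sobolevEmb n m (τ + 1) v)) =
      distr n m (FM m (χ.annSymbol 1 k * (c * weight (-τ - 1))) v) := by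
  have h1 := χ.hasTemperateGrowth_annSymbol le_rfl k
  have h2 := hasTemperateGrowth_weight (n := n) (-τ - 1)
  have h0 : χ.blockSymbol k = χ.annSymbol 1 k := χ.blockSymbol_eq_annSymbol k
  rw [block, h0, sobolevEmb_apply, neg_add', fourierMultiplierCLM_fourierMultiplierCLM_apply h2 hc',
    fourierMultiplierCLM_fourierMultiplierCLM_apply (h2.mul hc') h1,
    ← fourierMultiplierCLM_distr (h1.mul (hc'.mul h2)) (χ.memLp_annSymbol_mul hc τ k)]
  congr 2
  ring

/-- The summand of the paraproduct, carried over to `L²`. The localization of its output, which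
`paraTerm` has by definition, comes for free from the frequency gap. -/
theorem smulLeftCLM_block_sobolevEmb (hc : IsFirstOrder c c₀) (hc' : c.HasTemperateGrowth)
    (hf : AEStronglyMeasurable f volume) (ha : ∀ᵐ y, ‖f y‖ ≤ a) {N : ℤ} (hN : 3 ≤ N) (τ : ℝ) (k : ℤ)
    (v : L2 n m) :
    smulLeftCLM (CVec m) (χ.lowPass (k - N) f)
      (χ.block k (fourierMultiplierCLM (CVec m) c (sobolevEmb n m (τ + 1) v))) =
      sobolevEmb n m τ (χ.paraTerm τ k c (scalarMat m (χ.lowPass (k - N) f)) v) := by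
  have h1 := χ.hasTemperateGrowth_annSymbol (c := 4) (by norm_num) k
  have h2 := hasTemperateGrowth_weight (n := n) τ
  rw [χ.block_sobolevEmb hc hc', smulLeftCLM_distr (χ.hasTemperateGrowth_lowPass hf ha _)
    (χ.memLp_lowPass hf ha _), ← χ.FM_annSymbol_mulOp_lowPass hf ha hN
      (χ.memLp_annSymbol_mul hc τ k), sobolevEmb_apply, paraTerm,
    ContinuousLinearMap.comp_apply, ContinuousLinearMap.comp_apply,
    ← fourierMultiplierCLM_distr h1 (χ.memLp_annSymbol 4 k),
    ← fourierMultiplierCLM_distr (h1.mul h2)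
      (memLp_annSymbol_mul_weight χ (by norm_num) (by norm_num) k τ),
    fourierMultiplierCLM_fourierMultiplierCLM_apply (h1.mul h2) (hasTemperateGrowth_weight _),
    mul_assoc, weight_mul, add_neg_cancel, weight_zero, mul_one]

theorem paraTerm_lowPassMat {M : Rn n → Matrix (Fin m) (Fin m) ℝ} (hM : IsCoeff M a)
    (τ : ℝ) (k j : ℤ) (v : L2 n m) :
    χ.paraTerm τ k c (χ.lowPassMat j M) v = ∑ i, ∑ l, constOp n (matrixUnit i l)
      (χ.paraTerm τ k c (scalarMat m (χ.lowPass j fun y => M y i l)) v) := by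
  simp only [paraTerm, ContinuousLinearMap.comp_apply, χ.mulOp_lowPassMat hM, map_sum,
    FM_constOp (memLp_annSymbol_mul_weight χ (c := 4) (by norm_num) (by norm_num) k τ)]

end LPCutoff

namespace ParaQuantization

variable (Q : ParaQuantization n) {c : Rn n → ℂ} {c₀ : ℝ} {a : ℝ}

open Classical in
theorem exists_hasSum_scalar (hc : IsFirstOrder c c₀) (hc₀ : 0 ≤ c₀) {f : Rn n → ℝ}
    (ha : ∀ᵐ y, ‖f y‖ ≤ a) (ha0 : 0 ≤ a) (τ : ℝ) (v : L2 n m) :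
    ∃ y, HasSum (fun k : ℤ => if Q.lowest < (k : WithBot ℤ) then
      Q.cutoff.paraTerm τ k c (scalarMat m (Q.cutoff.lowPass (k - Q.gap) f)) v else 0) y := by
  have hB := Q.cutoff.bound_pos
  have hl := Q.cutoff.lowBound_nonneg
  set S : ℤ → L2 n m →L[ℂ] L2 n m := fun k => if Q.lowest < (k : WithBot ℤ) then
      Q.cutoff.paraTerm τ k c (scalarMat m (Q.cutoff.lowPass (k - Q.gap) f)) else 0 with hS
  have h1 : ∀ k x, FM m (Q.cutoff.annSymbol 16 k) (S k (FM m (Q.cutoff.annSymbol 16 k) x)) =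
      S k x := by
    intro k x
    simp only [hS]
    split_ifs
    · exact Q.cutoff.FM_paraTerm_FM hc τ k x
    · simp
  have h2 : ∀ k, ‖S k‖ ≤
      (2 * Q.cutoff.bound * 256 ^ |τ / 2|) ^ 2 * c₀ * (Q.cutoff.lowBound * a) := by
    intro k
    simp only [hS]
    split_ifs
    · exact Q.cutoff.norm_paraTerm_le hc τ k (by positivity) fun x =>
        (norm_scalarMat_le _ x).trans (Q.cutoff.norm_lowPass_le ha ha0 _ x)
    · rw [norm_zero]; positivity
  obtain ⟨Γ, hΓ, -⟩ := exists_hasSum_localized (N := 21 * (2 * Q.cutoff.bound) ^ 2) (by positivity)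
    (fun k x y => by rw [inner_FM (Q.cutoff.memLp_annSymbol 16 k), Q.cutoff.star_annSymbol])
    Q.cutoff.sum_norm_sq_FM_le h1 h2
  refine ⟨Γ v, (hΓ v).congr_fun fun k => ?_⟩
  simp only [hS]
  split_ifs <;> rfl

open Classical in
/-- Strong convergence in `L²` implies convergence of the defining series of the paraproduct in the
sense of tempered distributions, and identifies its sum. -/
theorem para_sobolevEmb (hc : IsFirstOrder c c₀) (hc' : c.HasTemperateGrowth) {f : Rn n → ℝ}
    (hf : AEStronglyMeasurable f volume) (ha : ∀ᵐ y, ‖f y‖ ≤ a) (τ : ℝ) {v y : L2 n m}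
    (h : HasSum (fun k : ℤ => if Q.lowest < (k : WithBot ℤ) then
      Q.cutoff.paraTerm τ k c (scalarMat m (Q.cutoff.lowPass (k - Q.gap) f)) v else 0) y) :
    Q.para f (fourierMultiplierCLM (CVec m) c (sobolevEmb n m (τ + 1) v)) =
      sobolevEmb n m τ y := by
  refine HasSum.tsum_eq (((sobolevEmb n m τ).hasSum h).congr_fun fun k => ?_)
  split_ifs
  · exact (Q.cutoff.smulLeftCLM_block_sobolevEmb hc hc' hf ha Q.three_le_gap τ k v)
  · simp

open Classical in
theorem exists_matPara_sobolevEmb {M : Rn n → Matrix (Fin m) (Fin m) ℝ} (hM : IsCoeff M a)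
    (hc : IsFirstOrder c c₀) (hc₀ : 0 ≤ c₀) (hc' : c.HasTemperateGrowth) (τ : ℝ) (v : L2 n m) :
    ∃ y, HasSum (fun k : ℤ => if Q.lowest < (k : WithBot ℤ) then
      Q.cutoff.paraTerm τ k c (Q.cutoff.lowPassMat (k - Q.gap) M) v else 0) y ∧
      Q.matPara M (fourierMultiplierCLM (CVec m) c (sobolevEmb n m (τ + 1) v)) =
        sobolevEmb n m τ y := by
  have h1 := fun i l => Q.exists_hasSum_scalar hc hc₀ (hM.bounded i l) hM.nonneg τ v
  choose y hy using h1
  refine ⟨∑ i, ∑ l, constOp n (matrixUnit i l) (y i l), ?_, ?_⟩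
  · have h2 := hasSum_sum (s := Finset.univ) fun i _ => hasSum_sum (s := Finset.univ) fun l _ =>
      (constOp n (matrixUnit i l)).hasSum (hy i l)
    refine h2.congr_fun fun k => ?_
    split_ifs
    · exact Q.cutoff.paraTerm_lowPassMat hM τ k _ v
    · simp
  · simp only [matPara, map_sum]
    refine Finset.sum_congr rfl fun i _ => Finset.sum_congr rfl fun l _ => ?_
    rw [Q.para_sobolevEmb hc hc' (hM.measurable i l) (hM.bounded i l) τ (hy i l),
      postcomp_sobolevEmb]

theorem lineDeriv_eq_derivSymbol (j : Fin n) (g : 𝓢'(Rn n, CVec m)) :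
    ∂_{(EuclideanSpace.single j 1 : Rn n)} g =
      fourierMultiplierCLM (CVec m) (derivSymbol j) g := by
  have h1 : (fun ξ : Rn n => ((inner ℝ ξ (EuclideanSpace.single j 1 : Rn n) : ℝ) :
      ℂ)).HasTemperateGrowth := by fun_prop
  rw [lineDeriv_eq_fourierMultiplierCLM, ← smul_apply, ← fourierMultiplierCLM_smul h1]
  congr 2
  ext ξ
  rw [Pi.smul_apply, smul_eq_mul, derivSymbol, EuclideanSpace.inner_single_right]
  simp

/-- The paradifferential operator maps `H^(τ+1)` to `H^τ`, and is represented by an operator on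
`L²`. -/
theorem paraRHS_sobolevEmb {𝒜 : Fin n → RVec m → Matrix (Fin m) (Fin m) ℝ} {U : Rn n → RVec m}
    {DU : Rn n → (Rn n →L[ℝ] RVec m)} {z : ℝ} (hA : ∀ j, IsCoeff (fun x => 𝒜 j (U x)) a)
    (ha : 0 ≤ a) (hZ : IsCoeff (fun x => zerothOrderCoeff 𝒜 (U x) (DU x)) z) (τ : ℝ) (v : L2 n m) :
    paraRHS Q 𝒜 U DU (sobolevEmb n m (τ + 1) v) = sobolevEmb n m τ
      (Q.rhsOp (fun j x => 𝒜 j (U x)) (fun x => zerothOrderCoeff 𝒜 (U x) (DU x)) τ v) := by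
  classical
  have h1 := fun j => Q.exists_matPara_sobolevEmb (hA j) (isFirstOrder_derivSymbol j)
    (by positivity) (hasTemperateGrowth_derivSymbol j) τ v
  choose y hy hy' using h1
  obtain ⟨y₀, hy₀, hy₀'⟩ := Q.exists_matPara_sobolevEmb hZ isFirstOrder_one zero_le_one
    (Function.HasTemperateGrowth.const 1) τ v
  have h2 : fourierMultiplierCLM (CVec m) (1 : Rn n → ℂ) (sobolevEmb n m (τ + 1) v) =
      sobolevEmb n m (τ + 1) v := by
    have := fourierMultiplierCLM_const (E := Rn n) (F := CVec m) 1
    rw [one_smul] at this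
    exact congrArg (· (sobolevEmb n m (τ + 1) v)) this
  rw [h2] at hy₀'
  have h3 : Q.rhsOp (fun j x => 𝒜 j (U x)) (fun x => zerothOrderCoeff 𝒜 (U x) (DU x)) τ v =
      ∑ j, y j + y₀ := by
    refine ((Q.hasSum_rhsOp_and_norm_le hA ha hZ τ).1 v).unique
      (((hasSum_sum (s := Finset.univ) fun j _ => hy j).add hy₀).congr_fun fun k => ?_)
    simp only [rhsTerm]
    split_ifs
    · simp only [add_apply, sum_apply]
    · simp
  simp only [paraRHS, lineDeriv_eq_derivSymbol, hy', hy₀', h3, map_add, map_sum]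

end ParaQuantization

end

noncomputable section

variable {n m : ℕ}

/-! ### The paradifferential equation as an evolution equation in `L²` -/

/-- The pairing with a test function of the element of `H^τ` represented by a function in `L²`. -/
def sobolevEval (m : ℕ) (τ : ℝ) (φ : 𝓢(Rn n, ℂ)) : L2 n m →L[ℂ] CVec m :=
  PointwiseConvergenceCLM.evalCLM (RingHom.id ℂ) (CVec m) φ ∘L sobolevEmb n m τ

theorem sobolevEval_apply (τ : ℝ) (φ : 𝓢(Rn n, ℂ)) (v : L2 n m) :
    sobolevEval m τ φ v = sobolevEmb n m τ v φ := rfl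

variable {Q : ParaQuantization n} {𝒜 : Fin n → RVec m → Matrix (Fin m) (Fin m) ℝ} {T A : ℝ}
  {u : ℝ → Rn n → RVec m} {Du : ℝ → Rn n → (Rn n →L[ℝ] RVec m)}

theorem IsBackground.ae_paraRHS_sobolevEmb (hu : IsBackground T A u Du)
    (h_smooth : ∀ j a b, ContDiff ℝ ∞ (fun V => 𝒜 j V a b)) (σ : ℝ) :
    ∀ᵐ s ∂(volume.restrict (Icc 0 T)), ∀ v : L2 n m,
      paraRHS Q 𝒜 (u s) (Du s) (sobolevEmb n m σ v) =
        sobolevEmb n m (σ - 1) (Q.generator 𝒜 u Du (σ - 1) s v) := by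
  obtain ⟨K, hK0, hK⟩ := exists_bound_coefficients h_smooth A
  filter_upwards [hu.ae_slice] with s hs v
  have h := Q.paraRHS_sobolevEmb (hs.isCoeff h_smooth hK0 hK) hK0
    (hs.isCoeff_zerothOrder h_smooth hK0 hK) (σ - 1) v
  rwa [sub_add_cancel] at h

section Equation

variable {σ : ℝ} {v : ℝ → L2 n m}

theorem IsBackground.ae_paraRHS_apply (hu : IsBackground T A u Du)
    (h_smooth : ∀ j a b, ContDiff ℝ ∞ (fun V => 𝒜 j V a b)) {w : ℝ → 𝓢'(Rn n, CVec m)}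
    (hw : ∀ t ∈ Icc 0 T, w t = sobolevEmb n m σ (v t)) (φ : 𝓢(Rn n, ℂ)) :
    ∀ᵐ s ∂(volume.restrict (Icc 0 T)), paraRHS Q 𝒜 (u s) (Du s) (w s) φ =
      sobolevEval m (σ - 1) φ (Q.generator 𝒜 u Du (σ - 1) s (v s)) := by
  filter_upwards [hu.ae_paraRHS_sobolevEmb (Q := Q) h_smooth σ,
    ae_restrict_mem measurableSet_Icc] with s hs hsT
  rw [hw s hsT, hs, sobolevEval_apply]

theorem IsBackground.integral_paraRHS_apply (hu : IsBackground T A u Du)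
    (h_smooth : ∀ j a b, ContDiff ℝ ∞ (fun V => 𝒜 j V a b)) {w : ℝ → 𝓢'(Rn n, CVec m)}
    (hw : ∀ t ∈ Icc 0 T, w t = sobolevEmb n m σ (v t))
    (hi : IntervalIntegrable (fun s => Q.generator 𝒜 u Du (σ - 1) s (v s)) volume 0 T)
    (φ : 𝓢(Rn n, ℂ)) {t : ℝ} (ht : t ∈ Icc 0 T) :
    ∫ s in (0 : ℝ)..t, paraRHS Q 𝒜 (u s) (Du s) (w s) φ =
      sobolevEval m (σ - 1) φ (∫ s in (0 : ℝ)..t, Q.generator 𝒜 u Du (σ - 1) s (v s)) := by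
  have h0 : (0 : ℝ) ∈ Icc 0 T := ⟨le_rfl, ht.1.trans ht.2⟩
  rw [← ContinuousLinearMap.intervalIntegral_comp_comm _ (intervalIntegrable_of_mem_Icc hi h0 ht)]
  refine intervalIntegral.integral_congr_ae_restrict ?_
  rw [uIoc_of_le ht.1]
  exact ae_mono (Measure.restrict_mono (Ioc_subset_Icc_self.trans (Icc_subset_Icc_right ht.2))
    le_rfl) (hu.ae_paraRHS_apply h_smooth hw φ)

/-- Evolutions in `L²` represent solutions of the paradifferential equation in `H^σ`. -/
theorem IsEvolution.isParaSolution (hu : IsBackground T A u Du) (hT : 0 ≤ T)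
    (h_smooth : ∀ j a b, ContDiff ℝ ∞ (fun V => 𝒜 j V a b)) {v₀ : L2 n m}
    (hv : IsEvolution T (FM m (weight (-1))) (Q.generator 𝒜 u Du (σ - 1)) v₀ v)
    (hi : IntervalIntegrable (fun s => Q.generator 𝒜 u Du (σ - 1) s (v s)) volume 0 T) :
    IsParaSolution Q 𝒜 T u Du σ (sobolevEmb n m σ v₀) (fun t => sobolevEmb n m σ (v t)) := by
  refine ⟨⟨fun t _ => memSobolev_sobolevEmb σ _, fun t ht => ?_⟩, by rw [hv.initial],
    fun φ => ?_, fun φ t ht => ?_⟩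
  · simp only [← map_sub, sobolevNorm_sobolevEmb]
    simpa using (((hv.cont t ht).sub_const (v t))).norm
  · have h1 : IntervalIntegrable (fun s => sobolevEval m (σ - 1) φ
        (Q.generator 𝒜 u Du (σ - 1) s (v s))) volume 0 T := by
      rw [intervalIntegrable_iff_integrableOn_Icc_of_le hT] at hi ⊢
      exact (sobolevEval m (σ - 1) φ).integrable_comp hi
    rw [intervalIntegrable_iff_integrableOn_Icc_of_le hT] at h1 ⊢
    refine h1.congr ?_
    filter_upwards [hu.ae_paraRHS_apply (Q := Q) (σ := σ) (v := v) h_smooth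
      (fun t _ => rfl) φ] with s hs using hs.symm
  · rw [hu.integral_paraRHS_apply h_smooth (v := v) (fun _ _ => rfl) hi φ ht,
      ← sobolevEmb_FM_weight, ← sobolevEmb_FM_weight σ v₀, hv.equation t ht]
    rw [← sobolevEval_apply, map_add, sobolevEval_apply]
    rfl

/-- Solutions of the paradifferential equation in `H^σ` are represented by evolutions in `L²`. -/
theorem IsParaSolution.exists_isEvolution {w₀ : 𝓢'(Rn n, CVec m)} {w : ℝ → 𝓢'(Rn n, CVec m)}
    (hw : IsParaSolution Q 𝒜 T u Du σ w₀ w) (hu : IsBackground T A u Du) (hT : 0 ≤ T)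
    (h_smooth : ∀ j a b, ContDiff ℝ ∞ (fun V => 𝒜 j V a b))
    (hi : ∀ v : ℝ → L2 n m, ContinuousOn v (Icc 0 T) →
      IntervalIntegrable (fun s => Q.generator 𝒜 u Du (σ - 1) s (v s)) volume 0 T) :
    ∃ v₀ v, sobolevEmb n m σ v₀ = w₀ ∧ (∀ t ∈ Icc 0 T, w t = sobolevEmb n m σ (v t)) ∧
      IsEvolution T (FM m (weight (-1))) (Q.generator 𝒜 u Du (σ - 1)) v₀ v := by
  have h1 : ∀ t, ∃ x : L2 n m, t ∈ Icc 0 T → sobolevEmb n m σ x = w t := by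
    intro t
    by_cases ht : t ∈ Icc 0 T
    · obtain ⟨x, hx⟩ := exists_sobolevEmb_eq (hw.cont.1 t ht)
      exact ⟨x, fun _ => hx⟩
    · exact ⟨0, fun h => absurd h ht⟩
  choose v hv using h1
  have h0 : (0 : ℝ) ∈ Icc 0 T := ⟨le_rfl, hT⟩
  have hw₀ : sobolevEmb n m σ (v 0) = w₀ := by rw [hv 0 h0, hw.initial]
  have hcont : ContinuousOn v (Icc 0 T) := by
    intro t ht
    have h2 := hw.cont.2 t ht
    rw [ContinuousWithinAt, tendsto_iff_norm_sub_tendsto_zero]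
    refine h2.congr' ?_
    filter_upwards [self_mem_nhdsWithin] with s hs
    rw [← hv s hs, ← hv t ht, ← map_sub, sobolevNorm_sobolevEmb]
  have hv' : ∀ t ∈ Icc 0 T, w t = sobolevEmb n m σ (v t) := fun t ht => (hv t ht).symm
  refine ⟨v 0, v, hw₀, hv', hcont, rfl, fun t ht => ?_⟩
  apply sobolevEmb_injective (σ - 1)
  ext1 φ
  have h3 := hw.equation φ t ht
  rw [hu.integral_paraRHS_apply h_smooth hv' (hi v hcont) φ ht, hv' t ht, ← hw₀,
    ← sobolevEmb_FM_weight, ← sobolevEmb_FM_weight σ (v 0)] at h3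
  rw [h3, ← sobolevEval_apply, ← sobolevEval_apply, map_add]
  rfl

end Equation

end

noncomputable section

variable {n m : ℕ}

/-! ### Complex conjugation -/

/-- Complex conjugation on `ℂᵐ`. -/
def conjVec (m : ℕ) : CVec m →L[ℝ] CVec m :=
  LinearMap.toContinuousLinearMap
    { toFun := fun v => WithLp.toLp 2 fun a => (starRingEnd ℂ) (v a)
      map_add' := fun v w => by ext a; simp
      map_smul' := fun c v => by ext a; simp }

@[simp] theorem conjVec_apply (v : CVec m) (a : Fin m) :
    conjVec m v a = (starRingEnd ℂ) (v a) := rfl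

theorem conjVec_smul (c : ℂ) (v : CVec m) :
    conjVec m (c • v) = (starRingEnd ℂ) c • conjVec m v := by
  ext a; simp

/-- Complex conjugation of test functions. -/
def conjTest (φ : 𝓢(Rn n, ℂ)) : 𝓢(Rn n, ℂ) :=
  SchwartzMap.postcompCLM (𝕜 := ℝ) (Complex.conjCLE : ℂ →L[ℝ] ℂ) φ

@[simp] theorem conjTest_apply (φ : 𝓢(Rn n, ℂ)) (x : Rn n) :
    conjTest φ x = (starRingEnd ℂ) (φ x) := rfl

/-- Complex conjugation on `L²`. -/
def conjOp (n m : ℕ) : L2 n m →L[ℝ] L2 n m :=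
  (conjVec m).compLpL 2 volume

theorem conjOp_coeFn (v : L2 n m) : conjOp n m v =ᵐ[volume] fun x => conjVec m (v x) :=
  (conjVec m).coeFn_compLpL v

/-- The distribution `g` is the complex conjugate of `f`. -/
def IsConjDistribution (f g : 𝓢'(Rn n, CVec m)) : Prop :=
  ∀ φ : 𝓢(Rn n, ℂ), g φ = conjVec m (f (conjTest φ))

theorem isConjDistribution_distr (v : L2 n m) :
    IsConjDistribution (distr n m v) (distr n m (conjOp n m v)) := by
  intro φ
  rw [distr_apply, distr_apply, ← ContinuousLinearMap.integral_comp_comm]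
  · refine integral_congr_ae ?_
    filter_upwards [conjOp_coeFn v] with x hx
    rw [hx, conjVec_smul, conjTest_apply, Complex.conj_conj]
  · have h1 := ((conjTest φ).memLp 2 (volume : Measure (Rn n)))
    exact memLp_one_iff_integrable.mp ((Lp.memLp v).smul (r := 1) h1)

theorem IsConjDistribution.unique {f g g' : 𝓢'(Rn n, CVec m)} (h : IsConjDistribution f g)
    (h' : IsConjDistribution f g') : g = g' := by
  ext1 φ
  rw [h φ, h' φ]

/-- A symbol of a Fourier multiplier which maps real functions to real functions. -/
def IsHermitianSymbol (g : Rn n → ℂ) : Prop := ∀ ξ, (starRingEnd ℂ) (g ξ) = g (-ξ)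

theorem IsHermitianSymbol.mul {g g' : Rn n → ℂ} (h : IsHermitianSymbol g)
    (h' : IsHermitianSymbol g') : IsHermitianSymbol (g * g') := fun ξ => by
  rw [Pi.mul_apply, Pi.mul_apply, map_mul, h, h']

theorem isHermitianSymbol_weight (τ : ℝ) : IsHermitianSymbol (weight τ : Rn n → ℂ) := fun ξ => by
  rw [weight, weight, Complex.conj_ofReal, norm_neg]

theorem isHermitianSymbol_derivSymbol (j : Fin n) : IsHermitianSymbol (derivSymbol j) := fun ξ => by
  rw [derivSymbol, derivSymbol, map_mul, map_mul, map_mul, Complex.conj_I, Complex.conj_ofReal,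
    Complex.conj_ofReal, map_ofNat, PiLp.neg_apply, Complex.ofReal_neg]
  ring

theorem isHermitianSymbol_one : IsHermitianSymbol (1 : Rn n → ℂ) := fun ξ => by simp

theorem LPCutoff.isHermitianSymbol_annSymbol (χ : LPCutoff n) (c : ℝ) (k : ℤ) :
    IsHermitianSymbol (χ.annSymbol c k) := fun ξ => by
  have h : ∀ r : ℝ, ∀ η : Rn n, χ.toFun (r • -η) = χ.toFun (r • η) := fun r η =>
    χ.radial _ _ (by rw [smul_neg, norm_neg])
  simp only [annSymbol, annulus, Complex.conj_ofReal, smul_neg (_ : ℝ) ξ, h]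

theorem conj_fourier {f g : Rn n → ℂ} (h : ∀ x, g x = (starRingEnd ℂ) (f (-x))) (ξ : Rn n) :
    𝓕 g ξ = (starRingEnd ℂ) (𝓕 f ξ) := by
  rw [Real.fourier_eq, Real.fourier_eq, ← integral_conj,
    ← integral_neg_eq_self (fun v => Real.fourierChar (-inner ℝ v ξ) • g v)]
  congr 1; ext v
  rw [Circle.smul_def, Circle.smul_def, smul_eq_mul, smul_eq_mul, map_mul, h, neg_neg,
    inner_neg_left, AddChar.map_neg_eq_inv, Circle.coe_inv_eq_conj, AddChar.map_neg_eq_inv,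
    Circle.coe_inv_eq_conj]

theorem conj_fourierInv {f g : Rn n → ℂ} (h : ∀ x, g x = (starRingEnd ℂ) (f x)) (ξ : Rn n) :
    𝓕⁻ g ξ = (starRingEnd ℂ) (𝓕⁻ f (-ξ)) := by
  rw [Real.fourierInv_eq, Real.fourierInv_eq, ← integral_conj]
  congr 1; ext v
  rw [Circle.smul_def, Circle.smul_def, smul_eq_mul, smul_eq_mul, map_mul, h,
    inner_neg_right, AddChar.map_neg_eq_inv, Circle.coe_inv_eq_conj, Complex.conj_conj]

/-- Fourier multipliers with Hermitian symbols commute with complex conjugation. -/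
theorem IsConjDistribution.fourierMultiplierCLM {f g : 𝓢'(Rn n, CVec m)}
    (h : IsConjDistribution f g) {a : Rn n → ℂ} (ha : IsHermitianSymbol a)
    (ha' : a.HasTemperateGrowth) :
    IsConjDistribution (TemperedDistribution.fourierMultiplierCLM (CVec m) a f)
      (TemperedDistribution.fourierMultiplierCLM (CVec m) a g) := by
  intro φ
  rw [fourierMultiplierCLM_apply_apply, fourierMultiplierCLM_apply_apply, h]
  congr 2
  ext ξ
  rw [conjTest_apply, SchwartzMap.fourier_coe, SchwartzMap.fourier_coe]
  refine (congrArg (starRingEnd ℂ) (conj_fourier (f := SchwartzMap.smulLeftCLM ℂ a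
    (𝓕⁻ (conjTest φ))) (fun x => ?_) ξ)).trans (Complex.conj_conj _)
  rw [SchwartzMap.smulLeftCLM_apply_apply ha', SchwartzMap.smulLeftCLM_apply_apply ha',
    smul_eq_mul, smul_eq_mul, map_mul, ha, neg_neg, SchwartzMap.fourierInv_coe,
    SchwartzMap.fourierInv_coe, conj_fourierInv (f := φ) (g := conjTest φ) (fun x => rfl),
    neg_neg, Complex.conj_conj]

theorem conjOp_FM {a : Rn n → ℂ} (ha : IsHermitianSymbol a) (ha' : a.HasTemperateGrowth)
    (ha'' : MemLp a ∞ volume) (v : L2 n m) : conjOp n m (FM m a v) = FM m a (conjOp n m v) := by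
  apply distr_injective
  refine (isConjDistribution_distr (FM m a v)).unique ?_
  rw [← fourierMultiplierCLM_distr ha' ha'', ← fourierMultiplierCLM_distr ha' ha'']
  exact (isConjDistribution_distr v).fourierMultiplierCLM ha ha'

theorem isConjDistribution_sobolevEmb (σ : ℝ) (v : L2 n m) :
    IsConjDistribution (sobolevEmb n m σ v) (sobolevEmb n m σ (conjOp n m v)) :=
  (isConjDistribution_distr v).fourierMultiplierCLM (isHermitianSymbol_weight _)
    (hasTemperateGrowth_weight _)

/-- A distribution is real on real test functions exactly if it is its own complex conjugate, as
seen from the real and imaginary parts of a test function. -/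
theorem isRealDistribution_iff {f : 𝓢'(Rn n, CVec m)} :
    IsRealDistribution f ↔ IsConjDistribution f f := by
  constructor
  · intro h φ
    -- the real and imaginary parts of the test function
    set r : 𝓢(Rn n, ℂ) := φ + conjTest φ with hr
    set s : 𝓢(Rn n, ℂ) := Complex.I • (φ - conjTest φ) with hs
    have hr' : ∀ x, (r x).im = 0 := fun x => by simp [hr]
    have hs' : ∀ x, (s x).im = 0 := fun x => by simp [hs]
    have h1 : φ = (2⁻¹ : ℂ) • (r - Complex.I • s) := by
      ext x
      simp only [hr, hs, smul_apply, sub_apply, add_apply, smul_eq_mul, ← mul_assoc,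
        Complex.I_mul_I]
      ring
    have h2 : conjTest φ = (2⁻¹ : ℂ) • (r + Complex.I • s) := by
      ext x
      simp only [hr, hs, smul_apply, sub_apply, add_apply, smul_eq_mul, ← mul_assoc,
        Complex.I_mul_I]
      ring
    ext a
    have h3 := Complex.conj_eq_iff_im.mpr (h r hr' a)
    have h4 := Complex.conj_eq_iff_im.mpr (h s hs' a)
    rw [conjVec_apply, h2]
    conv_lhs => rw [h1]
    simp only [map_smul, map_sub, map_add, PiLp.smul_apply, PiLp.sub_apply, PiLp.add_apply,
      smul_eq_mul, map_mul, h3, h4, Complex.conj_I, map_inv₀, map_ofNat]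
    ring
  · intro h φ hφ a
    have h1 : conjTest φ = φ := by
      ext x
      exact Complex.conj_eq_iff_im.mpr (hφ x)
    have h2 := congrArg (fun v : CVec m => v a) (h φ)
    simp only [h1, conjVec_apply] at h2
    exact Complex.conj_eq_iff_im.mp h2.symm

theorem isRealDistribution_sobolevEmb_iff {σ : ℝ} {v : L2 n m} :
    IsRealDistribution (sobolevEmb n m σ v) ↔ conjOp n m v = v := by
  rw [isRealDistribution_iff]
  constructor
  · intro h
    exact sobolevEmb_injective σ ((isConjDistribution_sobolevEmb σ v).unique h)
  · intro h
    have := isConjDistribution_sobolevEmb σ v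
    rwa [h] at this

/-! ### The paradifferential operator is real -/

theorem LPCutoff.conjOp_mulOp_lowPassMat (χ : LPCutoff n) {M : Rn n → Matrix (Fin m) (Fin m) ℝ}
    {a : ℝ} (hM : IsCoeff M a) (j : ℤ) (v : L2 n m) :
    conjOp n m (mulOp (χ.lowPassMat j M) v) = mulOp (χ.lowPassMat j M) (conjOp n m v) := by
  have hm := χ.memLp_lowPassMat hM j
  apply Lp.ext
  filter_upwards [conjOp_coeFn (mulOp (χ.lowPassMat j M) v), mulOp_coeFn hm v,
    mulOp_coeFn hm (conjOp n m v), conjOp_coeFn v] with x h1 h2 h3 h4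
  rw [h1, h2, h3, h4]
  simp only [lowPassMat, sum_apply, smul_apply, map_sum, conjVec_smul, conj_lowPass]
  refine Finset.sum_congr rfl fun i _ => Finset.sum_congr rfl fun l _ => ?_
  congr 1
  ext b
  by_cases hb : b = i <;> simp [matrixUnit_apply, hb]

theorem LPCutoff.conjOp_paraTerm (χ : LPCutoff n) {c : Rn n → ℂ} {c₀ : ℝ} (hc : IsFirstOrder c c₀)
    (hc' : c.HasTemperateGrowth) (hc'' : IsHermitianSymbol c)
    {M : Rn n → Matrix (Fin m) (Fin m) ℝ} {a : ℝ} (hM : IsCoeff M a) (τ : ℝ) (k j : ℤ)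
    (v : L2 n m) : conjOp n m (χ.paraTerm τ k c (χ.lowPassMat j M) v) =
      χ.paraTerm τ k c (χ.lowPassMat j M) (conjOp n m v) := by
  simp only [paraTerm, ContinuousLinearMap.comp_apply]
  rw [conjOp_FM ((χ.isHermitianSymbol_annSymbol 4 k).mul (isHermitianSymbol_weight τ))
      ((χ.hasTemperateGrowth_annSymbol (by norm_num) k).mul (hasTemperateGrowth_weight τ))
      (memLp_annSymbol_mul_weight χ (by norm_num) (by norm_num) k τ),
    χ.conjOp_mulOp_lowPassMat hM,
    conjOp_FM ((χ.isHermitianSymbol_annSymbol 1 k).mul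
      (hc''.mul (isHermitianSymbol_weight (-τ - 1))))
      ((χ.hasTemperateGrowth_annSymbol le_rfl k).mul (hc'.mul (hasTemperateGrowth_weight _)))
      (χ.memLp_annSymbol_mul hc τ k)]

theorem ParaQuantization.conjOp_rhsOp (Q : ParaQuantization n)
    {A : Fin n → Rn n → Matrix (Fin m) (Fin m) ℝ} {Z : Rn n → Matrix (Fin m) (Fin m) ℝ} {a z : ℝ}
    (hA : ∀ j, IsCoeff (A j) a) (ha : 0 ≤ a) (hZ : IsCoeff Z z) (τ : ℝ) (v : L2 n m) :
    conjOp n m (Q.rhsOp A Z τ v) = Q.rhsOp A Z τ (conjOp n m v) := by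
  have h := fun v => (Q.hasSum_rhsOp_and_norm_le hA ha hZ τ).1 v
  refine (((conjOp n m).hasSum (h v)).congr_fun fun k => ?_).unique (h (conjOp n m v))
  simp only [rhsTerm]
  split_ifs
  · simp only [add_apply, sum_apply, map_add, map_sum]
    congr 1
    · refine Finset.sum_congr rfl fun j _ => ?_
      exact (Q.cutoff.conjOp_paraTerm (isFirstOrder_derivSymbol j)
        (hasTemperateGrowth_derivSymbol j) (isHermitianSymbol_derivSymbol j) (hA j) τ k _ v).symm
    · exact (Q.cutoff.conjOp_paraTerm isFirstOrder_one
        (Function.HasTemperateGrowth.const 1) isHermitianSymbol_one hZ τ k _ v).symm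
  · simp

/-- Evolutions by the paradifferential equation are invariant under complex conjugation. -/
theorem IsEvolution.conj {Q : ParaQuantization n}
    {𝒜 : Fin n → RVec m → Matrix (Fin m) (Fin m) ℝ} {T A τ : ℝ}
    {u : ℝ → Rn n → RVec m} {Du : ℝ → Rn n → (Rn n →L[ℝ] RVec m)} (hu : IsBackground T A u Du)
    (h_smooth : ∀ j a b, ContDiff ℝ ∞ (fun V => 𝒜 j V a b)) {v₀ : L2 n m} {v : ℝ → L2 n m}
    (hv : IsEvolution T (FM m (weight (-1))) (Q.generator 𝒜 u Du τ) v₀ v)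
    (hi : IntervalIntegrable (fun s => Q.generator 𝒜 u Du τ s (v s)) volume 0 T) :
    IsEvolution T (FM m (weight (-1))) (Q.generator 𝒜 u Du τ) (conjOp n m v₀)
      (fun t => conjOp n m (v t)) := by
  obtain ⟨K, hK0, hK⟩ := exists_bound_coefficients h_smooth A
  have hS := fun x : L2 n m => conjOp_FM (isHermitianSymbol_weight (-1))
    (hasTemperateGrowth_weight (n := n) (-1)) (memLp_weight (by norm_num)) x
  refine ⟨(conjOp n m).continuous.comp_continuousOn hv.cont, by rw [hv.initial], fun t ht => ?_⟩
  have h0 : (0 : ℝ) ∈ Icc 0 T := ⟨le_rfl, ht.1.trans ht.2⟩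
  have h1 : conjOp n m (∫ s in (0 : ℝ)..t, Q.generator 𝒜 u Du τ s (v s)) =
      ∫ s in (0 : ℝ)..t, conjOp n m (Q.generator 𝒜 u Du τ s (v s)) :=
    (ContinuousLinearMap.intervalIntegral_comp_comm (conjOp n m)
      (intervalIntegrable_of_mem_Icc hi h0 ht)).symm
  rw [← hS, ← hS, hv.equation t ht, map_add]
  refine congrArg₂ (· + ·) rfl (h1.trans ?_)
  refine intervalIntegral.integral_congr_ae ?_
  refine ae_restrict_uIoc_of_Icc ?_ h0 ht
  filter_upwards [hu.ae_slice] with s hs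
  exact Q.conjOp_rhsOp (hs.isCoeff h_smooth hK0 hK) hK0
    (hs.isCoeff_zerothOrder h_smooth hK0 hK) τ (v s)

end

noncomputable section

/-! ### Well-posedness and the energy estimate -/

/-- A function whose increments are bounded by the integrals of `g` is absolutely continuous, with
derivative bounded by `g`. -/
theorem absolutelyContinuous_and_ae_deriv_le {f g : ℝ → ℝ} {T : ℝ} (hT : 0 ≤ T)
    (hg : IntervalIntegrable g volume 0 T)
    (hg0 : ∀ᵐ s ∂(volume.restrict (Icc 0 T)), 0 ≤ g s)
    (h : ∀ s ∈ Icc 0 T, ∀ t ∈ Icc 0 T, |f t - f s| ≤ |∫ r in s..t, g r|) :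
    AbsolutelyContinuousOnInterval f 0 T ∧
      ∀ᵐ t ∂(volume.restrict (Icc 0 T)), ∃ d, HasDerivAt f d t ∧ d ≤ g t := by
  have h0 : (0 : ℝ) ∈ Icc 0 T := ⟨le_rfl, hT⟩
  set G : ℝ → ℝ := fun t => ∫ r in (0 : ℝ)..t, g r with hG
  have hGsub : ∀ s ∈ Icc 0 T, ∀ t ∈ Icc 0 T, |f t - f s| ≤ |G t - G s| := by
    intro s hs t ht
    rw [hG]
    simp only
    rw [intervalIntegral.integral_interval_sub_left (intervalIntegrable_of_mem_Icc hg h0 ht)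
      (intervalIntegrable_of_mem_Icc hg h0 hs)]
    exact h s hs t ht
  have hac : AbsolutelyContinuousOnInterval f 0 T := by
    refine (hg.absolutelyContinuousOnInterval_intervalIntegral (c := 0)
      left_mem_uIcc).of_dist_le (C := 1) fun x hx y hy => ?_
    rw [uIcc_of_le hT] at hx hy
    rw [Real.dist_eq, Real.dist_eq, one_mul]
    exact hGsub y hy x hx
  refine ⟨hac, ?_⟩
  have hends : ∀ᵐ t : ℝ, t ≠ 0 ∧ t ≠ T :=
    (measure_eq_zero_iff_ae_notMem.mp (measure_singleton (0 : ℝ))).and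
      (measure_eq_zero_iff_ae_notMem.mp (measure_singleton T))
  filter_upwards [ae_restrict_of_ae hac.ae_differentiableAt, hg0, ae_restrict_of_ae hends,
    ae_restrict_of_ae hg.ae_hasDerivAt_integral, ae_restrict_mem measurableSet_Icc]
    with t h1 h2 ⟨h3, h4⟩ h5 ht
  have h6 : HasDerivAt f (deriv f t) t := (h1 (by rwa [uIcc_of_le hT])).hasDerivAt
  have h7 : HasDerivAt G (g t) t := h5 (by rwa [uIcc_of_le hT]) 0 left_mem_uIcc
  refine ⟨_, h6, (le_abs_self _).trans ?_⟩
  rw [← abs_of_nonneg h2]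
  refine le_of_tendsto_of_tendsto h6.tendsto_slope.abs h7.tendsto_slope.abs ?_
  have h8 : Icc 0 T ∈ 𝓝[≠] t := mem_nhdsWithin_of_mem_nhds
    (Icc_mem_nhds (lt_of_le_of_ne ht.1 (Ne.symm h3)) (lt_of_le_of_ne ht.2 h4))
  filter_upwards [h8] with s hs
  rw [slope_def_field, slope_def_field, abs_div, abs_div]
  exact div_le_div_of_nonneg_right (hGsub t ht s hs) (abs_nonneg _)

end

theorem propositionp {n m : ℕ} (Q : ParaQuantization n)
    (𝒜 : Fin n → RVec m → Matrix (Fin m) (Fin m) ℝ)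
    (h_smooth : ∀ j a b, ContDiff ℝ ∞ (fun V => 𝒜 j V a b))
    (h_symm : ∀ j V, (𝒜 j V).IsSymm) (σ A : ℝ) :
    ∃ C : ℝ, ∀ (T : ℝ) (u : ℝ → Rn n → RVec m) (Du : ℝ → Rn n → (Rn n →L[ℝ] RVec m)),
      0 < T → IsBackground T A u Du →
      HadamardWellPosed σ T (IsParaSolution Q 𝒜 T u Du σ) ∧
      ∀ w₀ w, IsParaSolution Q 𝒜 T u Du σ w₀ w →
        (AbsolutelyContinuousOnInterval (fun t => sobolevNorm σ (w t) ^ 2) 0 T ∧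
          ∀ᵐ t ∂(volume.restrict (Icc 0 T)), ∃ d : ℝ,
            HasDerivAt (fun s => sobolevNorm σ (w s) ^ 2) d t ∧
            d ≤ C * (controlB Du t).toReal * sobolevNorm σ (w t) ^ 2) ∧
        (IsRealDistribution w₀ → ∀ t ∈ Icc 0 T, IsRealDistribution (w t)) := by
  obtain ⟨C₁, hC₁, h₁⟩ := Q.exists_energyGenerator h_smooth h_symm (σ - 1) A
  obtain ⟨C₂, hC₂, h₂⟩ := Q.exists_energyGenerator h_smooth h_symm σ A
  obtain ⟨C₃, hC₃, h₃⟩ := Q.exists_energyGenerator h_smooth h_symm (σ + 1) A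
  set C := C₁ + C₂ + C₃ with hC
  refine ⟨2 * C, fun T u Du hT' hu => ?_⟩
  have hT := hT'.le
  -- the equation in `H^σ` is an evolution equation in `L²`; the generators of the equations in
  -- `H^(σ+1)` and `H^(σ+2)` provide smooth solutions
  have hR := Q.cutoff.regularization (m := m)
  have hΓ := h₁ T u Du hT hu C (by linarith)
  have hΓ₁ := h₂ T u Du hT hu C (by linarith)
  have hΓ₂ := h₃ T u Du hT hu C (by linarith)
  have h01 := Q.weight_comp_generator h_smooth hu (σ - 1)
  have h12 := Q.weight_comp_generator h_smooth hu σ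
  rw [sub_add_cancel] at h01
  have hi : ∀ v : ℝ → L2 n m, ContinuousOn v (Icc 0 T) →
      IntervalIntegrable (fun s => Q.generator 𝒜 u Du (σ - 1) s (v s)) volume 0 T := fun v hv =>
    intervalIntegrable_clm_apply hT hΓ.measurable hΓ.integrable_β hΓ.norm_le hv
  have hdiff : ∀ {v₀ v₀' : L2 n m} {v v' : ℝ → L2 n m},
      IsEvolution T (FM m (weight (-1))) (Q.generator 𝒜 u Du (σ - 1)) v₀ v →
      IsEvolution T (FM m (weight (-1))) (Q.generator 𝒜 u Du (σ - 1)) v₀' v' →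
      ∀ t ∈ Icc 0 T, ‖v' t - v t‖ ^ 2 ≤ ‖v₀' - v₀‖ ^ 2 *
        Real.exp (∫ s in (0 : ℝ)..T, 2 * (C * (controlB Du s).toReal)) :=
    fun hv hv' t ht => (hv'.sub hv hT hΓ).norm_sq_le hT hR hΓ ht
  refine ⟨⟨fun w₀ hw₀ => ?_, fun w₀ w w' hw hw' t ht => ?_, fun w₀ hw₀ ε hε => ?_⟩,
    fun w₀ w hw => ?_⟩
  · obtain ⟨v₀, rfl⟩ := exists_sobolevEmb_eq hw₀
    obtain ⟨v, hv⟩ := exists_isEvolution hT hR hΓ hΓ₂ hΓ₁.norm_le h01 h12 v₀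
    exact ⟨_, hv.isParaSolution hu hT h_smooth (hi v hv.cont)⟩
  · obtain ⟨v₀, v, hv₀, hv, hve⟩ := hw.exists_isEvolution hu hT h_smooth hi
    obtain ⟨v₀', v', hv₀', hv', hve'⟩ := hw'.exists_isEvolution hu hT h_smooth hi
    have h4 : v₀' = v₀ := sobolevEmb_injective σ (hv₀'.trans hv₀.symm)
    have h5 := hdiff hve hve' t ht
    rw [h4, sub_self, norm_zero, zero_pow two_ne_zero, zero_mul] at h5
    rw [hv t ht, hv' t ht, sub_eq_zero.mp (norm_eq_zero.mp (pow_eq_zero_iff two_ne_zero |>.mp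
      (le_antisymm h5 (sq_nonneg _))))]
  · set E := ∫ s in (0 : ℝ)..T, 2 * (C * (controlB Du s).toReal) with hE
    refine ⟨ε * Real.exp (-(E / 2)), by positivity, fun w₀' w w' hw hw' hδ t ht => ?_⟩
    obtain ⟨v₀, v, hv₀, hv, hve⟩ := hw.exists_isEvolution hu hT h_smooth hi
    obtain ⟨v₀', v', hv₀', hv', hve'⟩ := hw'.exists_isEvolution hu hT h_smooth hi
    rw [← hv₀, ← hv₀', ← map_sub, sobolevNorm_sobolevEmb] at hδ
    rw [hv t ht, hv' t ht, ← map_sub, sobolevNorm_sobolevEmb]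
    refine lt_of_pow_lt_pow_left₀ 2 hε.le ((hdiff hve hve' t ht).trans_lt ?_)
    calc ‖v₀' - v₀‖ ^ 2 * Real.exp E < (ε * Real.exp (-(E / 2))) ^ 2 * Real.exp E := by gcongr
      _ = ε ^ 2 := by
        rw [mul_pow, ← Real.exp_nat_mul, mul_assoc, ← Real.exp_add]
        simp [mul_div_cancel₀]
  · obtain ⟨v₀, v, hv₀, hv, hve⟩ := hw.exists_isEvolution hu hT h_smooth hi
    have hnorm : ∀ t ∈ Icc 0 T, sobolevNorm σ (w t) = ‖v t‖ := fun t ht => by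
      rw [hv t ht, sobolevNorm_sobolevEmb]
    refine ⟨?_, fun hreal t ht => ?_⟩
    · have hint : IntervalIntegrable
          (fun r => 2 * (C * (controlB Du r).toReal) * ‖v r‖ ^ 2) volume 0 T :=
        (hΓ.integrable_b.const_mul 2).mul_continuousOn (by
          rw [uIcc_of_le hT]; exact hve.cont.norm.pow 2)
      have h4 := absolutelyContinuous_and_ae_deriv_le (f := fun t => sobolevNorm σ (w t) ^ 2) hT
        hint ?_ fun s hs t ht => ?_
      · refine ⟨h4.1, ?_⟩
        filter_upwards [h4.2, ae_restrict_mem measurableSet_Icc] with t ⟨d, hd, hd'⟩ ht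
        refine ⟨d, hd, hd'.trans (le_of_eq ?_)⟩
        rw [hnorm t ht]; ring
      · filter_upwards [hΓ.b_nonneg] with s hs
        positivity
      · simp only [hnorm t ht, hnorm s hs]
        exact hve.abs_norm_sq_sub_le hT hR hΓ hs ht
    · rw [← hv₀, isRealDistribution_sobolevEmb_iff] at hreal
      rw [hv t ht, isRealDistribution_sobolevEmb_iff]
      have h5 := hdiff hve (hve.conj hu h_smooth (hi v hve.cont)) t ht
      rw [hreal, sub_self, norm_zero, zero_pow two_ne_zero, zero_mul] at h5
      exact sub_eq_zero.mp (norm_eq_zero.mp (pow_eq_zero_iff two_ne_zero |>.mp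
        (le_antisymm h5 (sq_nonneg _))))
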